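/- Let $M$ be a smooth manifold (finite-dimensional, Hausdorff, second countable, without boundary), and let $\tau:E\to M$ be a smooth vector bundle of finite rank. A \emph{skew algebroid} structure on $E$ is an $\mathbb R$-bilinear skew-symmetric bracket $[\cdot,\cdot]$ on smooth sections together with a smooth vector bundle morphism $\rho:E\to TM$ such that $[X,fY]=f[X,Y]+\rho(X)(f)\,Y$. It is \emph{almost-Lie} if $\rho([X,Y])=[\rho(X),\rho(Y)]_{TM}$, and a \emph{Lie algebroid} if moreover the bracket satisfies the Jacobi identity. In bundle coordinates $(x^a,y^i)$ let $\rho^a_i(x)$ and $c^k_{ij}(x)$ be its structure functions, $\rho(e_i)=\rho^a_i\partial_{x^a}$, $[e_i,e_j]=c^k_{ij}e_k$. Let $E$ be almost-Lie, let $L:E\to\mathbb R$ be smooth, let $t_0<t_1$ and $1\le k\le\infty$. All curves are defined on $[t_0,t_1]$ and are of class $C^k$ up to the end-points. Let $\gamma\sim(x(t),y(t))$ be a curve in $E$ that solves the Euler--Lagrange equation $$\frac{d}{dt}\lambda_L(\gamma(t))=\Lambda_L(\gamma(t)),$$ where $\lambda_L:E\to E^*$ and $\Lambda_L:E\to TE^*$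 are given by $\lambda_L(x,y)=(x^a,\partial L/\partial y^j)$ and $$\Lambda_L(x,y)=\Big(x^a,\ \frac{\partial L}{\partial y^j},\ \rho^b_i y^i,\ c^k_{ij}y^i\frac{\partial L}{\partial y^k}+\rho^a_j\frac{\partial L}{\partial x^a}\Big).$$ Let $E_{\tau\circ\gamma}$ be the vector space of sections of $E$ along $\tau\circ\gamma$, and $E^0_{\tau\circ\gamma}$ the subspace of those that vanish at $t_0$ and $t_1$. For $\eta\sim h^i(t)$ in $E_{\tau\circ\gamma}$ the \emph{admissible variation} $\delta_\eta\gamma(t)\in T_{\gamma(t)}E$ is the vector with components $\big(\rho^a_ih^i,\ \dot h^j+c^j_{kl}y^kh^l\big)$. The section $\eta$ is a \emph{Jacobi vector field} along $\gamma$ if $$\frac{d}{dt}\,T\lambda_L(\delta_\eta\gamma(t))=\kappa_{E^*}\big(T\Lambda_L(\delta_\eta\gamma(t))\big),$$ where $\kappa_Q$ denotes the canonical involution of $TTQ$. The \emph{multiplicity} of $\gamma(t_0),\gamma(t_1)$ as conjugate points along $\gamma$ is the (possibly infinite) dimension of the space of Jacobi vector fields in $E^0_{\tau\circ\gamma}$;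 the two points are \emph{conjugate} if this space is non-zero. For $\eta\in E_{\tau\circ\gamma}$ and $\xi\in E^0_{\tau\circ\gamma}$ the \emph{second variation} of the action $S_L(\gamma)=\int_{t_0}^{t_1}L(\gamma(t))\,dt$ is $$\delta^2S_L(\gamma)(\eta,\xi)=\int_{t_0}^{t_1}d_T^2L\big(\delta_{(\Delta\xi,\eta)}\gamma(t)\big)\,dt,\qquad \delta_{(\Delta\xi,\eta)}\gamma=\kappa_E\big(\delta_{\Delta\xi}(\delta_\eta\gamma)\big).$$ Here $\Delta\xi$ is any curve in $TE$ over $\xi$ with $T\tau\circ\Delta\xi=\rho(\eta)$ whose values at $t_0,t_1$ are null vectors of the bundle $T\tau:TE\to TM$. The admissible variation $\delta_{\Delta\xi}(\delta_\eta\gamma)$ is formed in the tangent lift algebroid $d_TE$ on $T\tau:TE\to TM$, whose anchor and bracket in the base coordinates $(x,\dot x)$ and fibre coordinates $(y,\dot y)$ are $(y,\dot y)\mapsto\big(\rho y,\ (\partial_{\dot x}\rho)y+\rho\dot y\big)$ and $\big((y,\dot y),(z,\dot z)\big)\mapsto\big(c(y,z),\ (\partial_{\dot x}c)(y,z)+c(\dot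 y,z)+c(y,\dot z)\big)$. Finally $d_Tg:TQ\to\mathbb R$, $d_Tg(v)=\langle dg,v\rangle$, is the tangent lift of a function $g$ on $Q$, and $d_T^2=d_T\circ d_T$. Then the following hold. 1. $\delta^2S_L(\gamma)$ is a well-defined bilinear form on $E_{\tau\circ\gamma}\times E^0_{\tau\circ\gamma}$: for all $\eta,\xi$ a curve $\Delta\xi$ as above exists, for each such $\Delta\xi$ the integrand is integrable, the integral does not depend on the choice of $\Delta\xi$, and it is bilinear in $(\eta,\xi)$. 2. A section $\eta\in E_{\tau\circ\gamma}$ is a Jacobi vector field along $\gamma$ if and only if $\delta^2S_L(\gamma)(\eta,\xi)=0$ for every $\xi\in E^0_{\tau\circ\gamma}$. 3. If $E$ is a Lie algebroid, then the restriction of $\delta^2S_L(\gamma)$ to $E^0_{\tau\circ\gamma}\times E^0_{\tau\circ\gamma}$ is symmetric. Its null space is exactly the set of Jacobi vector fields along $\gamma$ that vanish at $t_0$ and $t_1$, so its dimension equals the multiplicity of $\gamma(t_0),\gamma(t_1)$ as conjugate points along $\gamma$, and $\gamma(t_0),\gamma(t_1)$ are conjugate along $\gamma$ if and only if it is non-trivial.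 -/

import Mathlib

open Set Bundle
open scoped Manifold ContDiff Topology

noncomputable section

/-! ### Calculus on vector spaces

`W × W` is the tangent bundle of a vector space `W`, an element being (point, velocity). -/

section Calculus

variable {W W' : Type*} [NormedAddCommGroup W] [NormedSpace ℝ W]
  [NormedAddCommGroup W'] [NormedSpace ℝ W']

/-- The tangent map `T g` of a map between vector spaces. -/
def tangentPush (g : W → W') (X : W × W) : W' × W' := (g X.1, fderiv ℝ g X.1 X.2)

/-- The tangent lift `d_T g : T W → ℝ` of a function, `d_T g (X) = ⟨dg, X⟩`. -/
def tangentLiftFun (g : W → ℝ) (X : W × W) : ℝ := fderiv ℝ g X.1 X.2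

/-- The canonical involution `κ_W` of `T T W`:
`(q, q̇, δq, δq̇) ↦ (q, δq, q̇, δq̇)`. -/
def canonicalFlip (A : (W × W) × (W × W)) : (W × W) × (W × W) :=
  ((A.1.1, A.2.1), (A.1.2, A.2.2))

end Calculus

/-! ### Skew algebroids in bundle coordinates

`B` is the model of the base, `F` the typical fibre; `B × F` stands for (a coordinate domain of)
the bundle `E`, and `B × (F →L[ℝ] ℝ)` for its dual `E*`. -/

/-- The structure functions `ρ(x)` and `c(x)` of a skew algebroid in bundle coordinates:
`ρ(x) y = ρᵃᵢ(x) yⁱ` and `c(x) y z = cᵏᵢⱼ(x) yⁱ zʲ`. -/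
structure CoordAlgebroid (B F : Type*) [NormedAddCommGroup B] [NormedSpace ℝ B]
    [NormedAddCommGroup F] [NormedSpace ℝ F] where
  anchor : B → F →L[ℝ] B
  bracket : B → F →L[ℝ] F →L[ℝ] F

namespace CoordAlgebroid

variable {B F : Type*} [NormedAddCommGroup B] [NormedSpace ℝ B]
  [NormedAddCommGroup F] [NormedSpace ℝ F]

/-- The relation `κ ⊂ T E × T E`, evaluated on velocities `ξ̇ = (x, f, ρ(x) y, f')` of a curve
over `x` and read at the point `(x, y)`: the `κ`-related vector at `(x, y)` has the components
`(ρ(x) f, f' + c(x)(y, f))`. -/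
def kappa (A : CoordAlgebroid B F) (x : B) (y f f' : F) : B × F :=
  (A.anchor x f, f' + A.bracket x y f)

/-- The tangent lift `d_T E` of an algebroid, a bundle `T E → T M` with base coordinates `(x, ẋ)`
and fibre coordinates `(y, ẏ)`. Its anchor is `κ_M ∘ T ρ`, its bivector is `d_T Π`. -/
def lift (A : CoordAlgebroid B F) : CoordAlgebroid (B × B) (F × F) where
  anchor X :=
    (A.anchor X.1 ∘L ContinuousLinearMap.fst ℝ F F).prod
      (fderiv ℝ A.anchor X.1 X.2 ∘L ContinuousLinearMap.fst ℝ F F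
        + A.anchor X.1 ∘L ContinuousLinearMap.snd ℝ F F)
  bracket X :=
    ContinuousLinearMap.compL ℝ (F × F) F (F × F) (ContinuousLinearMap.inl ℝ F F) ∘L
      (A.bracket X.1).bilinearComp (ContinuousLinearMap.fst ℝ F F)
        (ContinuousLinearMap.fst ℝ F F)
    + ContinuousLinearMap.compL ℝ (F × F) F (F × F) (ContinuousLinearMap.inr ℝ F F) ∘L
      ((fderiv ℝ A.bracket X.1 X.2).bilinearComp (ContinuousLinearMap.fst ℝ F F)
          (ContinuousLinearMap.fst ℝ F F)
        + (A.bracket X.1).bilinearComp (ContinuousLinearMap.snd ℝ F F)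
          (ContinuousLinearMap.fst ℝ F F)
        + (A.bracket X.1).bilinearComp (ContinuousLinearMap.fst ℝ F F)
          (ContinuousLinearMap.snd ℝ F F))

theorem lift_anchor_apply (A : CoordAlgebroid B F) (X : B × B) (Y : F × F) :
    A.lift.anchor X Y =
      (A.anchor X.1 Y.1, fderiv ℝ A.anchor X.1 X.2 Y.1 + A.anchor X.1 Y.2) := by
  simp [lift]

theorem lift_bracket_apply (A : CoordAlgebroid B F) (X : B × B) (Y Z : F × F) :
    A.lift.bracket X Y Z =
      (A.bracket X.1 Y.1 Z.1,
        fderiv ℝ A.bracket X.1 X.2 Y.1 Z.1 + A.bracket X.1 Y.2 Z.1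
          + A.bracket X.1 Y.1 Z.2) := by
  simp [lift]

/-- The Legendre map `λ_ℓ : E → E*`, `(x, y) ↦ (x, ∂ℓ/∂y)`. -/
def legendre (ℓ : B × F → ℝ) (p : B × F) : B × (F →L[ℝ] ℝ) :=
  (p.1, fderiv ℝ ℓ p ∘L ContinuousLinearMap.inr ℝ B F)

/-- The Tulczyjew differential `Λ_ℓ = ε ∘ dℓ : E → T E*`,
`(x, y) ↦ (x, ∂ℓ/∂y; ρ(x) y, ⟨∂ℓ/∂y, c(x)(y, ·)⟩ + ⟨∂ℓ/∂x, ρ(x) ·⟩)`. -/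
def tulczyjew (A : CoordAlgebroid B F) (ℓ : B × F → ℝ) (p : B × F) :
    (B × (F →L[ℝ] ℝ)) × (B × (F →L[ℝ] ℝ)) :=
  (legendre ℓ p,
    (A.anchor p.1 p.2,
      (fderiv ℝ ℓ p ∘L ContinuousLinearMap.inr ℝ B F) ∘L A.bracket p.1 p.2
        + (fderiv ℝ ℓ p ∘L ContinuousLinearMap.inl ℝ B F) ∘L A.anchor p.1))

/-- The vector `δ_{(Δξ,η)} γ = κ_E (δ_{Δξ} (δ_η γ))` of `T T E`, where `p = (x, y)` is the value of
`γ`, `δη` is the value of `δ_η γ ∈ T_γ E`, `Ξ = ((x, f), (Δx, Δf))` is the value of `Δξ ∈ T_ξ E` and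
`Ξ'` its time derivative. Here `δ_{Δξ} (δ_η γ)` is formed in the lifted algebroid. -/
def secondVector (A : CoordAlgebroid B F) (p δη : B × F) (Ξ Ξ' : (B × F) × (B × F)) :
    ((B × F) × (B × F)) × ((B × F) × (B × F)) :=
  let D : (B × B) × (F × F) :=
    A.lift.kappa (p.1, δη.1) (p.2, δη.2) (Ξ.1.2, Ξ.2.2) (Ξ'.1.2, Ξ'.2.2)
  canonicalFlip ((p, δη), ((D.1.1, D.2.1), (D.1.2, D.2.2)))

end CoordAlgebroid

/-! ### Algebroids

`M` is a smooth manifold without boundary modelled on the finite-dimensional space `V`, and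
`E` is a smooth vector bundle over `M` with typical fibre `F`. -/

section Algebroid

variable {V : Type*} [NormedAddCommGroup V] [NormedSpace ℝ V]
  {F : Type*} [NormedAddCommGroup F] [NormedSpace ℝ F]
  {M : Type*} [TopologicalSpace M] [ChartedSpace V M]
  {E : M → Type*} [∀ x, AddCommGroup (E x)] [∀ x, Module ℝ (E x)]
  [∀ x, TopologicalSpace (E x)] [TopologicalSpace (TotalSpace F E)]
  [FiberBundle F E] [VectorBundle ℝ F E]

/-- The product `f • X` of a smooth function and a smooth section. -/
def smoothSMul (f : M → ℝ) (hf : ContMDiff 𝓘(ℝ, V) 𝓘(ℝ, ℝ) ∞ f)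
    (X : ContMDiffSection 𝓘(ℝ, V) F ∞ E) : ContMDiffSection 𝓘(ℝ, V) F ∞ E :=
  ⟨fun x => f x • X x, hf.smul_section X.contMDiff⟩

/-- The derivative `v(f)` of a function along a tangent vector. -/
def derivAlong (f : M → ℝ) (x : M) (v : TangentSpace 𝓘(ℝ, V) x) : ℝ :=
  mfderiv 𝓘(ℝ, V) 𝓘(ℝ, ℝ) f x v

variable [IsManifold 𝓘(ℝ, V) ∞ M]

variable (V F E) in
/-- A skew-symmetric algebroid structure on the vector bundle `E`. -/
structure SkewAlgebroid where
  anchor : ∀ x : M, E x →L[ℝ] TangentSpace 𝓘(ℝ, V) x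
  contMDiff_anchor : ContMDiff (𝓘(ℝ, V).prod 𝓘(ℝ, F)) (𝓘(ℝ, V).prod 𝓘(ℝ, V)) ∞
    (fun v : TotalSpace F E =>
      (⟨v.proj, anchor v.proj v.snd⟩ : TangentBundle 𝓘(ℝ, V) M))
  bracket : ContMDiffSection 𝓘(ℝ, V) F ∞ E →ₗ[ℝ] ContMDiffSection 𝓘(ℝ, V) F ∞ E →ₗ[ℝ]
    ContMDiffSection 𝓘(ℝ, V) F ∞ E
  bracket_skew : ∀ X Y, bracket X Y = -bracket Y X
  leibniz : ∀ (X Y : ContMDiffSection 𝓘(ℝ, V) F ∞ E) (f : M → ℝ)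
    (hf : ContMDiff 𝓘(ℝ, V) 𝓘(ℝ, ℝ) ∞ f) (x : M),
    bracket X (smoothSMul f hf Y) x =
      f x • bracket X Y x + derivAlong f x (anchor x (X x)) • Y x

namespace SkewAlgebroid

/-- Almost-Lie algebroids: the anchor maps the bracket to the Lie bracket of vector fields. -/
def IsAlmostLie (A : SkewAlgebroid V F E) : Prop :=
  ∀ (X Y : ContMDiffSection 𝓘(ℝ, V) F ∞ E) (x : M),
    A.anchor x (A.bracket X Y x) =
      VectorField.mlieBracket 𝓘(ℝ, V) (fun z => A.anchor z (X z)) (fun z => A.anchor z (Y z)) x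

/-- Lie algebroids: almost-Lie, and the bracket satisfies the Jacobi identity. -/
def IsLie (A : SkewAlgebroid V F E) : Prop :=
  A.IsAlmostLie ∧ ∀ X Y Z : ContMDiffSection 𝓘(ℝ, V) F ∞ E,
    A.bracket (A.bracket X Y) Z + A.bracket (A.bracket Y Z) X
      + A.bracket (A.bracket Z X) Y = 0

end SkewAlgebroid

/-! ### Bundle coordinates -/

section LocalSection

variable [FiniteDimensional ℝ V] [T2Space M]
  [ContMDiffVectorBundle ∞ F E 𝓘(ℝ, V)]

variable (V F E) in
set_option linter.unusedSectionVars false in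
theorem exists_cutoff (x₀ : M) : ∃ f : SmoothBumpFunction 𝓘(ℝ, V) x₀,
    tsupport f ⊆ (trivializationAt F E x₀).baseSet := by
  have h := (trivializationAt F E x₀).open_baseSet.mem_nhds (mem_baseSet_trivializationAt F E x₀)
  obtain ⟨f, -, hf⟩ := (SmoothBumpFunction.nhds_basis_tsupport (I := 𝓘(ℝ, V)) x₀).mem_iff.1 h
  exact ⟨f, hf⟩

variable (V F E) in
/-- A smooth bump function at `x₀` (equal to `1` near `x₀`) supported in the domain of the
trivialization at `x₀`. -/
def cutoff (x₀ : M) : SmoothBumpFunction 𝓘(ℝ, V) x₀ := (exists_cutoff V F E x₀).choose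

variable (V E) in
/-- A global smooth section of `E` which near `x₀` is the constant section `u` in the
trivialization at `x₀`. -/
def constSection (x₀ : M) (u : F) : ContMDiffSection 𝓘(ℝ, V) F ∞ E where
  toFun x := cutoff V F E x₀ x • (trivializationAt F E x₀).symmL ℝ x u
  contMDiff_toFun := by
    refine ContMDiffOn.smul_section_of_tsupport (u := (trivializationAt F E x₀).baseSet)
      (ψ := cutoff V F E x₀)
      (s := fun x => (trivializationAt F E x₀).symmL ℝ x u)
      (cutoff V F E x₀).contMDiff.contMDiffOn (trivializationAt F E x₀).open_baseSet
      (exists_cutoff V F E x₀).choose_spec ?_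
    rw [Bundle.Trivialization.contMDiffOn_section_baseSet_iff (e := trivializationAt F E x₀)]
    refine (contMDiffOn_const (c := u)).congr fun x hx => ?_
    rw [Bundle.Trivialization.symmL_apply _ hx]
    exact congrArg Prod.snd ((trivializationAt F E x₀).apply_mk_symm hx u)

variable (V E) in
theorem constSection_add (x₀ : M) (u w : F) :
    constSection V E x₀ (u + w) = constSection V E x₀ u + constSection V E x₀ w := by
  ext x
  change cutoff V F E x₀ x • (trivializationAt F E x₀).symmL ℝ x (u + w) =
    cutoff V F E x₀ x • (trivializationAt F E x₀).symmL ℝ x u +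
      cutoff V F E x₀ x • (trivializationAt F E x₀).symmL ℝ x w
  rw [map_add, smul_add]

variable (V E) in
theorem constSection_smul (x₀ : M) (r : ℝ) (u : F) :
    constSection V E x₀ (r • u) = r • constSection V E x₀ u := by
  ext x
  change cutoff V F E x₀ x • (trivializationAt F E x₀).symmL ℝ x (r • u) =
    r • cutoff V F E x₀ x • (trivializationAt F E x₀).symmL ℝ x u
  rw [map_smul, smul_comm]

namespace SkewAlgebroid

variable [FiniteDimensional ℝ F]

/-- The structure functions of the algebroid in the bundle coordinates at `x₀`, that is, in the
preferred chart of `M` and the preferred trivialization of `E` at `x₀`. The bracket coefficients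
`c(x)(u, w) = [u, w](x)`, for the constant local sections `u` and `w`, are correct for `x` near
`x₀`; they are used only there. -/
def coord (A : SkewAlgebroid V F E) (x₀ : M) : CoordAlgebroid V F where
  anchor q :=
    let x := (extChartAt 𝓘(ℝ, V) x₀).symm q
    mfderiv 𝓘(ℝ, V) 𝓘(ℝ, V) (extChartAt 𝓘(ℝ, V) x₀) x ∘L A.anchor x ∘L
      (trivializationAt F E x₀).symmL ℝ x
  bracket q :=
    let x := (extChartAt 𝓘(ℝ, V) x₀).symm q
    LinearMap.toContinuousBilinearMap (LinearMap.mk₂ ℝ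
      (fun u w => (trivializationAt F E x₀).continuousLinearMapAt ℝ x
        (A.bracket (constSection V E x₀ u) (constSection V E x₀ w) x))
      (fun u u' w => by simp [constSection_add])
      (fun r u w => by simp [constSection_smul])
      (fun u w w' => by simp [constSection_add])
      (fun r u w => by simp [constSection_smul]))

end SkewAlgebroid

end LocalSection

variable (V F E) in
/-- The bundle coordinates `(x, y)` of `E` at `x₀`: the preferred chart of the total space. -/
def bundleChart (x₀ : M) : PartialEquiv (TotalSpace F E) (V × F) :=
  extChartAt (𝓘(ℝ, V).prod 𝓘(ℝ, F)) (zeroSection F E x₀)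

/-! ### Curves -/

/-- The extension of a curve on `[t₀, t₁]` to `ℝ` that is constant on both sides. -/
def extendCurve {X : Type*} {t₀ t₁ : ℝ} (h : t₀ < t₁) (γ : Icc t₀ t₁ → X) : ℝ → X :=
  IccExtend h.le γ

/-- A section of `E` along the base path of `γ`, as a curve in the total space. -/
def sectionCurve {t₀ t₁ : ℝ} {γ : Icc t₀ t₁ → TotalSpace F E} (η : ∀ t, E (γ t).proj) :
    Icc t₀ t₁ → TotalSpace F E :=
  fun t => ⟨(γ t).proj, η t⟩

variable (V) in
/-- Curves `[t₀, t₁] → E` of class `C^k` (up to the end-points). -/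
def IsCkCurve (k : ℕ∞) {t₀ t₁ : ℝ} (h : t₀ < t₁) (γ : Icc t₀ t₁ → TotalSpace F E) : Prop :=
  ContMDiffOn 𝓘(ℝ, ℝ) (𝓘(ℝ, V).prod 𝓘(ℝ, F)) k (extendCurve h γ) (Icc t₀ t₁)

variable (V) in
/-- The space `E_{τ∘γ}` of `C^k` sections of `E` along the base path of the `C^k` curve `γ`. -/
def sectionsAlong (k : ℕ∞) {t₀ t₁ : ℝ} (h : t₀ < t₁) (γ : Icc t₀ t₁ → TotalSpace F E)
    (hγ : IsCkCurve V k h γ) : Submodule ℝ (∀ t, E (γ t).proj) where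
  carrier := {η | IsCkCurve V k h (sectionCurve η)}
  add_mem' := by
    intro η ζ hη hζ t ht
    have h1 := contMDiffWithinAt_totalSpace.1 (hη t ht)
    have h2 := contMDiffWithinAt_totalSpace.1 (hζ t ht)
    refine contMDiffWithinAt_totalSpace.2 ⟨h1.1, ?_⟩
    refine (h1.2.add h2.2).congr_of_eventuallyEq_of_mem ?_ ht
    have hc := h1.1.continuousWithinAt.preimage_mem_nhdsWithin
      ((trivializationAt F E _).open_baseSet.mem_nhds
        (mem_baseSet_trivializationAt F E _))
    filter_upwards [hc] with s hs
    exact ((trivializationAt F E _).linear ℝ hs).map_add _ _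
  zero_mem' := by
    have hb : ContMDiffOn 𝓘(ℝ, ℝ) 𝓘(ℝ, V) k (fun s => (extendCurve h γ s).proj) (Icc t₀ t₁) :=
      fun t ht => (contMDiffWithinAt_totalSpace.1 (hγ t ht)).1
    exact (contMDiff_zeroSection ℝ E).comp_contMDiffOn hb
  smul_mem' := by
    intro r η hη t ht
    have h1 := contMDiffWithinAt_totalSpace.1 (hη t ht)
    refine contMDiffWithinAt_totalSpace.2 ⟨h1.1, ?_⟩
    refine ((contMDiffWithinAt_const : ContMDiffWithinAt 𝓘(ℝ, ℝ) 𝓘(ℝ, ℝ) k (fun _ : ℝ => r)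
      (Icc t₀ t₁) t).smul h1.2).congr_of_eventuallyEq_of_mem ?_ ht
    have hc := h1.1.continuousWithinAt.preimage_mem_nhdsWithin
      ((trivializationAt F E _).open_baseSet.mem_nhds
        (mem_baseSet_trivializationAt F E _))
    filter_upwards [hc] with s hs
    exact ((trivializationAt F E _).linear ℝ hs).map_smul _ _

variable (V) in
/-- The space `E⁰_{τ∘γ}` of those sections along `τ∘γ` that vanish at the end-points. -/
def sectionsAlongZero (k : ℕ∞) {t₀ t₁ : ℝ} (h : t₀ < t₁) (γ : Icc t₀ t₁ → TotalSpace F E)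
    (hγ : IsCkCurve V k h γ) : Submodule ℝ (sectionsAlong V k h γ hγ) where
  carrier := {η | η.1 ⟨t₀, left_mem_Icc.2 h.le⟩ = 0 ∧ η.1 ⟨t₁, right_mem_Icc.2 h.le⟩ = 0}
  add_mem' := by
    intro η ζ hη hζ
    exact ⟨by simp [hη.1, hζ.1], by simp [hη.2, hζ.2]⟩
  zero_mem' := ⟨rfl, rfl⟩
  smul_mem' := by
    intro r η hη
    exact ⟨by simp [hη.1], by simp [hη.2]⟩

/-! ### Euler–Lagrange equation, Jacobi fields, second variation

All equations below are equations between tangent vectors at a point over `x₀ = τ(γ(t))`; they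
are written in the bundle coordinates at this `x₀`. -/

namespace SkewAlgebroid

variable [FiniteDimensional ℝ V] [T2Space M]
  [ContMDiffVectorBundle ∞ F E 𝓘(ℝ, V)] [FiniteDimensional ℝ F]

variable (A : SkewAlgebroid V F E) (L : TotalSpace F E → ℝ)

variable (V) in
/-- The Lagrangian in the bundle coordinates at `x₀`. -/
def coordLagrangian (x₀ : M) (p : V × F) : ℝ := L ((bundleChart V F E x₀).symm p)

variable (V) in
/-- The curve `γ` in the bundle coordinates at `x₀`. -/
def coordCurve (x₀ : M) {t₀ t₁ : ℝ} (h : t₀ < t₁) (γ : Icc t₀ t₁ → TotalSpace F E) (s : ℝ) :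
    V × F :=
  bundleChart V F E x₀ (extendCurve h γ s)

/-- The Euler–Lagrange equation `d/dt (λ_L(γ(t))) = Λ_L(γ(t))` on `[t₀, t₁]`. -/
def IsELSolution {t₀ t₁ : ℝ} (h : t₀ < t₁) (γ : Icc t₀ t₁ → TotalSpace F E) : Prop :=
  ∀ t : Icc t₀ t₁,
    let x₀ := (γ t).proj
    let ℓ := coordLagrangian V L x₀
    let γc := coordCurve V x₀ h γ
    HasDerivWithinAt (fun s => CoordAlgebroid.legendre ℓ (γc s))
      ((A.coord x₀).tulczyjew ℓ (γc t)).2 (Icc t₀ t₁) t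

/-- The infinitesimal admissible variation `δ_η γ (s) = κ_γ(η̇(s)) ∈ T_{γ(s)} E`, in the bundle
coordinates at `x₀`, for `γ(s)` over a neighbourhood of `x₀`. -/
def coordVariation (x₀ : M) {t₀ t₁ : ℝ} (h : t₀ < t₁) (γ : Icc t₀ t₁ → TotalSpace F E)
    (η : ∀ t, E (γ t).proj) (s : ℝ) : V × F :=
  let γc := coordCurve V x₀ h γ
  let ηc := coordCurve V x₀ h (sectionCurve η)
  (A.coord x₀).kappa (γc s).1 (γc s).2 (ηc s).2 (derivWithin ηc (Icc t₀ t₁) s).2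

/-- `η` is a Jacobi vector field along `γ`: the Jacobi equation
`d/dt (T λ_L (δ_η γ(t))) = κ_{E*} (T Λ_L (δ_η γ(t)))` holds on `[t₀, t₁]`. -/
def IsJacobiField {t₀ t₁ : ℝ} (h : t₀ < t₁) (γ : Icc t₀ t₁ → TotalSpace F E)
    (η : ∀ t, E (γ t).proj) : Prop :=
  ∀ t : Icc t₀ t₁,
    let x₀ := (γ t).proj
    let ℓ := coordLagrangian V L x₀
    let J : ℝ → (V × F) × (V × F) := fun s =>
      (coordCurve V x₀ h γ s, A.coordVariation x₀ h γ η s)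
    HasDerivWithinAt (fun s => tangentPush (CoordAlgebroid.legendre ℓ) (J s))
      (canonicalFlip (tangentPush ((A.coord x₀).tulczyjew ℓ) (J t))).2 (Icc t₀ t₁) t

/-- `Δ` is an admissible choice of `Δξ` for the pair `(η, ξ)`: a `C^k` curve in `T E` over the
curve `ξ`, with `T τ ∘ Δξ = ρ(η)`, whose values at the end-points are null vectors of
`T τ : T E → T M`. -/
structure IsGeneratorLift (k : ℕ∞) {t₀ t₁ : ℝ} (h : t₀ < t₁) (γ : Icc t₀ t₁ → TotalSpace F E)
    (η ξ : ∀ t, E (γ t).proj)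
    (Δ : Icc t₀ t₁ → TangentBundle (𝓘(ℝ, V).prod 𝓘(ℝ, F)) (TotalSpace F E)) : Prop where
  contMDiffOn : ContMDiffOn 𝓘(ℝ, ℝ) (𝓘(ℝ, V).prod 𝓘(ℝ, F)).tangent k (extendCurve h Δ)
    (Icc t₀ t₁)
  proj_eq : ∀ t, (Δ t).proj = sectionCurve ξ t
  base : ∀ t, tangentMap (𝓘(ℝ, V).prod 𝓘(ℝ, F)) 𝓘(ℝ, V) (TotalSpace.proj (F := F) (E := E)) (Δ t) =
    ⟨(γ t).proj, A.anchor (γ t).proj (η t)⟩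
  null : ∀ t : Icc t₀ t₁, (t : ℝ) = t₀ ∨ (t : ℝ) = t₁ →
    Δ t = tangentMap 𝓘(ℝ, V) (𝓘(ℝ, V).prod 𝓘(ℝ, F)) (zeroSection F E)
      ⟨(γ t).proj, A.anchor (γ t).proj (η t)⟩

/-- The curve `Δ` in `T E` in the coordinates `((x, y), (ẋ, ẏ))` induced by the bundle coordinates
at `x₀`. -/
def coordLift (x₀ : M) {t₀ t₁ : ℝ} (h : t₀ < t₁)
    (Δ : Icc t₀ t₁ → TangentBundle (𝓘(ℝ, V).prod 𝓘(ℝ, F)) (TotalSpace F E)) (s : ℝ) :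
    (V × F) × (V × F) :=
  extChartAt (𝓘(ℝ, V).prod 𝓘(ℝ, F)).tangent
    (⟨zeroSection F E x₀, 0⟩ : TangentBundle (𝓘(ℝ, V).prod 𝓘(ℝ, F)) (TotalSpace F E))
    (extendCurve h Δ s)

/-- The integrand `d_T² L (δ_{(Δξ,η)} γ (t))` of the second variation. -/
def secondVariationIntegrand {t₀ t₁ : ℝ} (h : t₀ < t₁) (γ : Icc t₀ t₁ → TotalSpace F E)
    (η : ∀ t, E (γ t).proj)
    (Δ : Icc t₀ t₁ → TangentBundle (𝓘(ℝ, V).prod 𝓘(ℝ, F)) (TotalSpace F E))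
    (t : ℝ) : ℝ :=
  let x₀ := (extendCurve h γ t).proj
  let Ξ := coordLift x₀ h Δ
  tangentLiftFun (tangentLiftFun (coordLagrangian V L x₀))
    ((A.coord x₀).secondVector (coordCurve V x₀ h γ t) (A.coordVariation x₀ h γ η t)
      (Ξ t) (derivWithin Ξ (Icc t₀ t₁) t))

/-- The bilinear form `b` on `E_{τ∘γ} × E⁰_{τ∘γ}` is the second variation `δ²S_L(γ)`:
for all `η` and `ξ` there is an admissible choice of `Δξ`, and for every such choice
`b η ξ` is the (existing) integral `∫ d_T² L (δ_{(Δξ,η)} γ(t)) dt`. -/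
def IsSecondVariation (k : ℕ∞) {t₀ t₁ : ℝ} (h : t₀ < t₁) (γ : Icc t₀ t₁ → TotalSpace F E)
    (hγ : IsCkCurve V k h γ)
    (b : sectionsAlong V k h γ hγ →ₗ[ℝ] sectionsAlongZero V k h γ hγ →ₗ[ℝ] ℝ) : Prop :=
  ∀ (η : sectionsAlong V k h γ hγ) (ξ : sectionsAlongZero V k h γ hγ),
    (∃ Δ, A.IsGeneratorLift k h γ η.1 ξ.1.1 Δ) ∧
    ∀ Δ, A.IsGeneratorLift k h γ η.1 ξ.1.1 Δ →
      IntervalIntegrable (A.secondVariationIntegrand L h γ η.1 Δ) MeasureTheory.volume t₀ t₁ ∧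
      b η ξ = ∫ t in t₀..t₁, A.secondVariationIntegrand L h γ η.1 Δ t

/-- The set of Jacobi vector fields along `γ` vanishing at the end-points. -/
def jacobiFieldsZero (k : ℕ∞) {t₀ t₁ : ℝ} (h : t₀ < t₁) (γ : Icc t₀ t₁ → TotalSpace F E)
    (hγ : IsCkCurve V k h γ) : Set (sectionsAlongZero V k h γ hγ) :=
  {η | A.IsJacobiField L h γ η.1.1}

/-- `γ(t₀)` and `γ(t₁)` are conjugate along `γ`. -/
def AreConjugate (k : ℕ∞) {t₀ t₁ : ℝ} (h : t₀ < t₁) (γ : Icc t₀ t₁ → TotalSpace F E)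
    (hγ : IsCkCurve V k h γ) : Prop :=
  ∃ η ∈ A.jacobiFieldsZero L k h γ hγ, η ≠ 0

/-- The multiplicity of `γ(t₀)`, `γ(t₁)` as conjugate points: the dimension of the space of Jacobi
vector fields vanishing at the end-points (the Jacobi equation being linear, the span is that set
itself). The dimension is a cardinal, since it may be infinite. -/
def conjugateMultiplicity (k : ℕ∞) {t₀ t₁ : ℝ} (h : t₀ < t₁) (γ : Icc t₀ t₁ → TotalSpace F E)
    (hγ : IsCkCurve V k h γ) : Cardinal :=
  Module.rank ℝ (Submodule.span ℝ (A.jacobiFieldsZero L k h γ hγ))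

end SkewAlgebroid

end Algebroid

end

/-! Everything is governed by one function of `Z = ((x, y), (f, f'))`, the first variation `Φ(Z) =
⟨dℓ, κ(Z)⟩` (`firstVar`). It is linear in `(f, f')`, namely `Φ = ⟨p, f'⟩ + ⟨R, f⟩`, where the
momentum `p = ∂ℓ/∂y` and the force `R` are the fibre components of `λ_L` and `Λ_L`. The
Euler–Lagrange equation thus says `ẋ = ρ(x) y` and `ṗ = R`.

The tangent lift algebroid is obtained by differentiating the structure functions, so its `κ` is the
tangent map of `κ`. Hence (`SmoothAt.secondVariation_eq`) the integrand of the second variation is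
the derivative of `Φ` at `(γ, (ξ, ξ̇))` in the direction `(δ_η γ, (Δ, Δ̇))`, where `Δ` is the
vertical component of `Δξ`: `⟨Dp·δ_ηγ, ξ̇⟩ + ⟨DR·δ_ηγ, ξ⟩ + ⟨p, Δ̇⟩ + ⟨R, Δ⟩`. By the Euler–Lagrange
equation the last two terms are `d/dt ⟨p, Δ⟩`. As `Δ` vanishes at the end-points, the choice of `Δξ`
does not matter. The momentum component of the Jacobi equation is `d/dt (Dp·δ_ηγ) = DR·δ_ηγ`; the
other components hold automatically. Integration by parts then shows that Jacobi fields annihilate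
all `ξ`. The converse is the lemma of du Bois-Reymond, which is needed because `Dp·δ_ηγ` is a priori
only continuous.

The expressions above are not separately tensorial, and the integrand at time `t` is computed in the
chart centred at `τ(γ(t))`. `CoordChange.integrand_eq` shows that any other chart gives the same
value. Here the almost-Lie identity enters: the second order part of `Δξ` picks up `d/dt ρ(η)` under
a change of chart, and this must agree with the derivative of `ρ(x) y` along `δ_ηγ`. Boundary terms
that are invariant under changes of chart can then be integrated along the whole curve
(`integral_eq_of_charts`).

Lifts `Δξ` exist because horizontal lifts in charts can be averaged with a partition of unity in
time. The resulting lift has vertical component bilinear in `(η, ξ)`, which gives bilinearity of the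
form.

For a Lie algebroid, exchanging `η` and `ξ` leaves the Hessian of `ℓ` unchanged. The almost-Lie and
Jacobi identities turn the remaining terms into `d/dt ⟨p, c(η, ξ)⟩` (`LieAt.fderiv_momentum_sub`),
so the form is symmetric on sections vanishing at the ends. Its null space is described by the
equivalence with the Jacobi equation. -/

noncomputable section

/-! ### First and second variation in one coordinate system. -/

namespace CoordAlgebroid

variable {B F : Type*} [NormedAddCommGroup B] [NormedSpace ℝ B]
  [NormedAddCommGroup F] [NormedSpace ℝ F]

/-- The momentum `∂ℓ/∂y`. -/
def momentum (ℓ : B × F → ℝ) (p : B × F) : F →L[ℝ] ℝ :=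
  fderiv ℝ ℓ p ∘L ContinuousLinearMap.inr ℝ B F

/-- The fibre component `⟨∂ℓ/∂y, c(x)(y, ·)⟩ + ⟨∂ℓ/∂x, ρ(x) ·⟩` of the Tulczyjew differential. -/
def force (A : CoordAlgebroid B F) (ℓ : B × F → ℝ) (p : B × F) : F →L[ℝ] ℝ :=
  (fderiv ℝ ℓ p ∘L ContinuousLinearMap.inr ℝ B F) ∘L A.bracket p.1 p.2
    + (fderiv ℝ ℓ p ∘L ContinuousLinearMap.inl ℝ B F) ∘L A.anchor p.1

/-- `kappa` as a map of the joint variable `((x, y), (f, f'))`. -/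
def kappaMap (A : CoordAlgebroid B F) (Z : (B × F) × (F × F)) : B × F :=
  A.kappa Z.1.1 Z.1.2 Z.2.1 Z.2.2

/-- The first variation `⟨dℓ, κ⟩` as a function of `((x, y), (f, f'))`. -/
def firstVar (A : CoordAlgebroid B F) (ℓ : B × F → ℝ) (Z : (B × F) × (F × F)) : ℝ :=
  fderiv ℝ ℓ Z.1 (A.kappaMap Z)

/-- Smoothness of the structure functions at a point. -/
structure SmoothAt (A : CoordAlgebroid B F) (x : B) : Prop where
  anchor : ContDiffAt ℝ ∞ A.anchor x
  bracket : ContDiffAt ℝ ∞ A.bracket x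

/-- Linearity in `(f, f')` separates the momentum from the force, the two quantities that the
Euler–Lagrange equation relates by `ṗ = R`. -/
theorem firstVar_eq (A : CoordAlgebroid B F) (ℓ : B × F → ℝ) (Z : (B × F) × (F × F)) :
    A.firstVar ℓ Z = momentum ℓ Z.1 Z.2.2 + A.force ℓ Z.1 Z.2.1 := by
  have h : A.kappaMap Z = ContinuousLinearMap.inr ℝ B F Z.2.2
      + ContinuousLinearMap.inr ℝ B F (A.bracket Z.1.1 Z.1.2 Z.2.1)
      + ContinuousLinearMap.inl ℝ B F (A.anchor Z.1.1 Z.2.1) := by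
    simp [kappaMap, kappa]
  rw [firstVar, h]
  simp only [map_add, momentum, force, ContinuousLinearMap.comp_apply,
    _root_.add_apply]
  ring

section Smooth

theorem _root_.ContDiffAt.fderiv_infty {W W' : Type*} [NormedAddCommGroup W] [NormedSpace ℝ W]
    [NormedAddCommGroup W'] [NormedSpace ℝ W'] {f : W → W'} {w : W} (h : ContDiffAt ℝ ∞ f w) :
    ContDiffAt ℝ ∞ (fderiv ℝ f) w :=
  h.fderiv_right (by simp)

theorem _root_.ContDiffAt.differentiableAt_infty {W W' : Type*} [NormedAddCommGroup W]
    [NormedSpace ℝ W] [NormedAddCommGroup W'] [NormedSpace ℝ W'] {f : W → W'} {w : W}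
    (h : ContDiffAt ℝ ∞ f w) : DifferentiableAt ℝ f w :=
  h.differentiableAt (by simp)

theorem _root_.ContDiffAt.eventually_infty {W W' : Type*} [NormedAddCommGroup W]
    [NormedSpace ℝ W] [NormedAddCommGroup W'] [NormedSpace ℝ W'] {f : W → W'} {w : W}
    (h : ContDiffAt ℝ ∞ f w) : ∀ᶠ z in 𝓝 w, DifferentiableAt ℝ f z := by
  filter_upwards [(h.of_le (m := 1) (by simp)).eventually (by simp)] with z hz
  exact hz.differentiableAt (by simp)

variable {A : CoordAlgebroid B F} {ℓ : B × F → ℝ}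

theorem contDiffAt_momentum {p : B × F} (hℓ : ContDiffAt ℝ ∞ ℓ p) :
    ContDiffAt ℝ ∞ (momentum ℓ) p :=
  hℓ.fderiv_infty.clm_comp contDiffAt_const

theorem SmoothAt.contDiffAt_force {p : B × F} (hA : A.SmoothAt p.1) (hℓ : ContDiffAt ℝ ∞ ℓ p) :
    ContDiffAt ℝ ∞ (A.force ℓ) p := by
  have h1 : ContDiffAt ℝ ∞ (fun p : B × F => A.bracket p.1) p := hA.bracket.comp p contDiffAt_fst
  have h2 : ContDiffAt ℝ ∞ (fun p : B × F => A.anchor p.1) p := hA.anchor.comp p contDiffAt_fst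
  exact ((hℓ.fderiv_infty.clm_comp contDiffAt_const).clm_comp (h1.clm_apply contDiffAt_snd)).add
    ((hℓ.fderiv_infty.clm_comp contDiffAt_const).clm_comp h2)

theorem SmoothAt.contDiffAt_kappaMap {Z : (B × F) × (F × F)} (hA : A.SmoothAt Z.1.1) :
    ContDiffAt ℝ ∞ A.kappaMap Z := by
  have h1 : ContDiffAt ℝ ∞ (fun Z : (B × F) × (F × F) => A.bracket Z.1.1) Z :=
    hA.bracket.comp Z (contDiffAt_fst.fst)
  have h2 : ContDiffAt ℝ ∞ (fun Z : (B × F) × (F × F) => A.anchor Z.1.1) Z :=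
    hA.anchor.comp Z (contDiffAt_fst.fst)
  exact (h2.clm_apply contDiffAt_snd.fst).prodMk
    (contDiffAt_snd.snd.add ((h1.clm_apply contDiffAt_fst.snd).clm_apply contDiffAt_snd.fst))

theorem SmoothAt.contDiffAt_firstVar {Z : (B × F) × (F × F)} (hA : A.SmoothAt Z.1.1)
    (hℓ : ContDiffAt ℝ ∞ ℓ Z.1) : ContDiffAt ℝ ∞ (A.firstVar ℓ) Z := by
  have h1 : ContDiffAt ℝ ∞ (fun Z : (B × F) × (F × F) => fderiv ℝ ℓ Z.1) Z :=
    hℓ.fderiv_infty.comp Z contDiffAt_fst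
  exact h1.clm_apply hA.contDiffAt_kappaMap

-- The product rule produces exactly the anchor and bracket of the lifted algebroid: this derivative
-- is `κ` of `A.lift` up to the order of components.
set_option synthInstance.maxHeartbeats 400000 in
theorem SmoothAt.fderiv_kappaMap {Z : (B × F) × (F × F)} (hA : A.SmoothAt Z.1.1)
    (W : (B × F) × (F × F)) :
    fderiv ℝ A.kappaMap Z W =
      (fderiv ℝ A.anchor Z.1.1 W.1.1 Z.2.1 + A.anchor Z.1.1 W.2.1,
        W.2.2 + (fderiv ℝ A.bracket Z.1.1 W.1.1 Z.1.2 Z.2.1 + A.bracket Z.1.1 W.1.2 Z.2.1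
          + A.bracket Z.1.1 Z.1.2 W.2.1)) := by
  have h11 : HasFDerivAt (fun Z : (B × F) × (F × F) => Z.1.1) _ Z :=
    (ContinuousLinearMap.fst ℝ B F ∘L ContinuousLinearMap.fst ℝ (B × F) (F × F)).hasFDerivAt
  have h12 : HasFDerivAt (fun Z : (B × F) × (F × F) => Z.1.2) _ Z :=
    (ContinuousLinearMap.snd ℝ B F ∘L ContinuousLinearMap.fst ℝ (B × F) (F × F)).hasFDerivAt
  have h21 : HasFDerivAt (fun Z : (B × F) × (F × F) => Z.2.1) _ Z :=
    (ContinuousLinearMap.fst ℝ F F ∘L ContinuousLinearMap.snd ℝ (B × F) (F × F)).hasFDerivAt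
  have h22 : HasFDerivAt (fun Z : (B × F) × (F × F) => Z.2.2) _ Z :=
    (ContinuousLinearMap.snd ℝ F F ∘L ContinuousLinearMap.snd ℝ (B × F) (F × F)).hasFDerivAt
  have ha := hA.anchor.differentiableAt_infty.hasFDerivAt.comp Z h11
  have hb := hA.bracket.differentiableAt_infty.hasFDerivAt.comp Z h11
  have := (ha.clm_apply h21).prodMk (h22.add ((hb.clm_apply h12).clm_apply h21))
  have e : fderiv ℝ A.kappaMap Z = _ := this.fderiv
  rw [e]
  simp
  constructor <;> abel

theorem SmoothAt.fderiv_firstVar {Z : (B × F) × (F × F)} (hA : A.SmoothAt Z.1.1)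
    (hℓ : ContDiffAt ℝ ∞ ℓ Z.1) (W : (B × F) × (F × F)) :
    fderiv ℝ (A.firstVar ℓ) Z W =
      (fderiv ℝ (momentum ℓ) Z.1 W.1 Z.2.2 + momentum ℓ Z.1 W.2.2)
        + (fderiv ℝ (A.force ℓ) Z.1 W.1 Z.2.1 + A.force ℓ Z.1 W.2.1) := by
  have h1 : HasFDerivAt (fun Z : (B × F) × (F × F) => Z.1) _ Z :=
    (ContinuousLinearMap.fst ℝ (B × F) (F × F)).hasFDerivAt
  have h21 : HasFDerivAt (fun Z : (B × F) × (F × F) => Z.2.1) _ Z :=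
    (ContinuousLinearMap.fst ℝ F F ∘L ContinuousLinearMap.snd ℝ (B × F) (F × F)).hasFDerivAt
  have h22 : HasFDerivAt (fun Z : (B × F) × (F × F) => Z.2.2) _ Z :=
    (ContinuousLinearMap.snd ℝ F F ∘L ContinuousLinearMap.snd ℝ (B × F) (F × F)).hasFDerivAt
  have hm := (contDiffAt_momentum hℓ).differentiableAt_infty.hasFDerivAt.comp Z h1
  have hf := (hA.contDiffAt_force hℓ).differentiableAt_infty.hasFDerivAt.comp Z h1
  have := (hm.clm_apply h22).add (hf.clm_apply h21)
  have e : A.firstVar ℓ = _ := funext (A.firstVar_eq ℓ)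
  rw [e]
  refine (congrArg (fun T => T W) this.fderiv).trans ?_
  simp
  ring

/-- `firstVar ℓ` is `tangentLiftFun ℓ` composed with `Z ↦ (Z.1, κ(Z))`. Since `κ` of the lifted
algebroid is the tangent map of `κ`, the flipped vector is the derivative of this map in the stated
direction, and the chain rule applies. -/
theorem SmoothAt.secondVariation_eq {p δ : B × F} {Ξ Ξ' : (B × F) × (B × F)} (hA : A.SmoothAt p.1)
    (hℓ : ContDiffAt ℝ ∞ ℓ p) :
    tangentLiftFun (tangentLiftFun ℓ) (A.secondVector p δ Ξ Ξ') =
      fderiv ℝ (A.firstVar ℓ) (p, (Ξ.1.2, Ξ'.1.2)) (δ, (Ξ.2.2, Ξ'.2.2)) := by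
  set Z : (B × F) × (F × F) := (p, (Ξ.1.2, Ξ'.1.2)) with hZ
  have hA' : A.SmoothAt Z.1.1 := hA
  have hk := hA'.contDiffAt_kappaMap.differentiableAt_infty.hasFDerivAt
  have hd : DifferentiableAt ℝ (tangentLiftFun ℓ) (Z.1, A.kappaMap Z) := by
    have h1 : ContDiffAt ℝ ∞ (fun X : (B × F) × (B × F) => fderiv ℝ ℓ X.1) (Z.1, A.kappaMap Z) :=
      ContDiffAt.comp (Z.1, A.kappaMap Z) (g := fderiv ℝ ℓ) hℓ.fderiv_infty contDiffAt_fst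
    exact (h1.clm_apply contDiffAt_snd).differentiableAt_infty
  have hc := hd.hasFDerivAt.comp Z (hasFDerivAt_fst.prodMk hk)
  have e : fderiv ℝ (A.firstVar ℓ) Z = _ := hc.fderiv
  rw [e, ContinuousLinearMap.comp_apply]
  conv_lhs => rw [tangentLiftFun]
  congr 1
  · simp [secondVector, canonicalFlip, kappaMap, kappa, lift_anchor_apply, lift_bracket_apply, hZ]
  · rw [ContinuousLinearMap.prod_apply, hA'.fderiv_kappaMap]
    simp [secondVector, canonicalFlip, kappa, lift_anchor_apply, lift_bracket_apply, hZ]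

end Smooth

/-! ### Transformation laws under a change of bundle coordinates. -/

/-- The bundle map `(x, y) ↦ (ψ x, g(x) y)`. -/
def fiberMap (ψ : B → B) (g : B → F →L[ℝ] F) (p : B × F) : B × F := (ψ p.1, g p.1 p.2)

/-- The structure functions `A₀`, `A₁` are related near `x` by the change of bundle coordinates
`(x, y) ↦ (ψ x, g(x) y)`. -/
structure CoordChange (A₀ A₁ : CoordAlgebroid B F) (ψ : B → B) (g : B → F →L[ℝ] F) (x : B) :
    Prop where
  base : ContDiffAt ℝ ∞ ψ x
  fiber : ContDiffAt ℝ ∞ g x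
  smooth_left : A₀.SmoothAt x
  smooth_right : A₁.SmoothAt (ψ x)
  anchor : ∀ᶠ z in 𝓝 x, ∀ y, A₁.anchor (ψ z) (g z y) = fderiv ℝ ψ z (A₀.anchor z y)
  bracket : ∀ᶠ z in 𝓝 x, ∀ y w, g z (A₀.bracket z y w) =
    A₁.bracket (ψ z) (g z y) (g z w) + fderiv ℝ g z (A₀.anchor z y) w
      - fderiv ℝ g z (A₀.anchor z w) y

theorem contDiffAt_fiberMap {ψ : B → B} {g : B → F →L[ℝ] F} {p : B × F}
    (hψ : ContDiffAt ℝ ∞ ψ p.1) (hg : ContDiffAt ℝ ∞ g p.1) :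
    ContDiffAt ℝ ∞ (fiberMap ψ g) p := by
  have h1 : ContDiffAt ℝ ∞ (fun p : B × F => ψ p.1) p := hψ.comp p contDiffAt_fst
  have h2 : ContDiffAt ℝ ∞ (fun p : B × F => g p.1) p := hg.comp p contDiffAt_fst
  exact h1.prodMk (h2.clm_apply contDiffAt_snd)

theorem hasFDerivAt_fiberMap {ψ : B → B} {g : B → F →L[ℝ] F} {p : B × F}
    (hψ : DifferentiableAt ℝ ψ p.1) (hg : DifferentiableAt ℝ g p.1) :
    HasFDerivAt (fiberMap ψ g)
      ((fderiv ℝ ψ p.1 ∘L ContinuousLinearMap.fst ℝ B F).prod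
        (g p.1 ∘L ContinuousLinearMap.snd ℝ B F
          + (fderiv ℝ g p.1 ∘L ContinuousLinearMap.fst ℝ B F).flip p.2)) p := by
  have hψ' := hψ.hasFDerivAt.comp p (hasFDerivAt_fst (𝕜 := ℝ) (E := B) (F := F))
  have hg' := hg.hasFDerivAt.comp p (hasFDerivAt_fst (𝕜 := ℝ) (E := B) (F := F))
  exact hψ'.prodMk (hg'.clm_apply hasFDerivAt_snd)

theorem fderiv_fiberMap {ψ : B → B} {g : B → F →L[ℝ] F} {p : B × F}
    (hψ : DifferentiableAt ℝ ψ p.1) (hg : DifferentiableAt ℝ g p.1) (v : B × F) :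
    fderiv ℝ (fiberMap ψ g) p v = (fderiv ℝ ψ p.1 v.1, g p.1 v.2 + fderiv ℝ g p.1 v.1 p.2) := by
  rw [(hasFDerivAt_fiberMap hψ hg).fderiv]
  simp

namespace CoordChange

variable {A₀ A₁ : CoordAlgebroid B F} {ψ : B → B} {g : B → F →L[ℝ] F} {x : B}

/-- A curve `g(x) f` has the extra velocity `Dg(ρ y) f`. The inhomogeneous terms of the bracket law
trade it for `Dg(ρ f) y`, which is the term in the tangent map of `fiberMap`. So `κ`-related vectors
have an intrinsic meaning. -/
theorem kappa_eq (H : CoordChange A₀ A₁ ψ g x) :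
    ∀ᶠ z in 𝓝 x, ∀ y f f', A₁.kappa (ψ z) (g z y) (g z f) (g z f' + fderiv ℝ g z (A₀.anchor z y) f)
      = fderiv ℝ (fiberMap ψ g) (z, y) (A₀.kappa z y f f') := by
  filter_upwards [H.anchor, H.bracket, H.base.eventually_infty, H.fiber.eventually_infty]
    with z ha hb hψ hg y f f'
  rw [fderiv_fiberMap (p := (z, y)) hψ hg]
  simp only [kappa, ha, map_add, hb]
  ext1
  · rfl
  · simp only
    abel

/-- The change of the joint variable `((x, y), (f, f'))`. -/
def jointMap (A₀ : CoordAlgebroid B F) (ψ : B → B) (g : B → F →L[ℝ] F) (Z : (B × F) × (F × F)) :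
    (B × F) × (F × F) :=
  (fiberMap ψ g Z.1,
    (g Z.1.1 Z.2.1, g Z.1.1 Z.2.2 + fderiv ℝ g Z.1.1 (A₀.anchor Z.1.1 Z.1.2) Z.2.1))

variable {ℓ₀ ℓ₁ : B × F → ℝ} {y : F}

theorem fderiv_lagrangian (H : CoordChange A₀ A₁ ψ g x)
    (hℓ₁ : ContDiffAt ℝ ∞ ℓ₁ (fiberMap ψ g (x, y)))
    (hℓ : ∀ᶠ p in 𝓝 (x, y), ℓ₁ (fiberMap ψ g p) = ℓ₀ p) :
    ∀ᶠ p in 𝓝 (x, y), ∀ v, fderiv ℝ ℓ₁ (fiberMap ψ g p) (fderiv ℝ (fiberMap ψ g) p v)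
      = fderiv ℝ ℓ₀ p v := by
  have hφ : ContDiffAt ℝ ∞ (fiberMap ψ g) (x, y) := contDiffAt_fiberMap H.base H.fiber
  filter_upwards [hℓ.eventually_nhds, hφ.eventually_infty,
    hφ.continuousAt.eventually hℓ₁.eventually_infty] with p h1 h2 h3 v
  have : fderiv ℝ ℓ₀ p = fderiv ℝ (fun p => ℓ₁ (fiberMap ψ g p)) p :=
    (Filter.EventuallyEq.fderiv_eq h1).symm
  have h4 := (h3.hasFDerivAt.comp p h2.hasFDerivAt).fderiv
  rw [this]
  exact (congrArg (fun T => T v) h4).symm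

theorem firstVar_jointMap (H : CoordChange A₀ A₁ ψ g x)
    (hℓ₁ : ContDiffAt ℝ ∞ ℓ₁ (fiberMap ψ g (x, y)))
    (hℓ : ∀ᶠ p in 𝓝 (x, y), ℓ₁ (fiberMap ψ g p) = ℓ₀ p) (w : F × F) :
    ∀ᶠ Z in 𝓝 ((x, y), w), A₁.firstVar ℓ₁ (jointMap A₀ ψ g Z) = A₀.firstVar ℓ₀ Z := by
  have c1 : ContinuousAt (fun Z : (B × F) × (F × F) => Z.1) ((x, y), w) := continuousAt_fst
  have c2 : ContinuousAt (fun Z : (B × F) × (F × F) => Z.1.1) ((x, y), w) := continuousAt_fst.fst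
  filter_upwards [c1.eventually (H.fderiv_lagrangian hℓ₁ hℓ), c2.eventually H.kappa_eq]
    with Z h1 h2
  rw [firstVar, firstVar, ← h1]
  exact congrArg _ (h2 _ _ _)

theorem momentum_apply (H : CoordChange A₀ A₁ ψ g x)
    (hℓ₁ : ContDiffAt ℝ ∞ ℓ₁ (fiberMap ψ g (x, y)))
    (hℓ : ∀ᶠ p in 𝓝 (x, y), ℓ₁ (fiberMap ψ g p) = ℓ₀ p) :
    ∀ᶠ p in 𝓝 (x, y), ∀ f, momentum ℓ₁ (fiberMap ψ g p) (g p.1 f) = momentum ℓ₀ p f := by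
  have c1 : ContinuousAt (fun p : B × F => p.1) (x, y) := continuousAt_fst
  filter_upwards [H.fderiv_lagrangian hℓ₁ hℓ, c1.eventually H.base.eventually_infty,
    c1.eventually H.fiber.eventually_infty] with p h1 h2 h3 f
  simp [momentum, ← h1, fderiv_fiberMap h2 h3]

/-- Obtained by differentiating `momentum_apply` at fixed `f`. Neither summand is invariant alone:
`Dp·δ` produces a term in `Dg`, which the affine law for the vertical component `Δ` absorbs. The sum
is the boundary term used for Jacobi fields. -/
theorem fderiv_momentum_apply (H : CoordChange A₀ A₁ ψ g x)
    (hℓ₀ : ContDiffAt ℝ ∞ ℓ₀ (x, y))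
    (hℓ₁ : ContDiffAt ℝ ∞ ℓ₁ (fiberMap ψ g (x, y)))
    (hℓ : ∀ᶠ p in 𝓝 (x, y), ℓ₁ (fiberMap ψ g p) = ℓ₀ p) (δ : B × F) (f Δ : F) :
    fderiv ℝ (momentum ℓ₁) (fiberMap ψ g (x, y)) (fderiv ℝ (fiberMap ψ g) (x, y) δ) (g x f)
        + momentum ℓ₁ (fiberMap ψ g (x, y)) (fderiv ℝ g x δ.1 f + g x Δ)
      = fderiv ℝ (momentum ℓ₀) (x, y) δ f + momentum ℓ₀ (x, y) Δ := by
  have hφ : ContDiffAt ℝ ∞ (fiberMap ψ g) (x, y) := contDiffAt_fiberMap H.base H.fiber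
  have e1 : (fun p : B × F => momentum ℓ₁ (fiberMap ψ g p) (g p.1 f))
      =ᶠ[𝓝 (x, y)] fun p => momentum ℓ₀ p f := by
    filter_upwards [H.momentum_apply hℓ₁ hℓ] with p hp using hp f
  have e2 := (H.momentum_apply hℓ₁ hℓ).self_of_nhds Δ
  have h1 := (((contDiffAt_momentum hℓ₁).differentiableAt_infty.hasFDerivAt.comp (x, y)
    hφ.differentiableAt_infty.hasFDerivAt).clm_apply
    ((H.fiber.differentiableAt_infty.hasFDerivAt.comp (x, y)
      (hasFDerivAt_fst (𝕜 := ℝ) (E := B) (F := F))).clm_apply (hasFDerivAt_const f (x, y))))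
  have h2 := (contDiffAt_momentum hℓ₀).differentiableAt_infty.hasFDerivAt.clm_apply
    (hasFDerivAt_const f (x, y))
  have e3 := congrArg (fun T => T δ) ((h1.congr_of_eventuallyEq e1.symm).unique h2)
  simp only [_root_.add_apply, ContinuousLinearMap.comp_apply,
    ContinuousLinearMap.flip_apply, Function.comp_apply, ContinuousLinearMap.coe_fst',
    _root_.zero_apply, map_zero, zero_add] at e3
  simp only at e2
  rw [map_add, e2, ← e3]
  ring

end CoordChange

end CoordAlgebroid

/-! ### Invariance of the second variation integrand. -/

namespace CoordAlgebroid

variable {B F : Type*} [NormedAddCommGroup B] [NormedSpace ℝ B]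
  [NormedAddCommGroup F] [NormedSpace ℝ F]

section Components

variable {X Y : Type*} [NormedAddCommGroup X] [NormedSpace ℝ X]
  [NormedAddCommGroup Y] [NormedSpace ℝ Y] {S : Set ℝ} {s : ℝ}

theorem _root_.HasDerivWithinAt.prod_fst {f : ℝ → X × Y} {f' : X × Y}
    (h : HasDerivWithinAt f f' S s) : HasDerivWithinAt (fun r => (f r).1) f'.1 S s :=
  (ContinuousLinearMap.fst ℝ X Y).hasFDerivAt.comp_hasDerivWithinAt s h

theorem _root_.HasDerivWithinAt.prod_snd {f : ℝ → X × Y} {f' : X × Y}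
    (h : HasDerivWithinAt f f' S s) : HasDerivWithinAt (fun r => (f r).2) f'.2 S s :=
  (ContinuousLinearMap.snd ℝ X Y).hasFDerivAt.comp_hasDerivWithinAt s h

theorem _root_.HasDerivWithinAt.derivWithin_eq_of_eventuallyEq {f g : ℝ → X} {f' : X}
    (h : HasDerivWithinAt f f' S s) (hs : UniqueDiffWithinAt ℝ S s) (hsS : s ∈ S)
    (e : g =ᶠ[𝓝[S] s] f) : derivWithin g S s = f' :=
  (h.congr_of_eventuallyEq_of_mem e hsS).derivWithin hs

end Components

/-- The almost-Lie identity for the structure functions at a point. -/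
def AlmostLieAt (A : CoordAlgebroid B F) (x : B) : Prop :=
  ∀ y h, A.anchor x (A.bracket x y h) =
    fderiv ℝ A.anchor x (A.anchor x y) h - fderiv ℝ A.anchor x (A.anchor x h) y

/-- The variation of the curve `c` generated by the curve `e` over the same base path. -/
def curveVariation (A : CoordAlgebroid B F) (S : Set ℝ) (c e : ℝ → B × F) (s : ℝ) : B × F :=
  A.kappa (c s).1 (c s).2 (e s).2 (derivWithin e S s).2

/-- Differentiating `ρ(x) h` along `ẋ = ρ(x) y` gives `Dρ(ρ y) h + ρ ḣ`. The almost-Lie identity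
exchanges `Dρ(ρ y) h` for `Dρ(ρ h) y + ρ(c(y, h))`, so the result is the derivative of `ρ(x) y`
along the variation: admissible variations preserve the admissibility constraint to first order. -/
theorem AlmostLieAt.hasDerivWithinAt_anchor {A : CoordAlgebroid B F} {S : Set ℝ} {s : ℝ}
    {c e : ℝ → B × F} (hAL : A.AlmostLieAt (c s).1) (hA : A.SmoothAt (c s).1)
    (hc : HasDerivWithinAt (fun r => (c r).1) (A.anchor (c s).1 (c s).2) S s)
    (he : DifferentiableWithinAt ℝ e S s) :
    HasDerivWithinAt (fun r => A.anchor (c r).1 (e r).2)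
      (fderiv ℝ A.anchor (c s).1 (A.curveVariation S c e s).1 (c s).2
        + A.anchor (c s).1 (A.curveVariation S c e s).2) S s := by
  have h1 := hA.anchor.differentiableAt_infty.hasFDerivAt.comp_hasDerivWithinAt s hc
  have h2 := h1.clm_apply he.hasDerivWithinAt.prod_snd
  refine h2.congr_deriv ?_
  simp only [Function.comp_apply, curveVariation, kappa, map_add, hAL (c s).2 (e s).2]
  abel

namespace CoordChange

variable {A₀ A₁ : CoordAlgebroid B F} {ψ : B → B} {g : B → F →L[ℝ] F}
  {S : Set ℝ} {s : ℝ} {c₀ c₁ e₀ e₁ : ℝ → B × F}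

theorem derivWithin_curve (H : CoordChange A₀ A₁ ψ g (c₀ s).1)
    (hs : UniqueDiffWithinAt ℝ S s) (hsS : s ∈ S)
    (hc : HasDerivWithinAt (fun r => (c₀ r).1) (A₀.anchor (c₀ s).1 (c₀ s).2) S s)
    (he : DifferentiableWithinAt ℝ e₀ S s) (hce : ∀ᶠ r in 𝓝[S] s, (e₀ r).1 = (c₀ r).1)
    (he₁ : ∀ᶠ r in 𝓝[S] s, e₁ r = fiberMap ψ g (e₀ r)) :
    (derivWithin e₁ S s).2 = g (c₀ s).1 (derivWithin e₀ S s).2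
      + fderiv ℝ g (c₀ s).1 (A₀.anchor (c₀ s).1 (c₀ s).2) (e₀ s).2 := by
  have hes : (e₀ s).1 = (c₀ s).1 := hce.self_of_nhdsWithin hsS
  have hφ : DifferentiableAt ℝ (fiberMap ψ g) (e₀ s) :=
    (contDiffAt_fiberMap (hes ▸ H.base) (hes ▸ H.fiber)).differentiableAt_infty
  have h1 := hφ.hasFDerivAt.comp_hasDerivWithinAt s he.hasDerivWithinAt
  have h2 := h1.derivWithin_eq_of_eventuallyEq hs hsS (g := e₁) he₁
  -- Both curves have the same base path, so the base velocity of `e₀` is the admissible velocity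
  -- `ρ(x) y`.
  have h3 : (derivWithin e₀ S s).1 = A₀.anchor (c₀ s).1 (c₀ s).2 := by
    rw [← hc.derivWithin hs]
    exact (he.hasDerivWithinAt.prod_fst.derivWithin_eq_of_eventuallyEq hs hsS
      (hce.mono fun r hr => hr.symm)).symm
  rw [h2, fderiv_fiberMap, hes, h3]
  · exact hes ▸ H.base.differentiableAt_infty
  · exact hes ▸ H.fiber.differentiableAt_infty

theorem curveVariation_eq (H : CoordChange A₀ A₁ ψ g (c₀ s).1)
    (hs : UniqueDiffWithinAt ℝ S s) (hsS : s ∈ S)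
    (hc : HasDerivWithinAt (fun r => (c₀ r).1) (A₀.anchor (c₀ s).1 (c₀ s).2) S s)
    (he : DifferentiableWithinAt ℝ e₀ S s) (hce : ∀ᶠ r in 𝓝[S] s, (e₀ r).1 = (c₀ r).1)
    (hc₁ : c₁ s = fiberMap ψ g (c₀ s)) (he₁ : ∀ᶠ r in 𝓝[S] s, e₁ r = fiberMap ψ g (e₀ r)) :
    A₁.curveVariation S c₁ e₁ s =
      fderiv ℝ (fiberMap ψ g) (c₀ s) (A₀.curveVariation S c₀ e₀ s) := by
  have hes : (e₀ s).1 = (c₀ s).1 := hce.self_of_nhdsWithin hsS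
  have h1 := H.derivWithin_curve hs hsS hc he hce he₁
  have h2 : e₁ s = fiberMap ψ g (e₀ s) := he₁.self_of_nhdsWithin hsS
  rw [curveVariation, h1, h2, hc₁]
  simp only [fiberMap, hes]
  exact H.kappa_eq.self_of_nhds _ _ _

set_option synthInstance.maxHeartbeats 400000 in
theorem fderiv_jointMap (H : CoordChange A₀ A₁ ψ g (c₀ s).1) (w : F × F)
    (W : (B × F) × (F × F)) :
    fderiv ℝ (jointMap A₀ ψ g) (c₀ s, w) W =
      (fderiv ℝ (fiberMap ψ g) (c₀ s) W.1,
        (g (c₀ s).1 W.2.1 + fderiv ℝ g (c₀ s).1 W.1.1 w.1,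
          g (c₀ s).1 W.2.2 + fderiv ℝ g (c₀ s).1 W.1.1 w.2
            + (fderiv ℝ (fderiv ℝ g) (c₀ s).1 W.1.1 (A₀.anchor (c₀ s).1 (c₀ s).2) w.1
              + fderiv ℝ g (c₀ s).1 (fderiv ℝ A₀.anchor (c₀ s).1 W.1.1 (c₀ s).2
                + A₀.anchor (c₀ s).1 W.1.2) w.1
              + fderiv ℝ g (c₀ s).1 (A₀.anchor (c₀ s).1 (c₀ s).2) W.2.1))) := by
  have h1 : HasFDerivAt (fun Z : (B × F) × (F × F) => Z.1) _ (c₀ s, w) :=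
    (ContinuousLinearMap.fst ℝ (B × F) (F × F)).hasFDerivAt
  have h11 : HasFDerivAt (fun Z : (B × F) × (F × F) => Z.1.1) _ (c₀ s, w) :=
    (ContinuousLinearMap.fst ℝ B F ∘L ContinuousLinearMap.fst ℝ (B × F) (F × F)).hasFDerivAt
  have h12 : HasFDerivAt (fun Z : (B × F) × (F × F) => Z.1.2) _ (c₀ s, w) :=
    (ContinuousLinearMap.snd ℝ B F ∘L ContinuousLinearMap.fst ℝ (B × F) (F × F)).hasFDerivAt
  have h21 : HasFDerivAt (fun Z : (B × F) × (F × F) => Z.2.1) _ (c₀ s, w) :=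
    (ContinuousLinearMap.fst ℝ F F ∘L ContinuousLinearMap.snd ℝ (B × F) (F × F)).hasFDerivAt
  have h22 : HasFDerivAt (fun Z : (B × F) × (F × F) => Z.2.2) _ (c₀ s, w) :=
    (ContinuousLinearMap.snd ℝ F F ∘L ContinuousLinearMap.snd ℝ (B × F) (F × F)).hasFDerivAt
  have hφ := (contDiffAt_fiberMap (p := c₀ s) H.base
    H.fiber).differentiableAt_infty.hasFDerivAt.comp (c₀ s, w) h1
  have hg := H.fiber.differentiableAt_infty.hasFDerivAt.comp (c₀ s, w) h11
  have hg' := H.fiber.fderiv_infty.differentiableAt_infty.hasFDerivAt.comp (c₀ s, w) h11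
  have ha := H.smooth_left.anchor.differentiableAt_infty.hasFDerivAt.comp (c₀ s, w) h11
  have := hφ.prodMk ((hg.clm_apply h21).prodMk
    ((hg.clm_apply h22).add ((hg'.clm_apply (ha.clm_apply h12)).clm_apply h21)))
  refine (congrArg (fun T => T W) this.fderiv).trans ?_
  simp
  abel

variable {ℓ₀ ℓ₁ : B × F → ℝ} {Ξ₀ Ξ₁ : ℝ → (B × F) × (B × F)}

-- The vertical component changes by `Δ ↦ g Δ + Dg(ρ h) f`. Its time derivative contains `d/dt
-- ρ(h)`, which the almost-Lie identity rewrites in terms of the variation.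
set_option synthInstance.maxHeartbeats 400000 in
theorem derivWithin_lift (H : CoordChange A₀ A₁ ψ g (c₀ s).1) (hAL : A₀.AlmostLieAt (c₀ s).1)
    (hs : UniqueDiffWithinAt ℝ S s) (hsS : s ∈ S)
    (hc : HasDerivWithinAt (fun r => (c₀ r).1) (A₀.anchor (c₀ s).1 (c₀ s).2) S s)
    (he : DifferentiableWithinAt ℝ e₀ S s)
    (hΞ : DifferentiableWithinAt ℝ Ξ₀ S s)
    (hΞ1 : ∀ᶠ r in 𝓝[S] s, (Ξ₀ r).1.1 = (c₀ r).1)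
    (hΞ2 : ∀ᶠ r in 𝓝[S] s, (Ξ₀ r).2.1 = A₀.anchor (c₀ r).1 (e₀ r).2)
    (hΞ₁ : ∀ᶠ r in 𝓝[S] s, Ξ₁ r = tangentPush (fiberMap ψ g) (Ξ₀ r)) :
    (derivWithin Ξ₁ S s).2.2 =
      fderiv ℝ g (c₀ s).1 (A₀.anchor (c₀ s).1 (c₀ s).2) (Ξ₀ s).2.2
        + g (c₀ s).1 (derivWithin Ξ₀ S s).2.2
        + (fderiv ℝ (fderiv ℝ g) (c₀ s).1 (A₀.anchor (c₀ s).1 (c₀ s).2)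
              (A₀.anchor (c₀ s).1 (e₀ s).2) (Ξ₀ s).1.2
            + fderiv ℝ g (c₀ s).1
              (fderiv ℝ A₀.anchor (c₀ s).1 (A₀.curveVariation S c₀ e₀ s).1 (c₀ s).2
                + A₀.anchor (c₀ s).1 (A₀.curveVariation S c₀ e₀ s).2) (Ξ₀ s).1.2
            + fderiv ℝ g (c₀ s).1 (A₀.anchor (c₀ s).1 (e₀ s).2) (derivWithin Ξ₀ S s).1.2) := by
  have hes : (Ξ₀ s).1.1 = (c₀ s).1 := hΞ1.self_of_nhdsWithin hsS
  have hφ : ContDiffAt ℝ ∞ (fiberMap ψ g) (Ξ₀ s).1 :=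
    contDiffAt_fiberMap (hes ▸ H.base) (hes ▸ H.fiber)
  have hT : ContDiffAt ℝ ∞ (tangentPush (fiberMap ψ g)) (Ξ₀ s) :=
    (hφ.comp (Ξ₀ s) contDiffAt_fst).prodMk
      ((hφ.fderiv_infty.comp (Ξ₀ s) contDiffAt_fst).clm_apply contDiffAt_snd)
  have hD : HasDerivWithinAt Ξ₁ (derivWithin Ξ₁ S s) S s :=
    ((hT.differentiableAt_infty.comp_differentiableWithinAt s hΞ).congr_of_eventuallyEq_of_mem
      hΞ₁ hsS).hasDerivWithinAt
  have hx := H.fiber.differentiableAt_infty.hasFDerivAt.comp_hasDerivWithinAt s hc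
  have hx' := H.fiber.fderiv_infty.differentiableAt_infty.hasFDerivAt.comp_hasDerivWithinAt s hc
  have hf := hΞ.hasDerivWithinAt.prod_fst.prod_snd
  have hΔ := hΞ.hasDerivWithinAt.prod_snd.prod_snd
  have ha := hAL.hasDerivWithinAt_anchor H.smooth_left hc he
  have h := (hx.clm_apply hΔ).add ((hx'.clm_apply ha).clm_apply hf)
  have hcc : Filter.Tendsto (fun r => (c₀ r).1) (𝓝[S] s) (𝓝 (c₀ s).1) := hc.continuousWithinAt
  have e : (fun r => (Ξ₁ r).2.2) =ᶠ[𝓝[S] s] fun r => g (c₀ r).1 (Ξ₀ r).2.2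
      + fderiv ℝ g (c₀ r).1 (A₀.anchor (c₀ r).1 (e₀ r).2) (Ξ₀ r).1.2 := by
    filter_upwards [hΞ1, hΞ2, hΞ₁, hcc.eventually H.base.eventually_infty,
      hcc.eventually H.fiber.eventually_infty] with r h1 h2 h3 h4 h5
    rw [h3, tangentPush, fderiv_fiberMap (h1 ▸ h4) (h1 ▸ h5), h1, h2]
  have h' := h.derivWithin_eq_of_eventuallyEq hs hsS e
  rw [hD.prod_snd.prod_snd.derivWithin hs] at h'
  rw [h']
  simp

/-- Both sides are derivatives of the first variation, which is invariant under `jointMap`. It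
remains to see that `jointMap` and its derivative carry the data in one chart to the data in the
other. -/
theorem integrand_eq (H : CoordChange A₀ A₁ ψ g (c₀ s).1) (hAL : A₀.AlmostLieAt (c₀ s).1)
    (hs : UniqueDiffWithinAt ℝ S s) (hsS : s ∈ S)
    (hc : HasDerivWithinAt (fun r => (c₀ r).1) (A₀.anchor (c₀ s).1 (c₀ s).2) S s)
    (he : DifferentiableWithinAt ℝ e₀ S s) (hce : ∀ᶠ r in 𝓝[S] s, (e₀ r).1 = (c₀ r).1)
    (hΞ : DifferentiableWithinAt ℝ Ξ₀ S s)
    (hΞ1 : ∀ᶠ r in 𝓝[S] s, (Ξ₀ r).1.1 = (c₀ r).1)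
    (hΞ2 : ∀ᶠ r in 𝓝[S] s, (Ξ₀ r).2.1 = A₀.anchor (c₀ r).1 (e₀ r).2)
    (hc₁ : c₁ s = fiberMap ψ g (c₀ s)) (he₁ : ∀ᶠ r in 𝓝[S] s, e₁ r = fiberMap ψ g (e₀ r))
    (hΞ₁ : ∀ᶠ r in 𝓝[S] s, Ξ₁ r = tangentPush (fiberMap ψ g) (Ξ₀ r))
    (hℓ₀ : ContDiffAt ℝ ∞ ℓ₀ (c₀ s)) (hℓ₁ : ContDiffAt ℝ ∞ ℓ₁ (c₁ s))
    (hℓ : ∀ᶠ p in 𝓝 (c₀ s), ℓ₁ (fiberMap ψ g p) = ℓ₀ p) :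
    tangentLiftFun (tangentLiftFun ℓ₁)
        (A₁.secondVector (c₁ s) (A₁.curveVariation S c₁ e₁ s) (Ξ₁ s) (derivWithin Ξ₁ S s)) =
      tangentLiftFun (tangentLiftFun ℓ₀)
        (A₀.secondVector (c₀ s) (A₀.curveVariation S c₀ e₀ s) (Ξ₀ s) (derivWithin Ξ₀ S s)) := by
  have hes : (Ξ₀ s).1.1 = (c₀ s).1 := hΞ1.self_of_nhdsWithin hsS
  have hes2 := hΞ2.self_of_nhdsWithin hsS
  have hcs : (c₁ s).1 = ψ (c₀ s).1 := by rw [hc₁]; rfl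
  have hA₁ : A₁.SmoothAt (c₁ s).1 := hcs ▸ H.smooth_right
  rw [hA₁.secondVariation_eq hℓ₁, H.smooth_left.secondVariation_eq hℓ₀]
  have h1 := H.curveVariation_eq hs hsS hc he hce hc₁ he₁
  have h2 := H.derivWithin_lift hAL hs hsS hc he hΞ hΞ1 hΞ2 hΞ₁
  have hΞ₁1 : ∀ᶠ r in 𝓝[S] s, (Ξ₁ r).1 = fiberMap ψ g (Ξ₀ r).1 := by
    filter_upwards [hΞ₁] with r hr
    rw [hr]; rfl
  have hφ : ContDiffAt ℝ ∞ (fiberMap ψ g) (Ξ₀ s).1 :=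
    contDiffAt_fiberMap (hes ▸ H.base) (hes ▸ H.fiber)
  have hT : ContDiffAt ℝ ∞ (tangentPush (fiberMap ψ g)) (Ξ₀ s) :=
    (hφ.comp (Ξ₀ s) contDiffAt_fst).prodMk
      ((hφ.fderiv_infty.comp (Ξ₀ s) contDiffAt_fst).clm_apply contDiffAt_snd)
  have hD : HasDerivWithinAt Ξ₁ (derivWithin Ξ₁ S s) S s :=
    ((hT.differentiableAt_infty.comp_differentiableWithinAt s hΞ).congr_of_eventuallyEq_of_mem
      hΞ₁ hsS).hasDerivWithinAt
  have h3 := H.derivWithin_curve (e₀ := fun r => (Ξ₀ r).1) (e₁ := fun r => (Ξ₁ r).1) hs hsS hc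
    hΞ.hasDerivWithinAt.prod_fst.differentiableWithinAt hΞ1 hΞ₁1
  rw [hD.prod_fst.derivWithin hs, hΞ.hasDerivWithinAt.prod_fst.derivWithin hs] at h3
  have h4 : Ξ₁ s = tangentPush (fiberMap ψ g) (Ξ₀ s) := hΞ₁.self_of_nhdsWithin hsS
  set Z₀ : (B × F) × (F × F) := (c₀ s, ((Ξ₀ s).1.2, (derivWithin Ξ₀ S s).1.2)) with hZ₀
  set W₀ : (B × F) × (F × F) :=
    (A₀.curveVariation S c₀ e₀ s, ((Ξ₀ s).2.2, (derivWithin Ξ₀ S s).2.2)) with hW₀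
  have hZ : (c₁ s, ((Ξ₁ s).1.2, (derivWithin Ξ₁ S s).1.2)) = jointMap A₀ ψ g Z₀ := by
    rw [h3, h4, hc₁]
    simp [jointMap, hZ₀, tangentPush, fiberMap, hes]
  -- The time derivative yields `D²g(ρ y, ρ h)`, the derivative of `jointMap` yields `D²g(ρ h, ρ
  -- y)`.
  have hsymm : IsSymmSndFDerivAt ℝ g (c₀ s).1 := by
    refine H.fiber.isSymmSndFDerivAt ?_
    simp only [minSmoothness_of_isRCLikeNormedField]
    exact WithTop.coe_le_coe.2 le_top
  have hW : (A₁.curveVariation S c₁ e₁ s, ((Ξ₁ s).2.2, (derivWithin Ξ₁ S s).2.2)) =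
      fderiv ℝ (jointMap A₀ ψ g) Z₀ W₀ := by
    rw [h1, h2, h4, hZ₀, H.fderiv_jointMap]
    simp only [hW₀, tangentPush]
    rw [fderiv_fiberMap (p := (Ξ₀ s).1) (hes ▸ H.base.differentiableAt_infty)
      (hes ▸ H.fiber.differentiableAt_infty), fderiv_fiberMap (p := c₀ s)
      H.base.differentiableAt_infty H.fiber.differentiableAt_infty, hes, hes2]
    have hk : (A₀.curveVariation S c₀ e₀ s).1 = A₀.anchor (c₀ s).1 (e₀ s).2 := rfl
    rw [hk, hsymm.eq (A₀.anchor (c₀ s).1 (c₀ s).2)]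
    ext1
    · rfl
    · ext1
      · rfl
      · simp only
        abel
  rw [hZ, hW]
  have hev := H.firstVar_jointMap (ℓ₀ := ℓ₀) (ℓ₁ := ℓ₁) (y := (c₀ s).2) (hc₁ ▸ hℓ₁) hℓ
    ((Ξ₀ s).1.2, (derivWithin Ξ₀ S s).1.2)
  have hZ' : ContDiffAt ℝ ∞ (A₁.firstVar ℓ₁) (jointMap A₀ ψ g Z₀) := by
    rw [← hZ]
    exact SmoothAt.contDiffAt_firstVar hA₁ hℓ₁
  have hJ : DifferentiableAt ℝ (jointMap A₀ ψ g) Z₀ := by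
    have i1 : ContDiffAt ℝ ∞ (fun Z : (B × F) × (F × F) => g Z.1.1) Z₀ :=
      ContDiffAt.comp Z₀ (g := g) H.fiber contDiffAt_fst.fst
    have i2 : ContDiffAt ℝ ∞ (fun Z : (B × F) × (F × F) => fderiv ℝ g Z.1.1) Z₀ :=
      ContDiffAt.comp Z₀ (g := fderiv ℝ g) H.fiber.fderiv_infty contDiffAt_fst.fst
    have i3 : ContDiffAt ℝ ∞ (fun Z : (B × F) × (F × F) => A₀.anchor Z.1.1) Z₀ :=
      ContDiffAt.comp Z₀ (g := A₀.anchor) H.smooth_left.anchor contDiffAt_fst.fst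
    have i4 : ContDiffAt ℝ ∞ (fun Z : (B × F) × (F × F) => fiberMap ψ g Z.1) Z₀ :=
      (contDiffAt_fiberMap (p := c₀ s) H.base H.fiber).comp Z₀ contDiffAt_fst
    exact (i4.prodMk ((i1.clm_apply contDiffAt_snd.fst).prodMk ((i1.clm_apply contDiffAt_snd.snd).add
      ((i2.clm_apply (i3.clm_apply contDiffAt_fst.snd)).clm_apply
        contDiffAt_snd.fst)))).differentiableAt_infty
  -- The first variations agree in a neighbourhood, hence so do their derivatives.
  have hcomp := (hZ'.differentiableAt_infty.hasFDerivAt.comp Z₀ hJ.hasFDerivAt).fderiv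
  have hev' : fderiv ℝ (A₁.firstVar ℓ₁ ∘ jointMap A₀ ψ g) Z₀ = fderiv ℝ (A₀.firstVar ℓ₀) Z₀ :=
    Filter.EventuallyEq.fderiv_eq hev
  rw [← hev', hcomp]
  rfl

end CoordChange

end CoordAlgebroid

/-! ### Chart transitions on a manifold and on its tangent bundle. -/

section ChartTransition

variable {X H N : Type*} [NormedAddCommGroup X] [NormedSpace ℝ X] [TopologicalSpace H]
  {I : ModelWithCorners ℝ X H} [I.Boundaryless] [TopologicalSpace N] [ChartedSpace H N]

theorem contDiffAt_extChartAt_trans [IsManifold I ∞ N] {x₀ x₁ p : N}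
    (h₀ : p ∈ (extChartAt I x₀).source) (h₁ : p ∈ (extChartAt I x₁).source) :
    ContDiffAt ℝ ∞ (extChartAt I x₁ ∘ (extChartAt I x₀).symm) (extChartAt I x₀ p) := by
  have := contDiffWithinAt_ext_coord_change (I := I) (n := ∞) x₁ x₀ (y := extChartAt I x₀ p)
    (by
      rw [PartialEquiv.trans_source, PartialEquiv.symm_source]
      exact ⟨(extChartAt I x₀).map_source h₀, by
        rwa [mem_preimage, (extChartAt I x₀).left_inv h₀]⟩)
  rwa [I.range_eq_univ, contDiffWithinAt_univ] at this

theorem mfderiv_extChartAt_trans [IsManifold I ∞ N] {x₀ x₁ p : N}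
    (h₀ : p ∈ (extChartAt I x₀).source) (h₁ : p ∈ (extChartAt I x₁).source)
    (v : TangentSpace I p) :
    mfderiv I 𝓘(ℝ, X) (extChartAt I x₁) p v =
      fderiv ℝ (extChartAt I x₁ ∘ (extChartAt I x₀).symm) (extChartAt I x₀ p)
        (mfderiv I 𝓘(ℝ, X) (extChartAt I x₀) p v : X) := by
  have : IsManifold I 1 N := .of_le (n := ∞) (by simp)
  have e : (extChartAt I x₁ : N → X) =ᶠ[𝓝 p]
      (extChartAt I x₁ ∘ (extChartAt I x₀).symm) ∘ extChartAt I x₀ := by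
    filter_upwards [extChartAt_source_mem_nhds' h₀] with q hq
    rw [Function.comp_apply, Function.comp_apply, (extChartAt I x₀).left_inv hq]
  have hd := (contDiffAt_extChartAt_trans (I := I) h₀ h₁).differentiableAt_infty
  rw [e.mfderiv_eq, mfderiv_comp (I' := 𝓘(ℝ, X)) p hd.mdifferentiableAt
    (mdifferentiableAt_extChartAt (by simpa using h₀)), mfderiv_eq_fderiv]
  rfl

theorem mfderiv_extChartAt_injective [IsManifold I ∞ N] {x₀ p : N}
    (h₀ : p ∈ (extChartAt I x₀).source) :
    Function.Injective (mfderiv I 𝓘(ℝ, X) (extChartAt I x₀) p) := by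
  have : IsManifold I 1 N := .of_le (n := ∞) (by simp)
  obtain ⟨e, he⟩ := isInvertible_mfderiv_extChartAt (I := I) h₀
  rw [← he]
  exact e.injective

theorem tangent_extChartAt_apply [IsManifold I ∞ N] {p q : TangentBundle I N}
    (h : q.proj ∈ (extChartAt I p.proj).source) :
    extChartAt I.tangent p q =
      (extChartAt I p.proj q.proj, (mfderiv I 𝓘(ℝ, X) (extChartAt I p.proj) q.proj q.2 : X)) := by
  have : IsManifold I 1 N := .of_le (n := ∞) (by simp)
  have h' : q.proj ∈ (chartAt H p.proj).source := by simpa using h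
  have h'' : q.proj ∈ (trivializationAt X (TangentSpace I) p.proj).baseSet := h'
  have e := TangentBundle.continuousLinearMapAt_trivializationAt (I := I) h'
  rw [ModelWithCorners.tangent, FiberBundle.extChartAt]
  ext1
  · rfl
  · have e2 : (trivializationAt X (TangentSpace I) p.proj).continuousLinearMapAt ℝ q.proj q.2 =
        (trivializationAt X (TangentSpace I) p.proj q).2 := by
      rw [Bundle.Trivialization.continuousLinearMapAt_apply,
        Bundle.Trivialization.coe_linearMapAt_of_mem _ h'']
    exact e2.symm.trans (congrArg (fun T => T q.2) e)

theorem tangent_extChartAt_source {p q : TangentBundle I N} [IsManifold I ∞ N]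
    (h : q.proj ∈ (extChartAt I p.proj).source) : q ∈ (extChartAt I.tangent p).source := by
  simpa using h

end ChartTransition

/-! ### Coordinate domains and transition maps of the bundle. -/

section Algebroid

variable {V : Type*} [NormedAddCommGroup V] [NormedSpace ℝ V]
  {F : Type*} [NormedAddCommGroup F] [NormedSpace ℝ F]
  {M : Type*} [TopologicalSpace M] [ChartedSpace V M]
  {E : M → Type*} [∀ x, AddCommGroup (E x)] [∀ x, Module ℝ (E x)]
  [∀ x, TopologicalSpace (E x)] [TopologicalSpace (TotalSpace F E)]
  [FiberBundle F E] [VectorBundle ℝ F E] [IsManifold 𝓘(ℝ, V) ∞ M]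
  [FiniteDimensional ℝ V] [T2Space M] [ContMDiffVectorBundle ∞ F E 𝓘(ℝ, V)]

variable (V F E) in
/-- The open set on which the cutoff function at `x₀` is locally constant equal to `1`. -/
def coordDomain (x₀ : M) : Set M := {x | ∀ᶠ z in 𝓝 x, cutoff V F E x₀ z = 1}

theorem isOpen_coordDomain (x₀ : M) : IsOpen (coordDomain V F E x₀) :=
  isOpen_setOfPred_eventually_nhds

theorem mem_coordDomain_self (x₀ : M) : x₀ ∈ coordDomain V F E x₀ :=
  (cutoff V F E x₀).eventuallyEq_one

variable {x₀ x₁ x : M}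

theorem cutoff_eq_one (hx : x ∈ coordDomain V F E x₀) : cutoff V F E x₀ x = 1 :=
  Filter.Eventually.self_of_nhds (p := fun z => cutoff V F E x₀ z = 1) hx

theorem mem_support_of_coordDomain (hx : x ∈ coordDomain V F E x₀) :
    x ∈ Function.support (cutoff V F E x₀) := by
  simp [cutoff_eq_one hx]

theorem coordDomain_source (hx : x ∈ coordDomain V F E x₀) :
    x ∈ (extChartAt 𝓘(ℝ, V) x₀).source := by
  rw [extChartAt_source]
  exact (cutoff V F E x₀).support_subset_source (mem_support_of_coordDomain hx)

theorem coordDomain_baseSet (hx : x ∈ coordDomain V F E x₀) :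
    x ∈ (trivializationAt F E x₀).baseSet :=
  (exists_cutoff V F E x₀).choose_spec (subset_closure (mem_support_of_coordDomain hx))

theorem coordDomain_mem_nhds (hx : x ∈ coordDomain V F E x₀) : coordDomain V F E x₀ ∈ 𝓝 x :=
  (isOpen_coordDomain x₀).mem_nhds hx

theorem eventually_coordDomain (hx : x ∈ coordDomain V F E x₀) :
    ∀ᶠ q in 𝓝 (extChartAt 𝓘(ℝ, V) x₀ x), (extChartAt 𝓘(ℝ, V) x₀).symm q ∈ coordDomain V F E x₀ ∧
      extChartAt 𝓘(ℝ, V) x₀ ((extChartAt 𝓘(ℝ, V) x₀).symm q) = q := by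
  have hs := coordDomain_source hx
  have h1 : Filter.Tendsto (extChartAt 𝓘(ℝ, V) x₀).symm (𝓝 (extChartAt 𝓘(ℝ, V) x₀ x)) (𝓝 x) := by
    have := continuousAt_extChartAt_symm' hs
    rwa [ContinuousAt, (extChartAt 𝓘(ℝ, V) x₀).left_inv hs] at this
  filter_upwards [h1 (coordDomain_mem_nhds hx), extChartAt_target_mem_nhds' (PartialEquiv.map_source _ hs)] with q h1 h2
  exact ⟨h1, (extChartAt 𝓘(ℝ, V) x₀).right_inv h2⟩

theorem tendsto_extChartAt_symm (hx : x ∈ coordDomain V F E x₀) :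
    Filter.Tendsto (extChartAt 𝓘(ℝ, V) x₀).symm (𝓝 (extChartAt 𝓘(ℝ, V) x₀ x)) (𝓝 x) := by
  have hs := coordDomain_source hx
  have := continuousAt_extChartAt_symm' hs
  rwa [ContinuousAt, (extChartAt 𝓘(ℝ, V) x₀).left_inv hs] at this

variable (V F E) in
/-- The change of base coordinates. -/
def chartTrans (x₀ x₁ : M) : V → V := extChartAt 𝓘(ℝ, V) x₁ ∘ (extChartAt 𝓘(ℝ, V) x₀).symm

variable (V F E) in
/-- The change of fibre coordinates. -/
def fiberTrans (x₀ x₁ : M) (q : V) : F →L[ℝ] F :=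
  (trivializationAt F E x₁).continuousLinearMapAt ℝ ((extChartAt 𝓘(ℝ, V) x₀).symm q) ∘L
    (trivializationAt F E x₀).symmL ℝ ((extChartAt 𝓘(ℝ, V) x₀).symm q)

theorem contDiffAt_chartTrans (h₀ : x ∈ coordDomain V F E x₀) (h₁ : x ∈ coordDomain V F E x₁) :
    ContDiffAt ℝ ∞ (chartTrans V x₀ x₁) (extChartAt 𝓘(ℝ, V) x₀ x) :=
  contDiffAt_extChartAt_trans (coordDomain_source h₀) (coordDomain_source h₁)

theorem contMDiffAt_extChartAt_symm (h₀ : x ∈ coordDomain V F E x₀) :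
    ContMDiffAt 𝓘(ℝ, V) 𝓘(ℝ, V) ∞ (extChartAt 𝓘(ℝ, V) x₀).symm (extChartAt 𝓘(ℝ, V) x₀ x) :=
  (contMDiffOn_extChartAt_symm x₀).contMDiffAt
    (extChartAt_target_mem_nhds' (PartialEquiv.map_source _ (coordDomain_source h₀)))

theorem contDiffAt_fiberTrans (h₀ : x ∈ coordDomain V F E x₀) (h₁ : x ∈ coordDomain V F E x₁) :
    ContDiffAt ℝ ∞ (fiberTrans V F E x₀ x₁) (extChartAt 𝓘(ℝ, V) x₀ x) := by
  have hs := coordDomain_source h₀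
  have h := contMDiffAt_coordChangeL (IB := 𝓘(ℝ, V)) (n := ∞)
    (coordDomain_baseSet h₀) (coordDomain_baseSet h₁)
  have h2 := contMDiffAt_extChartAt_symm h₀
  rw [← (extChartAt 𝓘(ℝ, V) x₀).left_inv hs] at h
  have h3 := (h.comp _ h2).contDiffAt
  refine h3.congr_of_eventuallyEq ?_
  have hopen : (trivializationAt F E x₀).baseSet ∩ (trivializationAt F E x₁).baseSet ∈ 𝓝 x :=
    ((trivializationAt F E x₀).open_baseSet.inter (trivializationAt F E x₁).open_baseSet).mem_nhds
      ⟨coordDomain_baseSet h₀, coordDomain_baseSet h₁⟩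
  filter_upwards [tendsto_extChartAt_symm h₀ hopen] with q hq
  ext v
  simp only [fiberTrans, ContinuousLinearMap.comp_apply, Function.comp_apply]
  exact ((trivializationAt F E x₀).coordChangeL_apply (R := ℝ) (trivializationAt F E x₁) hq v).symm ▸ by
    rw [Bundle.Trivialization.symmL_apply _ hq.1,
      Bundle.Trivialization.continuousLinearMapAt_apply,
      Bundle.Trivialization.coe_linearMapAt_of_mem _ hq.2]

variable (V F E) in
theorem bundleChart_apply (x₀ : M) {p : TotalSpace F E}
    (hp : p.proj ∈ (trivializationAt F E x₀).baseSet) :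
    bundleChart V F E x₀ p = (extChartAt 𝓘(ℝ, V) x₀ p.proj, (trivializationAt F E x₀ p).2) := by
  rw [bundleChart, FiberBundle.extChartAt]
  ext1
  · simp
    rw [(trivializationAt F E x₀).coe_fst' hp]
  · simp

theorem fiberTrans_apply (h₀ : x ∈ coordDomain V F E x₀) (h₁ : x ∈ coordDomain V F E x₁) (v : E x) :
    fiberTrans V F E x₀ x₁ (extChartAt 𝓘(ℝ, V) x₀ x) (trivializationAt F E x₀ ⟨x, v⟩).2 =
      (trivializationAt F E x₁ ⟨x, v⟩).2 := by
  have e0 : (trivializationAt F E x₀ ⟨x, v⟩).2 =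
      (trivializationAt F E x₀).continuousLinearMapAt ℝ x v := by
    rw [Bundle.Trivialization.continuousLinearMapAt_apply,
      Bundle.Trivialization.coe_linearMapAt_of_mem _ (coordDomain_baseSet h₀)]
  rw [fiberTrans, (extChartAt 𝓘(ℝ, V) x₀).left_inv (coordDomain_source h₀), e0,
    ContinuousLinearMap.comp_apply,
    Bundle.Trivialization.symmL_continuousLinearMapAt _ (coordDomain_baseSet h₀),
    Bundle.Trivialization.continuousLinearMapAt_apply,
      Bundle.Trivialization.coe_linearMapAt_of_mem _ (coordDomain_baseSet h₁)]

theorem bundleChart_source {p : TotalSpace F E} (h₀ : p.proj ∈ coordDomain V F E x₀) :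
    p ∈ (bundleChart V F E x₀).source := by
  have := coordDomain_source h₀
  rw [extChartAt_source] at this
  rw [bundleChart, FiberBundle.extChartAt]
  simp [PartialEquiv.trans_source, Bundle.Trivialization.mem_source, coordDomain_baseSet h₀,
    (trivializationAt F E x₀).coe_fst' (coordDomain_baseSet h₀), this]

theorem bundleChart_trans {p : TotalSpace F E} (h₀ : p.proj ∈ coordDomain V F E x₀)
    (h₁ : p.proj ∈ coordDomain V F E x₁) :
    bundleChart V F E x₁ p = CoordAlgebroid.fiberMap (chartTrans V x₀ x₁)
      (fiberTrans V F E x₀ x₁) (bundleChart V F E x₀ p) := by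
  rw [bundleChart_apply _ _ _ x₁ (coordDomain_baseSet h₁),
    bundleChart_apply _ _ _ x₀ (coordDomain_baseSet h₀), CoordAlgebroid.fiberMap,
    ← fiberTrans_apply h₀ h₁]
  simp only [chartTrans, Function.comp_apply,
    (extChartAt 𝓘(ℝ, V) x₀).left_inv (coordDomain_source h₀)]

theorem eventually_bundleChart {p : TotalSpace F E} (h₀ : p.proj ∈ coordDomain V F E x₀) :
    ∀ᶠ q in 𝓝 (bundleChart V F E x₀ p),
      ((bundleChart V F E x₀).symm q).proj ∈ coordDomain V F E x₀ ∧
      bundleChart V F E x₀ ((bundleChart V F E x₀).symm q) = q := by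
  have hs := bundleChart_source h₀
  have h1 : Filter.Tendsto (bundleChart V F E x₀).symm (𝓝 (bundleChart V F E x₀ p)) (𝓝 p) := by
    have : ContinuousAt (bundleChart V F E x₀).symm (bundleChart V F E x₀ p) :=
      continuousAt_extChartAt_symm' hs
    rwa [ContinuousAt, (bundleChart V F E x₀).left_inv hs] at this
  have h2 : (bundleChart V F E x₀).target ∈ 𝓝 (bundleChart V F E x₀ p) :=
    extChartAt_target_mem_nhds' (PartialEquiv.map_source _ hs)
  filter_upwards [h1 ((FiberBundle.continuous_proj F E).continuousAt (coordDomain_mem_nhds h₀)), h2]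
    with q h1 h2
  exact ⟨h1, (bundleChart V F E x₀).right_inv h2⟩

theorem eventually_bundleChart_mem {p : TotalSpace F E} {U : Set M} (hU : U ∈ 𝓝 p.proj)
    (h₀ : p.proj ∈ coordDomain V F E x₀) :
    ∀ᶠ q in 𝓝 (bundleChart V F E x₀ p), ((bundleChart V F E x₀).symm q).proj ∈ U := by
  have hs := bundleChart_source h₀
  have h1 : Filter.Tendsto (bundleChart V F E x₀).symm (𝓝 (bundleChart V F E x₀ p)) (𝓝 p) := by
    have : ContinuousAt (bundleChart V F E x₀).symm (bundleChart V F E x₀ p) :=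
      continuousAt_extChartAt_symm' hs
    rwa [ContinuousAt, (bundleChart V F E x₀).left_inv hs] at this
  exact h1 ((FiberBundle.continuous_proj F E).continuousAt hU)

theorem eventuallyEq_bundleChart_trans {p : TotalSpace F E} (h₀ : p.proj ∈ coordDomain V F E x₀)
    (h₁ : p.proj ∈ coordDomain V F E x₁) :
    bundleChart V F E x₁ ∘ (bundleChart V F E x₀).symm =ᶠ[𝓝 (bundleChart V F E x₀ p)]
      CoordAlgebroid.fiberMap (chartTrans V x₀ x₁) (fiberTrans V F E x₀ x₁) := by
  filter_upwards [eventually_bundleChart h₀,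
    eventually_bundleChart_mem (coordDomain_mem_nhds h₁) h₀] with q h2 h3
  rw [Function.comp_apply, bundleChart_trans h2.1 h3, h2.2]

theorem mfderiv_bundleChart_trans {p : TotalSpace F E} (h₀ : p.proj ∈ coordDomain V F E x₀)
    (h₁ : p.proj ∈ coordDomain V F E x₁) (v : TangentSpace (𝓘(ℝ, V).prod 𝓘(ℝ, F)) p) :
    mfderiv (𝓘(ℝ, V).prod 𝓘(ℝ, F)) 𝓘(ℝ, V × F) (bundleChart V F E x₁) p v =
      fderiv ℝ (CoordAlgebroid.fiberMap (chartTrans V x₀ x₁) (fiberTrans V F E x₀ x₁))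
        (bundleChart V F E x₀ p)
        (mfderiv (𝓘(ℝ, V).prod 𝓘(ℝ, F)) 𝓘(ℝ, V × F) (bundleChart V F E x₀) p v : V × F) := by
  rw [← (eventuallyEq_bundleChart_trans h₀ h₁).fderiv_eq]
  exact mfderiv_extChartAt_trans (bundleChart_source h₀) (bundleChart_source h₁) v

variable (L : TotalSpace F E → ℝ)

open SkewAlgebroid in
theorem coordLagrangian_trans {p : TotalSpace F E} (h₀ : p.proj ∈ coordDomain V F E x₀)
    (h₁ : p.proj ∈ coordDomain V F E x₁) :
    ∀ᶠ q in 𝓝 (bundleChart V F E x₀ p), coordLagrangian V L x₁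
      (CoordAlgebroid.fiberMap (chartTrans V x₀ x₁) (fiberTrans V F E x₀ x₁) q) =
        coordLagrangian V L x₀ q := by
  filter_upwards [eventuallyEq_bundleChart_trans h₀ h₁,
    eventually_bundleChart_mem (coordDomain_mem_nhds h₁) h₀] with q h1 h2
  rw [coordLagrangian, ← h1, coordLagrangian, Function.comp_apply,
    (bundleChart V F E x₁).left_inv (bundleChart_source h2)]

variable {L}

open SkewAlgebroid in
theorem contDiffAt_coordLagrangian (hL : ContMDiff (𝓘(ℝ, V).prod 𝓘(ℝ, F)) 𝓘(ℝ, ℝ) ∞ L)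
    {p : TotalSpace F E} (h₀ : p.proj ∈ coordDomain V F E x₀) :
    ContDiffAt ℝ ∞ (coordLagrangian V L x₀) (bundleChart V F E x₀ p) := by
  have h1 : ContMDiffAt 𝓘(ℝ, V × F) (𝓘(ℝ, V).prod 𝓘(ℝ, F)) ∞ (bundleChart V F E x₀).symm
      (bundleChart V F E x₀ p) :=
    (contMDiffOn_extChartAt_symm _).contMDiffAt
      (extChartAt_target_mem_nhds' (PartialEquiv.map_source _ (bundleChart_source h₀)))
  exact (hL.contMDiffAt.comp _ h1).contDiffAt

end Algebroid

/-! ### The bracket in coordinates and its transformation law. -/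

section Algebroid

variable {V : Type*} [NormedAddCommGroup V] [NormedSpace ℝ V]
  {F : Type*} [NormedAddCommGroup F] [NormedSpace ℝ F]
  {M : Type*} [TopologicalSpace M] [ChartedSpace V M]
  {E : M → Type*} [∀ x, AddCommGroup (E x)] [∀ x, Module ℝ (E x)]
  [∀ x, TopologicalSpace (E x)] [TopologicalSpace (TotalSpace F E)]
  [FiberBundle F E] [VectorBundle ℝ F E] [IsManifold 𝓘(ℝ, V) ∞ M]
  [FiniteDimensional ℝ V] [T2Space M] [ContMDiffVectorBundle ∞ F E 𝓘(ℝ, V)]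

variable (F E) in
/-- The fibre coordinate of the bundle coordinates at `x₀`, as a linear map on the fibre over `x`. -/
def fiberCoord (x₀ x : M) : E x →L[ℝ] F := (trivializationAt F E x₀).continuousLinearMapAt ℝ x

/-- The derivative of a vector-valued function along a tangent vector. -/
def vecDeriv {W : Type*} [NormedAddCommGroup W] [NormedSpace ℝ W] (f : M → W) (x : M)
    (v : TangentSpace 𝓘(ℝ, V) x) : W :=
  mfderiv 𝓘(ℝ, V) 𝓘(ℝ, W) f x v

variable {x₀ x₁ x : M}

theorem fiberCoord_eq (hx : x ∈ coordDomain V F E x₀) (v : E x) :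
    fiberCoord F E x₀ x v = (trivializationAt F E x₀ ⟨x, v⟩).2 := by
  rw [fiberCoord, Bundle.Trivialization.continuousLinearMapAt_apply,
    Bundle.Trivialization.coe_linearMapAt_of_mem _ (coordDomain_baseSet hx)]

theorem fiberCoord_symmL (hx : x ∈ coordDomain V F E x₀) (u : F) :
    fiberCoord F E x₀ x ((trivializationAt F E x₀).symmL ℝ x u) = u :=
  (trivializationAt F E x₀).continuousLinearMapAt_symmL (coordDomain_baseSet hx) u

theorem symmL_fiberCoord (hx : x ∈ coordDomain V F E x₀) (v : E x) :
    (trivializationAt F E x₀).symmL ℝ x (fiberCoord F E x₀ x v) = v :=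
  (trivializationAt F E x₀).symmL_continuousLinearMapAt (coordDomain_baseSet hx) v

theorem fiberCoord_injective (hx : x ∈ coordDomain V F E x₀) :
    Function.Injective (fiberCoord F E x₀ x) :=
  Function.LeftInverse.injective (symmL_fiberCoord hx)

theorem fiberTrans_fiberCoord (h₀ : x ∈ coordDomain V F E x₀) (h₁ : x ∈ coordDomain V F E x₁)
    (v : E x) :
    fiberTrans V F E x₀ x₁ (extChartAt 𝓘(ℝ, V) x₀ x) (fiberCoord F E x₀ x v) =
      fiberCoord F E x₁ x v := by
  rw [fiberCoord_eq h₀, fiberCoord_eq h₁, fiberTrans_apply h₀ h₁]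

theorem fiberCoord_constSection (h₀ : x ∈ coordDomain V F E x₀) (u : F) :
    fiberCoord F E x₀ x (constSection V E x₀ u x) = u := by
  change fiberCoord F E x₀ x (cutoff V F E x₀ x • (trivializationAt F E x₀).symmL ℝ x u) = u
  rw [cutoff_eq_one h₀, one_smul, fiberCoord_symmL h₀]

theorem bundleChart_mk (h₀ : x ∈ coordDomain V F E x₀) (v : E x) :
    bundleChart V F E x₀ ⟨x, v⟩ = (extChartAt 𝓘(ℝ, V) x₀ x, fiberCoord F E x₀ x v) := by
  rw [fiberCoord_eq h₀, bundleChart_apply V F E x₀ (p := ⟨x, v⟩) (coordDomain_baseSet h₀)]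

theorem contMDiffAt_fiberCoord (X : ContMDiffSection 𝓘(ℝ, V) F ∞ E)
    (hx : x ∈ coordDomain V F E x₀) :
    ContMDiffAt 𝓘(ℝ, V) 𝓘(ℝ, F) ∞ (fun z => fiberCoord F E x₀ z (X z)) x := by
  have := ((trivializationAt F E x₀).contMDiffAt_section_iff (coordDomain_baseSet hx)).1
    X.contMDiff.contMDiffAt
  refine this.congr_of_eventuallyEq ?_
  filter_upwards [coordDomain_mem_nhds hx] with z hz using fiberCoord_eq hz _

theorem vecDeriv_eq_fderiv {W : Type*} [NormedAddCommGroup W] [NormedSpace ℝ W] {f : M → W}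
    (hx : x ∈ coordDomain V F E x₀) (hf : ContMDiffAt 𝓘(ℝ, V) 𝓘(ℝ, W) ∞ f x)
    (v : TangentSpace 𝓘(ℝ, V) x) :
    vecDeriv f x v =
      fderiv ℝ (f ∘ (extChartAt 𝓘(ℝ, V) x₀).symm) (extChartAt 𝓘(ℝ, V) x₀ x)
        (vecDeriv (extChartAt 𝓘(ℝ, V) x₀) x v) := by
  have : IsManifold 𝓘(ℝ, V) 1 M := .of_le (n := ∞) (by simp)
  have hs := coordDomain_source hx
  have e : f =ᶠ[𝓝 x] (f ∘ (extChartAt 𝓘(ℝ, V) x₀).symm) ∘ extChartAt 𝓘(ℝ, V) x₀ := by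
    filter_upwards [extChartAt_source_mem_nhds' hs] with q hq
    rw [Function.comp_apply, Function.comp_apply, (extChartAt 𝓘(ℝ, V) x₀).left_inv hq]
  have h2 := contMDiffAt_extChartAt_symm hx
  rw [← (extChartAt 𝓘(ℝ, V) x₀).left_inv hs] at hf
  have hd : DifferentiableAt ℝ (f ∘ (extChartAt 𝓘(ℝ, V) x₀).symm) (extChartAt 𝓘(ℝ, V) x₀ x) :=
    (hf.comp _ h2).contDiffAt.differentiableAt_infty
  rw [vecDeriv, e.mfderiv_eq, mfderiv_comp (I' := 𝓘(ℝ, V)) x hd.mdifferentiableAt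
    (mdifferentiableAt_extChartAt (by simpa using hs)), mfderiv_eq_fderiv]
  rfl

variable [FiniteDimensional ℝ F]

namespace SkewAlgebroid

variable (A : SkewAlgebroid V F E)

theorem coord_anchor (hx : x ∈ coordDomain V F E x₀) (v : E x) :
    (A.coord x₀).anchor (extChartAt 𝓘(ℝ, V) x₀ x) (fiberCoord F E x₀ x v) =
      vecDeriv (extChartAt 𝓘(ℝ, V) x₀) x (A.anchor x v) := by
  -- The structure functions at `x` are evaluated in the fibre over `symm (chart x)`, which equals
  -- `x` only propositionally. Generalising the point allows substitution in the dependent fibre.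
  have key : ∀ z, z = x → vecDeriv (extChartAt 𝓘(ℝ, V) x₀) z (A.anchor z
      ((trivializationAt F E x₀).symmL ℝ z (fiberCoord F E x₀ x v))) =
      vecDeriv (extChartAt 𝓘(ℝ, V) x₀) x (A.anchor x v) := by
    rintro _ rfl
    rw [symmL_fiberCoord hx]
  exact key _ ((extChartAt 𝓘(ℝ, V) x₀).left_inv (coordDomain_source hx))

theorem coord_bracket (hx : x ∈ coordDomain V F E x₀) (u w : F) :
    (A.coord x₀).bracket (extChartAt 𝓘(ℝ, V) x₀ x) u w =
      fiberCoord F E x₀ x (A.bracket (constSection V E x₀ u) (constSection V E x₀ w) x) := by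
  have key : ∀ z, z = x → fiberCoord F E x₀ z
      (A.bracket (constSection V E x₀ u) (constSection V E x₀ w) z) =
      fiberCoord F E x₀ x (A.bracket (constSection V E x₀ u) (constSection V E x₀ w) x) := by
    rintro _ rfl
    rfl
  exact key _ ((extChartAt 𝓘(ℝ, V) x₀).left_inv (coordDomain_source hx))

theorem coord_anchor_trans (h₀ : x ∈ coordDomain V F E x₀) (h₁ : x ∈ coordDomain V F E x₁)
    (y : F) :
    (A.coord x₁).anchor (chartTrans V x₀ x₁ (extChartAt 𝓘(ℝ, V) x₀ x))
      (fiberTrans V F E x₀ x₁ (extChartAt 𝓘(ℝ, V) x₀ x) y) =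
    fderiv ℝ (chartTrans V x₀ x₁) (extChartAt 𝓘(ℝ, V) x₀ x)
      ((A.coord x₀).anchor (extChartAt 𝓘(ℝ, V) x₀ x) y) := by
  obtain ⟨v, rfl⟩ : ∃ v, fiberCoord F E x₀ x v = y := ⟨_, fiberCoord_symmL h₀ y⟩
  rw [fiberTrans_fiberCoord h₀ h₁, coord_anchor A h₀, chartTrans, Function.comp_apply,
    (extChartAt 𝓘(ℝ, V) x₀).left_inv (coordDomain_source h₀), coord_anchor A h₁]
  exact mfderiv_extChartAt_trans (coordDomain_source h₀) (coordDomain_source h₁) _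

/-- Locality follows from the Leibniz rule. For a bump function `χ` supported where `Y = Y'`, the
section `χ (Y - Y')` is zero; at `x`, where `χ = 1` and `Y - Y' = 0`, Leibniz reduces its bracket
with `X` to `[X, Y - Y']`. -/
theorem bracket_congr_right (X : ContMDiffSection 𝓘(ℝ, V) F ∞ E)
    {Y Y' : ContMDiffSection 𝓘(ℝ, V) F ∞ E} (h : ∀ᶠ z in 𝓝 x, Y z = Y' z) :
    A.bracket X Y x = A.bracket X Y' x := by
  obtain ⟨χ, -, hχ⟩ := (SmoothBumpFunction.nhds_basis_tsupport (I := 𝓘(ℝ, V)) x).mem_iff.1 h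
  have h0 : smoothSMul χ χ.contMDiff (Y - Y') = 0 := by
    ext z
    change χ z • (Y z - Y' z) = 0
    by_cases hz : z ∈ tsupport χ
    · rw [show Y z = Y' z from hχ hz, sub_self, smul_zero]
    · rw [image_eq_zero_of_notMem_tsupport hz, zero_smul]
  have h1 := A.leibniz X (Y - Y') χ χ.contMDiff x
  rw [h0, map_zero, χ.eq_one, one_smul] at h1
  have h2 : (Y - Y') x = 0 := sub_eq_zero.2 h.self_of_nhds
  rw [h2, smul_zero, add_zero, map_sub] at h1
  exact (sub_eq_zero.1 h1.symm)

theorem bracket_skew_apply (X Y : ContMDiffSection 𝓘(ℝ, V) F ∞ E) :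
    A.bracket X Y x = -A.bracket Y X x := by
  rw [A.bracket_skew X Y]
  rfl

theorem coord_bracket_skew (hx : x ∈ coordDomain V F E x₀) (u w : F) :
    (A.coord x₀).bracket (extChartAt 𝓘(ℝ, V) x₀ x) u w =
      -(A.coord x₀).bracket (extChartAt 𝓘(ℝ, V) x₀ x) w u := by
  rw [coord_bracket A hx, coord_bracket A hx, bracket_skew_apply, map_neg]

variable (V E) in
theorem constSection_sum_apply {ι : Type*} (s : Finset ι) (a : ι → ℝ) (b : ι → F) :
    constSection V E x₀ (∑ i ∈ s, a i • b i) = ∑ i ∈ s, a i • constSection V E x₀ (b i) := by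
  classical
  induction s using Finset.induction_on with
  | empty =>
    have := constSection_smul V E x₀ (0 : ℝ) (0 : F)
    simpa using this
  | insert i s hi ih => rw [Finset.sum_insert hi, Finset.sum_insert hi, constSection_add, ih,
      constSection_smul]

/-- Near `x`, `Y` is a combination of the local frame `constSection` with smooth coefficients.
Locality permits this replacement. The Leibniz rule then gives the bracket with the frozen value of
`Y` plus the derivative of its components. -/
theorem fiberCoord_bracket_right (X Y : ContMDiffSection 𝓘(ℝ, V) F ∞ E)
    (hx : x ∈ coordDomain V F E x₀) :
    fiberCoord F E x₀ x (A.bracket X Y x) =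
      fiberCoord F E x₀ x (A.bracket X (constSection V E x₀ (fiberCoord F E x₀ x (Y x))) x)
        + vecDeriv (fun z => fiberCoord F E x₀ z (Y z)) x (A.anchor x (X x)) := by
  classical
  let b := Module.finBasis ℝ F
  -- The coefficients are multiplied by the cutoff function so that they are globally smooth, as the
  -- Leibniz rule requires; near `x` the factor is `1`.
  let a : Fin (Module.finrank ℝ F) → M → ℝ := fun k z =>
    cutoff V F E x₀ z • (b.coord k (trivializationAt F E x₀ ⟨z, Y z⟩).2)
  have hbk (k) : ContDiff ℝ ∞ (b.coord k) :=
    (LinearMap.toContinuousLinearMap (b.coord k)).contDiff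
  have ha : ∀ k, ContMDiff 𝓘(ℝ, V) 𝓘(ℝ, ℝ) ∞ (a k) := by
    intro k
    have h1 : ContMDiffOn 𝓘(ℝ, V) 𝓘(ℝ, F) ∞ (fun z => (trivializationAt F E x₀ ⟨z, Y z⟩).2)
        (trivializationAt F E x₀).baseSet :=
      (trivializationAt F E x₀).contMDiffOn_section_baseSet_iff.1 Y.contMDiff.contMDiffOn
    have h2 := (hbk k).contMDiff.comp_contMDiffOn h1
    refine contMDiff_of_tsupport fun z hz => ?_
    have hz' : z ∈ (trivializationAt F E x₀).baseSet :=
      (exists_cutoff V F E x₀).choose_spec (closure_mono (Function.support_smul_subset_left _ _) hz)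
    exact (cutoff V F E x₀).contMDiff.contMDiffAt.smul
      (h2.contMDiffAt ((trivializationAt F E x₀).open_baseSet.mem_nhds hz'))
  have ha' : ∀ k, ∀ z ∈ coordDomain V F E x₀, a k z = b.coord k (fiberCoord F E x₀ z (Y z)) := by
    intro k z hz
    simp only [a]
    rw [cutoff_eq_one hz, one_smul, fiberCoord_eq hz]
  have hY : ∀ᶠ z in 𝓝 x, Y z =
      (∑ k, smoothSMul (a k) (ha k) (constSection V E x₀ (b k)) :
        ContMDiffSection 𝓘(ℝ, V) F ∞ E) z := by
    filter_upwards [coordDomain_mem_nhds hx] with z hz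
    apply fiberCoord_injective hz
    have hsum : (∑ k, smoothSMul (a k) (ha k) (constSection V E x₀ (b k)) :
        ContMDiffSection 𝓘(ℝ, V) F ∞ E) z = ∑ k, a k z • constSection V E x₀ (b k) z := by
      rw [← ContMDiffSection.coeAddHom_apply, map_sum, Finset.sum_apply]
      rfl
    rw [hsum, map_sum]
    conv_lhs => rw [← b.sum_repr (fiberCoord F E x₀ z (Y z))]
    refine Finset.sum_congr rfl fun k _ => ?_
    rw [map_smul, fiberCoord_constSection hz, ha' k z hz]
    rfl
  have hbr : A.bracket X Y x = ∑ k, (a k x • A.bracket X (constSection V E x₀ (b k)) x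
      + derivAlong (a k) x (A.anchor x (X x)) • constSection V E x₀ (b k) x) := by
    rw [A.bracket_congr_right X hY, map_sum, ← ContMDiffSection.coeAddHom_apply, map_sum,
      Finset.sum_apply]
    refine Finset.sum_congr rfl fun k _ => ?_
    exact A.leibniz X _ (a k) (ha k) x
  have hd : ∀ k, derivAlong (a k) x (A.anchor x (X x)) = b.coord k
      (vecDeriv (fun z => fiberCoord F E x₀ z (Y z)) x (A.anchor x (X x))) := by
    intro k
    have e : a k =ᶠ[𝓝 x] (LinearMap.toContinuousLinearMap (b.coord k)) ∘
        fun z => fiberCoord F E x₀ z (Y z) := by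
      filter_upwards [coordDomain_mem_nhds hx] with z hz using ha' k z hz
    rw [derivAlong, vecDeriv, e.mfderiv_eq, mfderiv_comp (I' := 𝓘(ℝ, F)) x
      (ContinuousLinearMap.differentiableAt _).mdifferentiableAt
      ((contMDiffAt_fiberCoord Y hx).mdifferentiableAt (by simp)), mfderiv_eq_fderiv,
      ContinuousLinearMap.fderiv]
    rfl
  rw [hbr, map_sum]
  simp only [map_add, map_smul, fiberCoord_constSection hx, Finset.sum_add_distrib, hd]
  congr 1
  · conv_rhs => rw [← b.sum_repr (fiberCoord F E x₀ x (Y x))]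
    rw [constSection_sum_apply, map_sum, ← ContMDiffSection.coeAddHom_apply, map_sum,
      Finset.sum_apply, map_sum]
    refine Finset.sum_congr rfl fun k _ => ?_
    rw [map_smul, ha' k x hx, ← map_smul]
    rfl
  · exact b.sum_repr _

/-- The one-sided formula is applied in the second slot, then through skew-symmetry in the first. -/
theorem fiberCoord_bracket (X Y : ContMDiffSection 𝓘(ℝ, V) F ∞ E)
    (hx : x ∈ coordDomain V F E x₀) :
    fiberCoord F E x₀ x (A.bracket X Y x) =
      (A.coord x₀).bracket (extChartAt 𝓘(ℝ, V) x₀ x) (fiberCoord F E x₀ x (X x))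
          (fiberCoord F E x₀ x (Y x))
        + vecDeriv (fun z => fiberCoord F E x₀ z (Y z)) x (A.anchor x (X x))
        - vecDeriv (fun z => fiberCoord F E x₀ z (X z)) x (A.anchor x (Y x)) := by
  rw [fiberCoord_bracket_right A X Y hx, bracket_skew_apply, map_neg,
    fiberCoord_bracket_right A _ X hx, coord_bracket_skew A hx, coord_bracket A hx]
  have : constSection V E x₀ (fiberCoord F E x₀ x (Y x)) x = Y x :=
    fiberCoord_injective hx (fiberCoord_constSection hx _)
  rw [this]
  abel

/-- The bracket of two sections that are constant in the coordinates at `x₀` is computed in the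
coordinates at `x₁`. There their components are columns of the transition function, whose
derivatives give the inhomogeneous terms. -/
theorem coord_bracket_trans (h₀ : x ∈ coordDomain V F E x₀) (h₁ : x ∈ coordDomain V F E x₁)
    (u w : F) :
    fiberTrans V F E x₀ x₁ (extChartAt 𝓘(ℝ, V) x₀ x)
        ((A.coord x₀).bracket (extChartAt 𝓘(ℝ, V) x₀ x) u w) =
      (A.coord x₁).bracket (chartTrans V x₀ x₁ (extChartAt 𝓘(ℝ, V) x₀ x))
          (fiberTrans V F E x₀ x₁ (extChartAt 𝓘(ℝ, V) x₀ x) u)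
          (fiberTrans V F E x₀ x₁ (extChartAt 𝓘(ℝ, V) x₀ x) w)
        + fderiv ℝ (fiberTrans V F E x₀ x₁) (extChartAt 𝓘(ℝ, V) x₀ x)
            ((A.coord x₀).anchor (extChartAt 𝓘(ℝ, V) x₀ x) u) w
        - fderiv ℝ (fiberTrans V F E x₀ x₁) (extChartAt 𝓘(ℝ, V) x₀ x)
            ((A.coord x₀).anchor (extChartAt 𝓘(ℝ, V) x₀ x) w) u := by
  have hu : ∀ u, fiberCoord F E x₁ x (constSection V E x₀ u x) =
      fiberTrans V F E x₀ x₁ (extChartAt 𝓘(ℝ, V) x₀ x) u := by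
    intro u
    rw [← fiberTrans_fiberCoord h₀ h₁, fiberCoord_constSection h₀]
  have hd : ∀ u w, vecDeriv (fun z => fiberCoord F E x₁ z (constSection V E x₀ w z)) x
      (A.anchor x (constSection V E x₀ u x)) =
      fderiv ℝ (fiberTrans V F E x₀ x₁) (extChartAt 𝓘(ℝ, V) x₀ x)
            ((A.coord x₀).anchor (extChartAt 𝓘(ℝ, V) x₀ x) u) w := by
    intro u w
    rw [vecDeriv_eq_fderiv h₀ (contMDiffAt_fiberCoord _ h₁), ← coord_anchor A h₀,
      fiberCoord_constSection h₀]
    have e : (fun z => fiberCoord F E x₁ z (constSection V E x₀ w z)) ∘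
        (extChartAt 𝓘(ℝ, V) x₀).symm =ᶠ[𝓝 (extChartAt 𝓘(ℝ, V) x₀ x)]
        fun q => fiberTrans V F E x₀ x₁ q w := by
      filter_upwards [eventually_coordDomain h₀,
        tendsto_extChartAt_symm h₀ (coordDomain_mem_nhds h₁)] with q hq hq'
      rw [Function.comp_apply, ← fiberTrans_fiberCoord hq.1 hq', hq.2,
        fiberCoord_constSection hq.1]
    rw [e.fderiv_eq, ((contDiffAt_fiberTrans h₀ h₁).differentiableAt_infty.hasFDerivAt.clm_apply
      (hasFDerivAt_const w _)).fderiv]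
    simp
  rw [coord_bracket A h₀, fiberTrans_fiberCoord h₀ h₁, fiberCoord_bracket A _ _ h₁, hu, hu, hd, hd,
    chartTrans, Function.comp_apply, (extChartAt 𝓘(ℝ, V) x₀).left_inv (coordDomain_source h₀)]

end SkewAlgebroid

end Algebroid

/-! ### Smoothness and algebraic identities of the structure functions. -/

section Algebroid

variable {V : Type*} [NormedAddCommGroup V] [NormedSpace ℝ V]
  {F : Type*} [NormedAddCommGroup F] [NormedSpace ℝ F]
  {M : Type*} [TopologicalSpace M] [ChartedSpace V M]
  {E : M → Type*} [∀ x, AddCommGroup (E x)] [∀ x, Module ℝ (E x)]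
  [∀ x, TopologicalSpace (E x)] [TopologicalSpace (TotalSpace F E)]
  [FiberBundle F E] [VectorBundle ℝ F E] [IsManifold 𝓘(ℝ, V) ∞ M]
  [FiniteDimensional ℝ V] [T2Space M] [ContMDiffVectorBundle ∞ F E 𝓘(ℝ, V)]

variable {x₀ x₁ x : M} [FiniteDimensional ℝ F]

variable (V F E) in
/-- The image of `coordDomain` under the chart at `x₀`. -/
def coordImage (x₀ : M) : Set V :=
  (extChartAt 𝓘(ℝ, V) x₀).target ∩ (extChartAt 𝓘(ℝ, V) x₀).symm ⁻¹' coordDomain V F E x₀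

omit [FiniteDimensional ℝ F] in
theorem isOpen_coordImage (x₀ : M) : IsOpen (coordImage V F E x₀) :=
  (continuousOn_extChartAt_symm x₀).isOpen_inter_preimage (isOpen_extChartAt_target x₀)
    (isOpen_coordDomain x₀)

omit [FiniteDimensional ℝ F] in
theorem mem_coordImage (hx : x ∈ coordDomain V F E x₀) :
    extChartAt 𝓘(ℝ, V) x₀ x ∈ coordImage V F E x₀ := by
  refine ⟨(extChartAt 𝓘(ℝ, V) x₀).map_source (coordDomain_source hx), ?_⟩
  rwa [mem_preimage, (extChartAt 𝓘(ℝ, V) x₀).left_inv (coordDomain_source hx)]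

omit [FiniteDimensional ℝ F] in
theorem exists_of_mem_coordImage {q : V} (hq : q ∈ coordImage V F E x₀) :
    ∃ x ∈ coordDomain V F E x₀, extChartAt 𝓘(ℝ, V) x₀ x = q :=
  ⟨_, hq.2, (extChartAt 𝓘(ℝ, V) x₀).right_inv hq.1⟩

namespace SkewAlgebroid

variable (A : SkewAlgebroid V F E)

omit [FiniteDimensional ℝ F] in
theorem contMDiffAt_anchor_section (X : ContMDiffSection 𝓘(ℝ, V) F ∞ E)
    (hx : x ∈ coordDomain V F E x₀) :
    ContMDiffAt 𝓘(ℝ, V) 𝓘(ℝ, V) ∞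
      (fun z => vecDeriv (extChartAt 𝓘(ℝ, V) x₀) z (A.anchor z (X z))) x := by
  have h1 : ContMDiffAt 𝓘(ℝ, V) (𝓘(ℝ, V).prod 𝓘(ℝ, V)) ∞
      (fun z => (⟨z, A.anchor z (X z)⟩ : TangentBundle 𝓘(ℝ, V) M)) x :=
    (A.contMDiff_anchor.comp X.contMDiff).contMDiffAt
  have h3 : ContMDiffAt 𝓘(ℝ, V).tangent 𝓘(ℝ, V × V) ∞
      (extChartAt 𝓘(ℝ, V).tangent (⟨x₀, 0⟩ : TangentBundle 𝓘(ℝ, V) M))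
      (⟨x, A.anchor x (X x)⟩ : TangentBundle 𝓘(ℝ, V) M) := by
    apply contMDiffAt_extChartAt'
    have := coordDomain_source hx
    rw [extChartAt_source] at this
    exact (TangentBundle.mem_chart_source_iff _ _).2 this
  have h4 := ContMDiffAt.comp x h3 h1
  have h5 := (contDiff_snd (𝕜 := ℝ) (E := V) (F := V) (n := ∞)).contMDiff.contMDiffAt.comp x h4
  refine h5.congr_of_eventuallyEq ?_
  filter_upwards [coordDomain_mem_nhds hx] with z hz
  rw [Function.comp_apply, Function.comp_apply, tangent_extChartAt_apply (coordDomain_source hz)]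
  rfl

/-- As `F` is finite-dimensional, smoothness of an operator-valued map may be tested on fixed
vectors, that is, on the anchor of constant sections. The test is available on a set, which explains
the open set `coordImage`. -/
theorem contDiffOn_coord_anchor : ContDiffOn ℝ ∞ (A.coord x₀).anchor (coordImage V F E x₀) := by
  rw [contDiffOn_clm_apply]
  intro u q hq
  obtain ⟨x, hx, rfl⟩ := exists_of_mem_coordImage hq
  have h1 := A.contMDiffAt_anchor_section (constSection V E x₀ u) hx
  rw [← (extChartAt 𝓘(ℝ, V) x₀).left_inv (coordDomain_source hx)] at h1
  have h2 := (h1.comp _ (contMDiffAt_extChartAt_symm hx)).contDiffAt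
  refine (h2.congr_of_eventuallyEq ?_).contDiffWithinAt
  filter_upwards [(isOpen_coordImage x₀).mem_nhds hq] with q hq
  obtain ⟨x, hx, rfl⟩ := exists_of_mem_coordImage hq
  rw [Function.comp_apply, (extChartAt 𝓘(ℝ, V) x₀).left_inv (coordDomain_source hx),
    ← coord_anchor A hx, fiberCoord_constSection hx]

theorem contDiffOn_coord_bracket : ContDiffOn ℝ ∞ (A.coord x₀).bracket (coordImage V F E x₀) := by
  rw [contDiffOn_clm_apply]
  intro u
  rw [contDiffOn_clm_apply]
  intro w q hq
  obtain ⟨x, hx, rfl⟩ := exists_of_mem_coordImage hq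
  have h1 := contMDiffAt_fiberCoord (A.bracket (constSection V E x₀ u) (constSection V E x₀ w)) hx
  rw [← (extChartAt 𝓘(ℝ, V) x₀).left_inv (coordDomain_source hx)] at h1
  have h2 := (h1.comp _ (contMDiffAt_extChartAt_symm hx)).contDiffAt
  refine (h2.congr_of_eventuallyEq ?_).contDiffWithinAt
  filter_upwards [(isOpen_coordImage x₀).mem_nhds hq] with q hq
  obtain ⟨x, hx, rfl⟩ := exists_of_mem_coordImage hq
  rw [Function.comp_apply, (extChartAt 𝓘(ℝ, V) x₀).left_inv (coordDomain_source hx),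
    ← coord_bracket A hx]

theorem coord_smoothAt (hx : x ∈ coordDomain V F E x₀) :
    (A.coord x₀).SmoothAt (extChartAt 𝓘(ℝ, V) x₀ x) :=
  ⟨A.contDiffOn_coord_anchor.contDiffAt ((isOpen_coordImage x₀).mem_nhds (mem_coordImage hx)),
    A.contDiffOn_coord_bracket.contDiffAt ((isOpen_coordImage x₀).mem_nhds (mem_coordImage hx))⟩

theorem coordChange (h₀ : x ∈ coordDomain V F E x₀) (h₁ : x ∈ coordDomain V F E x₁) :
    CoordAlgebroid.CoordChange (A.coord x₀) (A.coord x₁) (chartTrans V x₀ x₁)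
      (fiberTrans V F E x₀ x₁) (extChartAt 𝓘(ℝ, V) x₀ x) where
  base := contDiffAt_chartTrans h₀ h₁
  fiber := contDiffAt_fiberTrans h₀ h₁
  smooth_left := A.coord_smoothAt h₀
  smooth_right := by
    rw [chartTrans, Function.comp_apply, (extChartAt 𝓘(ℝ, V) x₀).left_inv (coordDomain_source h₀)]
    exact A.coord_smoothAt h₁
  anchor := by
    filter_upwards [eventually_coordDomain h₀,
      tendsto_extChartAt_symm h₀ (coordDomain_mem_nhds h₁)] with q hq hq' y
    have := A.coord_anchor_trans hq.1 hq' y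
    rwa [hq.2] at this
  bracket := by
    filter_upwards [eventually_coordDomain h₀,
      tendsto_extChartAt_symm h₀ (coordDomain_mem_nhds h₁)] with q hq hq' u w
    have := A.coord_bracket_trans hq.1 hq' u w
    rwa [hq.2] at this

variable {A}

/-- The manifold Lie bracket is the bracket of the coordinate fields, pulled back by the chart. At
the centre the chart has identity derivative, so no conjugation remains. The centre suffices because
equations along the curve are written in centred coordinates. -/
theorem IsAlmostLie.coord_almostLieAt (hA : A.IsAlmostLie) (x₀ : M) :
    (A.coord x₀).AlmostLieAt (extChartAt 𝓘(ℝ, V) x₀ x₀) := by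
  intro u w
  have : IsManifold 𝓘(ℝ, V) 1 M := .of_le (n := ∞) (by simp)
  have hx : x₀ ∈ coordDomain V F E x₀ := mem_coordDomain_self x₀
  have hsm := A.coord_smoothAt hx
  have hself : ∀ v : TangentSpace 𝓘(ℝ, V) x₀, vecDeriv (extChartAt 𝓘(ℝ, V) x₀) x₀ v = v := by
    intro v
    rw [vecDeriv, mfderiv_extChartAt_self]
    rfl
  -- Pulling a field back by the inverse chart means applying the inverse of the derivative of the
  -- inverse chart, which is the derivative of the chart.
  have hpull : ∀ u : F, (VectorField.mpullbackWithin 𝓘(ℝ, V) 𝓘(ℝ, V) (extChartAt 𝓘(ℝ, V) x₀).symm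
      (fun z => A.anchor z (constSection V E x₀ u z)) (range 𝓘(ℝ, V)) : V → V)
      =ᶠ[𝓝 (extChartAt 𝓘(ℝ, V) x₀ x₀)] fun q => (A.coord x₀).anchor q u := by
    intro u
    filter_upwards [(isOpen_coordImage x₀).mem_nhds (mem_coordImage hx)] with q hq
    have hq1 := hq.1
    obtain ⟨x, hx, rfl⟩ := exists_of_mem_coordImage hq
    have e2 := A.coord_anchor hx (constSection V E x₀ u x)
    rw [fiberCoord_constSection hx] at e2
    rw [e2]
    have e := ContinuousLinearMap.inverse_eq
      (mfderivWithin_extChartAt_symm_comp_mfderiv_extChartAt (I := 𝓘(ℝ, V)) hq1)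
      (mfderiv_extChartAt_comp_mfderivWithin_extChartAt_symm (I := 𝓘(ℝ, V)) hq1)
    refine (congrArg (fun T => T (A.anchor _ (constSection V E x₀ u _))) e).trans ?_
    have key : ∀ z, z = x → vecDeriv (extChartAt 𝓘(ℝ, V) x₀) z
        (A.anchor z (constSection V E x₀ u z)) =
        vecDeriv (extChartAt 𝓘(ℝ, V) x₀) x (A.anchor x (constSection V E x₀ u x)) := by
      rintro _ rfl
      rfl
    exact key _ ((extChartAt 𝓘(ℝ, V) x₀).left_inv (coordDomain_source hx))
  have hd : ∀ u : F, HasFDerivAt (fun q => (A.coord x₀).anchor q u)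
      ((fderiv ℝ (A.coord x₀).anchor (extChartAt 𝓘(ℝ, V) x₀ x₀)).flip u)
      (extChartAt 𝓘(ℝ, V) x₀ x₀) := by
    intro u
    have := hsm.anchor.differentiableAt_infty.hasFDerivAt.clm_apply
      (hasFDerivAt_const u (extChartAt 𝓘(ℝ, V) x₀ x₀))
    convert! this using 1
    simp
  have h := hA (constSection V E x₀ u) (constSection V E x₀ w) x₀
  rw [coord_bracket A hx, coord_anchor A hx, hself, h]
  have e : (VectorField.mlieBracket 𝓘(ℝ, V) (fun z => A.anchor z (constSection V E x₀ u z))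
      (fun z => A.anchor z (constSection V E x₀ w z)) x₀ : V) =
      VectorField.lieBracket ℝ
        (VectorField.mpullbackWithin 𝓘(ℝ, V) 𝓘(ℝ, V) (extChartAt 𝓘(ℝ, V) x₀).symm
          (fun z => A.anchor z (constSection V E x₀ u z)) (range 𝓘(ℝ, V)) : V → V)
        (VectorField.mpullbackWithin 𝓘(ℝ, V) 𝓘(ℝ, V) (extChartAt 𝓘(ℝ, V) x₀).symm
          (fun z => A.anchor z (constSection V E x₀ w z)) (range 𝓘(ℝ, V)) : V → V)
        (extChartAt 𝓘(ℝ, V) x₀ x₀) := by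
    have e1 : (mfderiv 𝓘(ℝ, V) 𝓘(ℝ, V) (extChartAt 𝓘(ℝ, V) x₀) x₀).inverse =
        ContinuousLinearMap.id ℝ V := by
      rw [mfderiv_extChartAt_self]
      exact ContinuousLinearMap.inverse_id
    have e3 : ((extChartAt 𝓘(ℝ, V) x₀).symm ⁻¹' univ ∩ range 𝓘(ℝ, V) : Set V) = univ := by simp
    refine (congrArg (fun T : V →L[ℝ] V => T _) e1).trans ?_
    refine Eq.trans ?_ (congrFun (VectorField.lieBracketWithin_univ (𝕜 := ℝ)) _)
    exact congrArg (fun S => VectorField.lieBracketWithin ℝ _ _ S (extChartAt 𝓘(ℝ, V) x₀ x₀)) e3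
  have key : ∀ W₁ W₂ : V → V,
      W₁ =ᶠ[𝓝 (extChartAt 𝓘(ℝ, V) x₀ x₀)] (fun q => (A.coord x₀).anchor q u) →
      W₂ =ᶠ[𝓝 (extChartAt 𝓘(ℝ, V) x₀ x₀)] (fun q => (A.coord x₀).anchor q w) →
      VectorField.lieBracket ℝ W₁ W₂ (extChartAt 𝓘(ℝ, V) x₀ x₀) =
        fderiv ℝ (A.coord x₀).anchor (extChartAt 𝓘(ℝ, V) x₀ x₀)
            ((A.coord x₀).anchor (extChartAt 𝓘(ℝ, V) x₀ x₀) u) w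
          - fderiv ℝ (A.coord x₀).anchor (extChartAt 𝓘(ℝ, V) x₀ x₀)
            ((A.coord x₀).anchor (extChartAt 𝓘(ℝ, V) x₀ x₀) w) u := by
    intro W₁ W₂ h₁ h₂
    rw [VectorField.lieBracket, h₁.fderiv_eq, h₂.fderiv_eq, h₁.self_of_nhds, h₂.self_of_nhds,
      (hd u).fderiv, (hd w).fderiv]
    rfl
  exact e.trans (key _ _ (hpull u) (hpull w))

set_option synthInstance.maxHeartbeats 400000 in
/-- The Jacobi identity for the structure functions. -/
theorem IsLie.coord_jacobi (hA : A.IsLie) (hx : x ∈ coordDomain V F E x₀) (u v w : F) :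
    let q := extChartAt 𝓘(ℝ, V) x₀ x
    let c := (A.coord x₀).bracket
    let ρ := (A.coord x₀).anchor
    (c q (c q u v) w - fderiv ℝ c q (ρ q w) u v) + (c q (c q v w) u - fderiv ℝ c q (ρ q u) v w)
      + (c q (c q w u) v - fderiv ℝ c q (ρ q v) w u) = 0 := by
  intro q c ρ
  have hsm := A.coord_smoothAt hx
  have hconst : ∀ u w : F, ∀ y : E x, vecDeriv (fun z => fiberCoord F E x₀ z
      (constSection V E x₀ w z)) x (A.anchor x y) = 0 := by
    intro u w y
    have e : (fun z => fiberCoord F E x₀ z (constSection V E x₀ w z)) =ᶠ[𝓝 x] fun _ => w := by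
      filter_upwards [coordDomain_mem_nhds hx] with z hz using fiberCoord_constSection hz w
    rw [vecDeriv, e.mfderiv_eq, mfderiv_const]
    rfl
  have hbr : ∀ u v w : F, vecDeriv (fun z => fiberCoord F E x₀ z
      (A.bracket (constSection V E x₀ u) (constSection V E x₀ v) z)) x
      (A.anchor x (constSection V E x₀ w x)) = fderiv ℝ c q (ρ q w) u v := by
    intro u v w
    rw [vecDeriv_eq_fderiv hx (contMDiffAt_fiberCoord _ hx), ← coord_anchor A hx,
      fiberCoord_constSection hx]
    have e : (fun z => fiberCoord F E x₀ z
        (A.bracket (constSection V E x₀ u) (constSection V E x₀ v) z)) ∘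
        (extChartAt 𝓘(ℝ, V) x₀).symm =ᶠ[𝓝 (extChartAt 𝓘(ℝ, V) x₀ x)] fun q => c q u v := by
      filter_upwards [eventually_coordDomain hx] with q hq
      rw [Function.comp_apply, ← coord_bracket A hq.1, hq.2]
    rw [e.fderiv_eq, ((hsm.bracket.differentiableAt_infty.hasFDerivAt.clm_apply
      (hasFDerivAt_const u _)).clm_apply (hasFDerivAt_const v _)).fderiv]
    simp [c, q, ρ]
  -- In `[[u, v], w]` the constant section `w` has no derivative term, while the components of `[u,
  -- v]` are `c(·)(u, v)`, whose derivative along `ρ w` survives.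
  have key : ∀ u v w : F, fiberCoord F E x₀ x (A.bracket (A.bracket (constSection V E x₀ u)
      (constSection V E x₀ v)) (constSection V E x₀ w) x) =
      c q (c q u v) w - fderiv ℝ c q (ρ q w) u v := by
    intro u v w
    rw [fiberCoord_bracket A _ _ hx, hconst u w, hbr, ← coord_bracket A hx,
      fiberCoord_constSection hx, add_zero]
  rw [← key, ← key, ← key, ← map_add, ← map_add]
  have h := hA.2 (constSection V E x₀ u) (constSection V E x₀ v) (constSection V E x₀ w)
  have h' := congrArg (fun X : ContMDiffSection 𝓘(ℝ, V) F ∞ E => fiberCoord F E x₀ x (X x)) h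
  exact h'.trans (map_zero _)

end SkewAlgebroid

end Algebroid

/-! ### Curves, sections along them and lifts of generators in coordinates. -/

section Algebroid

variable {V : Type*} [NormedAddCommGroup V] [NormedSpace ℝ V]
  {F : Type*} [NormedAddCommGroup F] [NormedSpace ℝ F]
  {M : Type*} [TopologicalSpace M] [ChartedSpace V M]
  {E : M → Type*} [∀ x, AddCommGroup (E x)] [∀ x, Module ℝ (E x)]
  [∀ x, TopologicalSpace (E x)] [TopologicalSpace (TotalSpace F E)]
  [FiberBundle F E] [VectorBundle ℝ F E] [IsManifold 𝓘(ℝ, V) ∞ M]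
  [FiniteDimensional ℝ V] [T2Space M] [ContMDiffVectorBundle ∞ F E 𝓘(ℝ, V)]

variable {x₀ x₁ x : M} {k : ℕ∞} {t₀ t₁ : ℝ} {h : t₀ < t₁} {γ : Icc t₀ t₁ → TotalSpace F E} {s : ℝ}

/-- The base path of a curve in the total space, extended to `ℝ`. -/
def basePath (h : t₀ < t₁) (γ : Icc t₀ t₁ → TotalSpace F E) (s : ℝ) : M :=
  (extendCurve h γ s).proj

/-- A section along a curve, extended to `ℝ`. -/
def extendSection (h : t₀ < t₁) {γ : Icc t₀ t₁ → TotalSpace F E} (η : ∀ t, E (γ t).proj) (s : ℝ) :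
    E (basePath h γ s) :=
  η (projIcc t₀ t₁ h.le s)

theorem extendCurve_of_mem {X : Type*} (f : Icc t₀ t₁ → X) (hs : s ∈ Icc t₀ t₁) :
    extendCurve h f s = f ⟨s, hs⟩ :=
  IccExtend_of_mem h.le f hs

theorem basePath_coe (t : Icc t₀ t₁) : basePath h γ t = (γ t).proj := by
  rw [basePath, extendCurve_of_mem γ t.2]

theorem IsCkCurve.continuousWithinAt_basePath (hγ : IsCkCurve V k h γ) (hs : s ∈ Icc t₀ t₁) :
    ContinuousWithinAt (basePath h γ) (Icc t₀ t₁) s :=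
  (contMDiffWithinAt_totalSpace.1 (hγ s hs)).1.continuousWithinAt

theorem IsCkCurve.eventually_coordDomain (hγ : IsCkCurve V k h γ) (hs : s ∈ Icc t₀ t₁)
    (hx : basePath h γ s ∈ coordDomain V F E x₀) :
    ∀ᶠ r in 𝓝[Icc t₀ t₁] s, basePath h γ r ∈ coordDomain V F E x₀ :=
  hγ.continuousWithinAt_basePath hs (coordDomain_mem_nhds hx)

theorem IsCkCurve.contDiffWithinAt_coordCurve (hγ : IsCkCurve V k h γ) (hs : s ∈ Icc t₀ t₁)
    (hx : basePath h γ s ∈ coordDomain V F E x₀) :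
    ContDiffWithinAt ℝ k (SkewAlgebroid.coordCurve V x₀ h γ) (Icc t₀ t₁) s := by
  have h1 : ContMDiffAt (𝓘(ℝ, V).prod 𝓘(ℝ, F)) 𝓘(ℝ, V × F) ∞ (bundleChart V F E x₀)
      (extendCurve h γ s) := by
    apply contMDiffAt_extChartAt'
    have := bundleChart_source (p := extendCurve h γ s) hx
    rwa [bundleChart, extChartAt_source] at this
  have h2 := (h1.of_le (n := ∞) (m := k) (by exact_mod_cast le_top)).comp_contMDiffWithinAt s
    (hγ s hs)
  exact h2.contDiffWithinAt

theorem coordCurve_fst (hx : basePath h γ s ∈ coordDomain V F E x₀) :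
    (SkewAlgebroid.coordCurve V x₀ h γ s).1 = extChartAt 𝓘(ℝ, V) x₀ (basePath h γ s) := by
  rw [SkewAlgebroid.coordCurve, bundleChart_apply V F E x₀ (coordDomain_baseSet hx)]
  rfl

theorem coordCurve_trans (h₀ : basePath h γ s ∈ coordDomain V F E x₀)
    (h₁ : basePath h γ s ∈ coordDomain V F E x₁) :
    SkewAlgebroid.coordCurve V x₁ h γ s =
      CoordAlgebroid.fiberMap (chartTrans V x₀ x₁) (fiberTrans V F E x₀ x₁)
        (SkewAlgebroid.coordCurve V x₀ h γ s) :=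
  bundleChart_trans (p := extendCurve h γ s) h₀ h₁

theorem coordCurve_sectionCurve (η : ∀ t, E (γ t).proj)
    (hx : basePath h γ s ∈ coordDomain V F E x₀) :
    SkewAlgebroid.coordCurve V x₀ h (sectionCurve (F := F) η) s =
      (extChartAt 𝓘(ℝ, V) x₀ (basePath h γ s),
        fiberCoord F E x₀ (basePath h γ s) (extendSection h η s)) :=
  bundleChart_mk (x := basePath h γ s) hx (extendSection h η s)

theorem coordCurve_sectionCurve_fst (η : ∀ t, E (γ t).proj)
    (hx : basePath h γ s ∈ coordDomain V F E x₀) :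
    (SkewAlgebroid.coordCurve V x₀ h (sectionCurve (F := F) η) s).1 =
      (SkewAlgebroid.coordCurve V x₀ h γ s).1 := by
  rw [coordCurve_sectionCurve η hx, coordCurve_fst hx]

variable {Δ : Icc t₀ t₁ → TangentBundle (𝓘(ℝ, V).prod 𝓘(ℝ, F)) (TotalSpace F E)}

/-- The fibre part of a tangent vector of the total space in the bundle coordinates at `x₀`. -/
def vecCoord (x₀ : M) (q : TangentBundle (𝓘(ℝ, V).prod 𝓘(ℝ, F)) (TotalSpace F E)) : V × F :=
  mfderiv (𝓘(ℝ, V).prod 𝓘(ℝ, F)) 𝓘(ℝ, V × F) (bundleChart V F E x₀) q.proj q.2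

theorem coordLift_apply (hx : (extendCurve h Δ s).proj.proj ∈ coordDomain V F E x₀) :
    SkewAlgebroid.coordLift x₀ h Δ s =
      (bundleChart V F E x₀ (extendCurve h Δ s).proj, vecCoord x₀ (extendCurve h Δ s)) := by
  rw [SkewAlgebroid.coordLift, tangent_extChartAt_apply]
  · rfl
  · exact bundleChart_source hx

theorem coordLift_trans (h₀ : (extendCurve h Δ s).proj.proj ∈ coordDomain V F E x₀)
    (h₁ : (extendCurve h Δ s).proj.proj ∈ coordDomain V F E x₁) :
    SkewAlgebroid.coordLift x₁ h Δ s = tangentPush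
      (CoordAlgebroid.fiberMap (chartTrans V x₀ x₁) (fiberTrans V F E x₀ x₁))
      (SkewAlgebroid.coordLift x₀ h Δ s) := by
  rw [coordLift_apply h₀, coordLift_apply h₁, tangentPush, bundleChart_trans h₀ h₁]
  exact congrArg (Prod.mk _) (mfderiv_bundleChart_trans h₀ h₁ _)

theorem contDiffWithinAt_coordLift
    (hΔ : ContMDiffOn 𝓘(ℝ, ℝ) (𝓘(ℝ, V).prod 𝓘(ℝ, F)).tangent k (extendCurve h Δ) (Icc t₀ t₁))
    (hs : s ∈ Icc t₀ t₁) (hx : (extendCurve h Δ s).proj.proj ∈ coordDomain V F E x₀) :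
    ContDiffWithinAt ℝ k (SkewAlgebroid.coordLift x₀ h Δ) (Icc t₀ t₁) s := by
  have h1 : ContMDiffAt (𝓘(ℝ, V).prod 𝓘(ℝ, F)).tangent 𝓘(ℝ, (V × F) × (V × F)) ∞
      (extChartAt (𝓘(ℝ, V).prod 𝓘(ℝ, F)).tangent
        (⟨zeroSection F E x₀, 0⟩ : TangentBundle (𝓘(ℝ, V).prod 𝓘(ℝ, F)) (TotalSpace F E)))
      (extendCurve h Δ s) := by
    apply contMDiffAt_extChartAt'
    have := bundleChart_source (p := (extendCurve h Δ s).proj) hx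
    rw [bundleChart, extChartAt_source] at this
    exact (TangentBundle.mem_chart_source_iff _ _).2 this
  have h2 := (h1.of_le (n := ∞) (m := k) (by exact_mod_cast le_top)).comp_contMDiffWithinAt s
    (hΔ s hs)
  exact h2.contDiffWithinAt

variable [FiniteDimensional ℝ F] {A : SkewAlgebroid V F E} {η ξ : ∀ t, E (γ t).proj}

namespace SkewAlgebroid

theorem coord_anchor_coordCurve (η : ∀ t, E (γ t).proj)
    (hx : basePath h γ s ∈ coordDomain V F E x₀) :
    (A.coord x₀).anchor (coordCurve V x₀ h γ s).1
        (coordCurve V x₀ h (sectionCurve (F := F) η) s).2 =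
      vecDeriv (extChartAt 𝓘(ℝ, V) x₀) (basePath h γ s)
        (A.anchor (basePath h γ s) (extendSection h η s)) := by
  rw [coordCurve_fst hx, coordCurve_sectionCurve η hx, A.coord_anchor hx]

namespace IsGeneratorLift

omit [FiniteDimensional ℝ F] in
theorem extend_proj (H : A.IsGeneratorLift k h γ η ξ Δ) (s : ℝ) :
    (extendCurve h Δ s).proj = extendCurve h (sectionCurve ξ) s :=
  H.proj_eq _

omit [FiniteDimensional ℝ F] in
theorem extend_proj_proj (H : A.IsGeneratorLift k h γ η ξ Δ) (s : ℝ) :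
    (extendCurve h Δ s).proj.proj = basePath h γ s := by
  have e := congrArg (TotalSpace.proj (F := F) (E := E)) (H.proj_eq (projIcc t₀ t₁ h.le s))
  exact e

omit [FiniteDimensional ℝ F] in
theorem contDiffWithinAt (H : A.IsGeneratorLift k h γ η ξ Δ) (hs : s ∈ Icc t₀ t₁)
    (hx : basePath h γ s ∈ coordDomain V F E x₀) :
    ContDiffWithinAt ℝ k (coordLift x₀ h Δ) (Icc t₀ t₁) s :=
  contDiffWithinAt_coordLift H.contMDiffOn hs (by rwa [H.extend_proj_proj])

omit [FiniteDimensional ℝ F] in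
theorem trans (H : A.IsGeneratorLift k h γ η ξ Δ)
    (h₀ : basePath h γ s ∈ coordDomain V F E x₀) (h₁ : basePath h γ s ∈ coordDomain V F E x₁) :
    coordLift x₁ h Δ s = tangentPush
      (CoordAlgebroid.fiberMap (chartTrans V x₀ x₁) (fiberTrans V F E x₀ x₁))
      (coordLift x₀ h Δ s) :=
  coordLift_trans (by rwa [H.extend_proj_proj]) (by rwa [H.extend_proj_proj])

omit [FiniteDimensional ℝ F] in
theorem coordLift_fst (H : A.IsGeneratorLift k h γ η ξ Δ)
    (hx : basePath h γ s ∈ coordDomain V F E x₀) :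
    (coordLift x₀ h Δ s).1 = coordCurve V x₀ h (sectionCurve ξ) s := by
  rw [coordLift_apply (by rwa [H.extend_proj_proj]), H.extend_proj]
  rfl

omit [FiniteDimensional ℝ F] in
theorem coordLift_fst_fst (H : A.IsGeneratorLift k h γ η ξ Δ)
    (hx : basePath h γ s ∈ coordDomain V F E x₀) :
    (coordLift x₀ h Δ s).1.1 = (coordCurve V x₀ h γ s).1 := by
  rw [H.coordLift_fst hx, coordCurve_sectionCurve_fst ξ hx]

end IsGeneratorLift

end SkewAlgebroid

-- In bundle coordinates the projection is the first component, so the base part of a tangent vector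
-- of `E` is the chart image of `Tτ`. This translates the condition `Tτ ∘ Δξ = ρ(η)`.
omit [FiniteDimensional ℝ F] in
theorem vecCoord_fst (q : TangentBundle (𝓘(ℝ, V).prod 𝓘(ℝ, F)) (TotalSpace F E))
    (hx : q.proj.proj ∈ coordDomain V F E x₀) :
    (vecCoord x₀ q).1 = vecDeriv (extChartAt 𝓘(ℝ, V) x₀) q.proj.proj
      (mfderiv (𝓘(ℝ, V).prod 𝓘(ℝ, F)) 𝓘(ℝ, V) (TotalSpace.proj (F := F) (E := E)) q.proj q.2) := by
  have : IsManifold 𝓘(ℝ, V) 1 M := .of_le (n := ∞) (by simp)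
  have : IsManifold (𝓘(ℝ, V).prod 𝓘(ℝ, F)) 1 (TotalSpace F E) := .of_le (n := ∞) (by simp)
  have e : (fun p => (bundleChart V F E x₀ p).1) =ᶠ[𝓝 q.proj]
      extChartAt 𝓘(ℝ, V) x₀ ∘ (TotalSpace.proj (F := F) (E := E)) := by
    filter_upwards [(FiberBundle.continuous_proj F E).continuousAt (coordDomain_mem_nhds hx)]
      with p hp
    rw [bundleChart_apply V F E x₀ (coordDomain_baseSet hp)]
    rfl
  have hm : MDifferentiableAt (𝓘(ℝ, V).prod 𝓘(ℝ, F)) 𝓘(ℝ, V × F) (bundleChart V F E x₀) q.proj := by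
    apply mdifferentiableAt_extChartAt
    have := bundleChart_source (p := q.proj) hx
    rwa [bundleChart, extChartAt_source] at this
  have h1 := ((ContinuousLinearMap.fst ℝ V F).hasFDerivAt.hasMFDerivAt.comp q.proj
    hm.hasMFDerivAt).mfderiv
  have h2 := mfderiv_comp (I' := 𝓘(ℝ, V)) q.proj
    (mdifferentiableAt_extChartAt (I := 𝓘(ℝ, V)) (x := x₀) (y := q.proj.proj)
      (by simpa using coordDomain_source hx))
    ((contMDiff_proj (n := 1) (IB := 𝓘(ℝ, V)) E).mdifferentiableAt (by simp))
  have h3 := (h1.symm.trans e.mfderiv_eq).trans h2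
  exact congrArg (fun T => T q.2) h3

-- The zero section has vanishing fibre coordinate in every chart. Hence null vectors of `Tτ` have
-- zero vertical component, the source of vanishing boundary terms.
omit [FiniteDimensional ℝ F] in
theorem vecCoord_tangentMap_zeroSection (v : TangentSpace 𝓘(ℝ, V) x)
    (hx : x ∈ coordDomain V F E x₀) :
    vecCoord x₀ (tangentMap 𝓘(ℝ, V) (𝓘(ℝ, V).prod 𝓘(ℝ, F)) (zeroSection F E) ⟨x, v⟩) =
      (vecDeriv (extChartAt 𝓘(ℝ, V) x₀) x v, 0) := by
  have : IsManifold 𝓘(ℝ, V) 1 M := .of_le (n := ∞) (by simp)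
  have : IsManifold (𝓘(ℝ, V).prod 𝓘(ℝ, F)) 1 (TotalSpace F E) := .of_le (n := ∞) (by simp)
  have e : bundleChart V F E x₀ ∘ zeroSection F E =ᶠ[𝓝 x]
      fun z => ContinuousLinearMap.inl ℝ V F (extChartAt 𝓘(ℝ, V) x₀ z) := by
    filter_upwards [coordDomain_mem_nhds hx] with z hz
    rw [Function.comp_apply, zeroSection, bundleChart_mk hz, map_zero]
    rfl
  have hm : MDifferentiableAt (𝓘(ℝ, V).prod 𝓘(ℝ, F)) 𝓘(ℝ, V × F) (bundleChart V F E x₀)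
      (zeroSection F E x) := by
    apply mdifferentiableAt_extChartAt
    have := bundleChart_source (p := zeroSection F E x) hx
    rwa [bundleChart, extChartAt_source] at this
  have h1 := mfderiv_comp (I' := 𝓘(ℝ, V).prod 𝓘(ℝ, F)) x hm
    ((contMDiff_zeroSection (n := 1) (IB := 𝓘(ℝ, V)) ℝ E).mdifferentiableAt (by simp))
  have h2 := ((ContinuousLinearMap.inl ℝ V F).hasFDerivAt.hasMFDerivAt.comp x
    (mdifferentiableAt_extChartAt (I := 𝓘(ℝ, V)) (x := x₀) (y := x)
      (by simpa using coordDomain_source hx)).hasMFDerivAt).mfderiv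
  have h3 := (h1.symm.trans e.mfderiv_eq).trans h2
  exact congrArg (fun T => T v) h3

namespace SkewAlgebroid
namespace IsGeneratorLift

theorem coordLift_snd_fst (H : A.IsGeneratorLift k h γ η ξ Δ)
    (hx : basePath h γ s ∈ coordDomain V F E x₀) :
    (coordLift x₀ h Δ s).2.1 = (A.coord x₀).anchor (coordCurve V x₀ h γ s).1
        (coordCurve V x₀ h (sectionCurve (F := F) η) s).2 := by
  have hx' : (extendCurve h Δ s).proj.proj ∈ coordDomain V F E x₀ := by
    rwa [H.extend_proj_proj]
  rw [coord_anchor_coordCurve η hx, coordLift_apply hx', vecCoord_fst _ hx']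
  have e := H.base (projIcc t₀ t₁ h.le s)
  exact congrArg (fun q : TangentBundle 𝓘(ℝ, V) M => vecDeriv (extChartAt 𝓘(ℝ, V) x₀) q.proj q.2) e

omit [FiniteDimensional ℝ F] in
theorem coordLift_snd_snd (H : A.IsGeneratorLift k h γ η ξ Δ) (hs : s = t₀ ∨ s = t₁)
    (hx : basePath h γ s ∈ coordDomain V F E x₀) : (coordLift x₀ h Δ s).2.2 = 0 := by
  have hx' : (extendCurve h Δ s).proj.proj ∈ coordDomain V F E x₀ := by
    rwa [H.extend_proj_proj]
  have hs' : s ∈ Icc t₀ t₁ := by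
    rcases hs with rfl | rfl
    exacts [left_mem_Icc.2 h.le, right_mem_Icc.2 h.le]
  rw [coordLift_apply hx', extendCurve_of_mem Δ hs', H.null ⟨s, hs'⟩ hs,
    vecCoord_tangentMap_zeroSection]
  rwa [← basePath_coe (h := h)]

end IsGeneratorLift
end SkewAlgebroid

end Algebroid

/-! ### Derivatives up to the end-points, and tangent maps of `λ` and `Λ`. -/

section Calculus

variable {X : Type*} [NormedAddCommGroup X] [NormedSpace ℝ X] {t₀ t₁ s : ℝ} {k : ℕ∞} {f : ℝ → X}

theorem ContDiffWithinAt.differentiableWithinAt_of_one_le {S : Set ℝ}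
    (hf : ContDiffWithinAt ℝ k f S s) (hk : 1 ≤ k) : DifferentiableWithinAt ℝ f S s := by
  refine hf.differentiableWithinAt ?_
  rintro h
  have h' : k = 0 := by exact_mod_cast h
  rw [h'] at hk
  exact absurd hk (by simp)

theorem ContDiffWithinAt.continuousWithinAt_derivWithin (h : t₀ < t₁) (hs : s ∈ Icc t₀ t₁)
    (hf : ContDiffWithinAt ℝ k f (Icc t₀ t₁) s) (hk : 1 ≤ k) :
    ContinuousWithinAt (derivWithin f (Icc t₀ t₁)) (Icc t₀ t₁) s := by
  have h1 := hf.fderivWithin_right (m := 0) (uniqueDiffOn_Icc h)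
    (by rw [zero_add]; exact_mod_cast hk) hs
  have h2 := h1.continuousWithinAt.clm_apply (continuousWithinAt_const (b := (1 : ℝ)))
  exact h2

end Calculus

namespace CoordAlgebroid

variable {B F : Type*} [NormedAddCommGroup B] [NormedSpace ℝ B]
  [NormedAddCommGroup F] [NormedSpace ℝ F] {ℓ : B × F → ℝ} {A : CoordAlgebroid B F} {p : B × F}

theorem fderiv_legendre (hℓ : ContDiffAt ℝ ∞ ℓ p) (v : B × F) :
    fderiv ℝ (legendre ℓ) p v = (v.1, fderiv ℝ (momentum ℓ) p v) := by
  have h1 : HasFDerivAt (fun p : B × F => p.1) _ p := (ContinuousLinearMap.fst ℝ B F).hasFDerivAt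
  have h2 := (contDiffAt_momentum hℓ).differentiableAt_infty.hasFDerivAt
  have e : fderiv ℝ (legendre ℓ) p = _ := (h1.prodMk h2).fderiv
  rw [e]
  rfl

theorem fderiv_tulczyjew (hA : A.SmoothAt p.1) (hℓ : ContDiffAt ℝ ∞ ℓ p) (v : B × F) :
    fderiv ℝ (A.tulczyjew ℓ) p v = ((v.1, fderiv ℝ (momentum ℓ) p v),
      (fderiv ℝ A.anchor p.1 v.1 p.2 + A.anchor p.1 v.2, fderiv ℝ (A.force ℓ) p v)) := by
  have h1 : HasFDerivAt (fun p : B × F => p.1) _ p := (ContinuousLinearMap.fst ℝ B F).hasFDerivAt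
  have h12 : HasFDerivAt (fun p : B × F => p.2) _ p := (ContinuousLinearMap.snd ℝ B F).hasFDerivAt
  have h2 := (contDiffAt_momentum hℓ).differentiableAt_infty.hasFDerivAt
  have h3 := (hA.contDiffAt_force hℓ).differentiableAt_infty.hasFDerivAt
  have h4 := (hA.anchor.differentiableAt_infty.hasFDerivAt.comp p h1).clm_apply h12
  have e : fderiv ℝ (A.tulczyjew ℓ) p = _ := ((h1.prodMk h2).prodMk (h4.prodMk h3)).fderiv
  rw [e]
  simp [add_comm]

end CoordAlgebroid

/-! ### The integrand and the Jacobi equation along the curve. -/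

section Algebroid

variable {V : Type*} [NormedAddCommGroup V] [NormedSpace ℝ V]
  {F : Type*} [NormedAddCommGroup F] [NormedSpace ℝ F]
  {M : Type*} [TopologicalSpace M] [ChartedSpace V M]
  {E : M → Type*} [∀ x, AddCommGroup (E x)] [∀ x, Module ℝ (E x)]
  [∀ x, TopologicalSpace (E x)] [TopologicalSpace (TotalSpace F E)]
  [FiberBundle F E] [VectorBundle ℝ F E] [IsManifold 𝓘(ℝ, V) ∞ M]
  [FiniteDimensional ℝ V] [T2Space M] [ContMDiffVectorBundle ∞ F E 𝓘(ℝ, V)]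

variable {x₀ x₁ x : M} {k : ℕ∞} {t₀ t₁ : ℝ} {h : t₀ < t₁} {γ : Icc t₀ t₁ → TotalSpace F E} {s : ℝ}
  {Δ Δ' : Icc t₀ t₁ → TangentBundle (𝓘(ℝ, V).prod 𝓘(ℝ, F)) (TotalSpace F E)}
  [FiniteDimensional ℝ F] {A : SkewAlgebroid V F E} {η ξ : ∀ t, E (γ t).proj}
  {L : TotalSpace F E → ℝ}

open CoordAlgebroid

omit [T2Space M] [FiniteDimensional ℝ V] [FiniteDimensional ℝ F]
  [IsManifold 𝓘(ℝ, V) ∞ M] [ContMDiffVectorBundle ∞ F E 𝓘(ℝ, V)] in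
theorem uniqueDiffWithinAt_Icc_of_mem (h : t₀ < t₁) (hs : s ∈ Icc t₀ t₁) :
    UniqueDiffWithinAt ℝ (Icc t₀ t₁) s := uniqueDiffOn_Icc h s hs

namespace SkewAlgebroid

omit [FiniteDimensional ℝ F] in
theorem contDiffAt_coordLagrangian_coordCurve
    (hL : ContMDiff (𝓘(ℝ, V).prod 𝓘(ℝ, F)) 𝓘(ℝ, ℝ) ∞ L)
    (hx : basePath h γ s ∈ coordDomain V F E x₀) :
    ContDiffAt ℝ ∞ (coordLagrangian V L x₀) (coordCurve V x₀ h γ s) :=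
  contDiffAt_coordLagrangian hL (p := extendCurve h γ s) hx

theorem smoothAt_coordCurve (A : SkewAlgebroid V F E)
    (hx : basePath h γ s ∈ coordDomain V F E x₀) :
    (A.coord x₀).SmoothAt (coordCurve V x₀ h γ s).1 := by
  rw [coordCurve_fst hx]
  exact A.coord_smoothAt hx

theorem coordChange_coordCurve (A : SkewAlgebroid V F E)
    (h₀ : basePath h γ s ∈ coordDomain V F E x₀) (h₁ : basePath h γ s ∈ coordDomain V F E x₁) :
    CoordChange (A.coord x₀) (A.coord x₁) (chartTrans V x₀ x₁) (fiberTrans V F E x₀ x₁)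
      (coordCurve V x₀ h γ s).1 := by
  rw [coordCurve_fst h₀]
  exact A.coordChange h₀ h₁

theorem IsAlmostLie.almostLieAt_coordCurve (hA : A.IsAlmostLie) :
    (A.coord (basePath h γ s)).AlmostLieAt (coordCurve V (basePath h γ s) h γ s).1 := by
  rw [coordCurve_fst (mem_coordDomain_self _)]
  exact hA.coord_almostLieAt _

theorem IsELSolution.hasDerivWithinAt (hEL : A.IsELSolution L h γ) (hs : s ∈ Icc t₀ t₁) :
    HasDerivWithinAt (fun r => legendre (coordLagrangian V L (basePath h γ s))
        (coordCurve V (basePath h γ s) h γ r))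
      ((A.coord (basePath h γ s)).tulczyjew (coordLagrangian V L (basePath h γ s))
        (coordCurve V (basePath h γ s) h γ s)).2 (Icc t₀ t₁) s := by
  have e := hEL ⟨s, hs⟩
  rw [← basePath_coe (h := h)] at e
  exact e

theorem IsELSolution.hasDerivWithinAt_base (hEL : A.IsELSolution L h γ) (hs : s ∈ Icc t₀ t₁) :
    HasDerivWithinAt (fun r => (coordCurve V (basePath h γ s) h γ r).1)
      ((A.coord (basePath h γ s)).anchor (coordCurve V (basePath h γ s) h γ s).1
        (coordCurve V (basePath h γ s) h γ s).2) (Icc t₀ t₁) s :=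
  (hEL.hasDerivWithinAt hs).prod_fst

theorem IsELSolution.hasDerivWithinAt_momentum (hEL : A.IsELSolution L h γ)
    (hs : s ∈ Icc t₀ t₁) :
    HasDerivWithinAt (fun r => momentum (coordLagrangian V L (basePath h γ s))
        (coordCurve V (basePath h γ s) h γ r))
      ((A.coord (basePath h γ s)).force (coordLagrangian V L (basePath h γ s))
        (coordCurve V (basePath h γ s) h γ s)) (Icc t₀ t₁) s :=
  (hEL.hasDerivWithinAt hs).prod_snd

/-- The integrand of the second variation at `t`, computed in the bundle coordinates at `x₀`. -/
def integrandIn (A : SkewAlgebroid V F E) (L : TotalSpace F E → ℝ) (h : t₀ < t₁)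
    (γ : Icc t₀ t₁ → TotalSpace F E) (η : ∀ t, E (γ t).proj)
    (Δ : Icc t₀ t₁ → TangentBundle (𝓘(ℝ, V).prod 𝓘(ℝ, F)) (TotalSpace F E)) (x₀ : M) (t : ℝ) : ℝ :=
  tangentLiftFun (tangentLiftFun (coordLagrangian V L x₀))
    ((A.coord x₀).secondVector (coordCurve V x₀ h γ t) (A.coordVariation x₀ h γ η t)
      (coordLift x₀ h Δ t) (derivWithin (coordLift x₀ h Δ) (Icc t₀ t₁) t))

theorem secondVariationIntegrand_eq_integrandIn (t : ℝ) :
    A.secondVariationIntegrand L h γ η Δ t = A.integrandIn L h γ η Δ (basePath h γ t) t := rfl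

theorem coordVariation_trans (hEL : A.IsELSolution L h γ) (hη : IsCkCurve V k h (sectionCurve η))
    (hγ : IsCkCurve V k h γ) (hk : 1 ≤ k)
    (hs : s ∈ Icc t₀ t₁) (hx : basePath h γ s ∈ coordDomain V F E x₁) :
    A.coordVariation x₁ h γ η s = fderiv ℝ (fiberMap (chartTrans V (basePath h γ s) x₁)
      (fiberTrans V F E (basePath h γ s) x₁)) (coordCurve V (basePath h γ s) h γ s)
        (A.coordVariation (basePath h γ s) h γ η s) := by
  have h₀ : basePath h γ s ∈ coordDomain V F E (basePath h γ s) := mem_coordDomain_self _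
  have hev₀ := hγ.eventually_coordDomain hs h₀
  have hev₁ := hγ.eventually_coordDomain hs hx
  refine (A.coordChange_coordCurve h₀ hx).curveVariation_eq (uniqueDiffWithinAt_Icc_of_mem h hs) hs
    (hEL.hasDerivWithinAt_base hs)
    ((hη.contDiffWithinAt_coordCurve hs h₀).differentiableWithinAt_of_one_le hk) ?_
    (coordCurve_trans h₀ hx) ?_
  · filter_upwards [hev₀] with r hr using coordCurve_sectionCurve_fst η hr
  · filter_upwards [hev₀, hev₁] with r hr hr' using coordCurve_trans hr hr'

/-- The centred chart at `s` may be replaced by any chart whose coordinate domain contains the base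
point. In particular one fixed chart serves for all times near a given one. -/
theorem integrandIn_eq (hA : A.IsAlmostLie) (hL : ContMDiff (𝓘(ℝ, V).prod 𝓘(ℝ, F)) 𝓘(ℝ, ℝ) ∞ L)
    (hEL : A.IsELSolution L h γ) (hη : IsCkCurve V k h (sectionCurve η)) (hγ : IsCkCurve V k h γ)
    (hk : 1 ≤ k) (H : A.IsGeneratorLift k h γ η ξ Δ) (hs : s ∈ Icc t₀ t₁)
    (hx : basePath h γ s ∈ coordDomain V F E x₁) :
    A.integrandIn L h γ η Δ x₁ s = A.secondVariationIntegrand L h γ η Δ s := by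
  have h₀ : basePath h γ s ∈ coordDomain V F E (basePath h γ s) := mem_coordDomain_self _
  have hev₀ := hγ.eventually_coordDomain hs h₀
  have hev₁ := hγ.eventually_coordDomain hs hx
  refine (A.coordChange_coordCurve h₀ hx).integrand_eq
    (e₀ := coordCurve V (basePath h γ s) h (sectionCurve η))
    (e₁ := coordCurve V x₁ h (sectionCurve η)) hA.almostLieAt_coordCurve
    (uniqueDiffWithinAt_Icc_of_mem h hs) hs (hEL.hasDerivWithinAt_base hs)
    ((hη.contDiffWithinAt_coordCurve hs h₀).differentiableWithinAt_of_one_le hk) ?_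
    ((H.contDiffWithinAt hs h₀).differentiableWithinAt_of_one_le hk) ?_ ?_
    (coordCurve_trans h₀ hx) ?_ ?_ (contDiffAt_coordLagrangian_coordCurve hL h₀)
    (contDiffAt_coordLagrangian_coordCurve hL hx)
    (coordLagrangian_trans L (p := extendCurve h γ s) h₀ hx)
  · filter_upwards [hev₀] with r hr using coordCurve_sectionCurve_fst η hr
  · filter_upwards [hev₀] with r hr using H.coordLift_fst_fst hr
  · filter_upwards [hev₀] with r hr using H.coordLift_snd_fst hr
  · filter_upwards [hev₀, hev₁] with r hr hr' using coordCurve_trans hr hr'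
  · filter_upwards [hev₀, hev₁] with r hr hr' using H.trans hr hr'

theorem integrandIn_eq_firstVar (hL : ContMDiff (𝓘(ℝ, V).prod 𝓘(ℝ, F)) 𝓘(ℝ, ℝ) ∞ L)
    (hx : basePath h γ s ∈ coordDomain V F E x₁) :
    A.integrandIn L h γ η Δ x₁ s =
      fderiv ℝ ((A.coord x₁).firstVar (coordLagrangian V L x₁))
        (coordCurve V x₁ h γ s, ((coordLift x₁ h Δ s).1.2,
          (derivWithin (coordLift x₁ h Δ) (Icc t₀ t₁) s).1.2))
        (A.coordVariation x₁ h γ η s, ((coordLift x₁ h Δ s).2.2,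
          (derivWithin (coordLift x₁ h Δ) (Icc t₀ t₁) s).2.2)) :=
  (A.smoothAt_coordCurve hx).secondVariation_eq (contDiffAt_coordLagrangian_coordCurve hL hx)

theorem integrandIn_eq_sum (hL : ContMDiff (𝓘(ℝ, V).prod 𝓘(ℝ, F)) 𝓘(ℝ, ℝ) ∞ L)
    (hx : basePath h γ s ∈ coordDomain V F E x₁) :
    A.integrandIn L h γ η Δ x₁ s =
      (fderiv ℝ (momentum (coordLagrangian V L x₁)) (coordCurve V x₁ h γ s)
          (A.coordVariation x₁ h γ η s) (derivWithin (coordLift x₁ h Δ) (Icc t₀ t₁) s).1.2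
        + momentum (coordLagrangian V L x₁) (coordCurve V x₁ h γ s)
          (derivWithin (coordLift x₁ h Δ) (Icc t₀ t₁) s).2.2)
      + (fderiv ℝ ((A.coord x₁).force (coordLagrangian V L x₁)) (coordCurve V x₁ h γ s)
          (A.coordVariation x₁ h γ η s) (coordLift x₁ h Δ s).1.2
        + (A.coord x₁).force (coordLagrangian V L x₁) (coordCurve V x₁ h γ s)
          (coordLift x₁ h Δ s).2.2) := by
  rw [integrandIn_eq_firstVar hL hx]
  exact SmoothAt.fderiv_firstVar (A.smoothAt_coordCurve hx)
    (contDiffAt_coordLagrangian_coordCurve hL hx) _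

theorem continuousWithinAt_coordVariation (hη : IsCkCurve V k h (sectionCurve η))
    (hγ : IsCkCurve V k h γ) (hk : 1 ≤ k) (hs : s ∈ Icc t₀ t₁)
    (hx : basePath h γ s ∈ coordDomain V F E x₁) :
    ContinuousWithinAt (A.coordVariation x₁ h γ η) (Icc t₀ t₁) s := by
  have c1 := (hγ.contDiffWithinAt_coordCurve hs hx).continuousWithinAt
  have c2 := (hη.contDiffWithinAt_coordCurve (x₀ := x₁) hs hx).continuousWithinAt
  have c3 := (hη.contDiffWithinAt_coordCurve (x₀ := x₁) hs hx).continuousWithinAt_derivWithin h hs hk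
  have hk : ContinuousAt (A.coord x₁).kappaMap (coordCurve V x₁ h γ s,
      ((coordCurve V x₁ h (sectionCurve (F := F) η) s).2,
        (derivWithin (coordCurve V x₁ h (sectionCurve (F := F) η)) (Icc t₀ t₁) s).2)) :=
    (SmoothAt.contDiffAt_kappaMap (A.smoothAt_coordCurve hx)).continuousAt
  exact hk.comp_continuousWithinAt (f := fun r => (coordCurve V x₁ h γ r,
      ((coordCurve V x₁ h (sectionCurve (F := F) η) r).2,
        (derivWithin (coordCurve V x₁ h (sectionCurve (F := F) η)) (Icc t₀ t₁) r).2)))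
    (c1.prodMk (c2.snd.prodMk c3.snd))

/-- The integrand is defined with a chart that moves with time. Near `s` it is rewritten in the
fixed chart at `s`, where it is a smooth expression in `γ`, the variation, the lift and its first
derivative, all continuous. -/
theorem continuousOn_integrand (hA : A.IsAlmostLie)
    (hL : ContMDiff (𝓘(ℝ, V).prod 𝓘(ℝ, F)) 𝓘(ℝ, ℝ) ∞ L)
    (hEL : A.IsELSolution L h γ) (hη : IsCkCurve V k h (sectionCurve η)) (hγ : IsCkCurve V k h γ)
    (hk : 1 ≤ k) (H : A.IsGeneratorLift k h γ η ξ Δ) :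
    ContinuousOn (A.secondVariationIntegrand L h γ η Δ) (Icc t₀ t₁) := by
  intro s hs
  have h₀ : basePath h γ s ∈ coordDomain V F E (basePath h γ s) := mem_coordDomain_self _
  have c1 := (hγ.contDiffWithinAt_coordCurve hs h₀).continuousWithinAt
  have c2 := continuousWithinAt_coordVariation (A := A) hη hγ hk hs h₀
  have c3 := (H.contDiffWithinAt hs h₀).continuousWithinAt
  have c4 := (H.contDiffWithinAt hs h₀).continuousWithinAt_derivWithin h hs hk
  have hf : ContinuousAt (fderiv ℝ ((A.coord (basePath h γ s)).firstVar
      (coordLagrangian V L (basePath h γ s)))) (coordCurve V (basePath h γ s) h γ s,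
        ((coordLift (basePath h γ s) h Δ s).1.2,
          (derivWithin (coordLift (basePath h γ s) h Δ) (Icc t₀ t₁) s).1.2)) :=
    (SmoothAt.contDiffAt_firstVar (A.smoothAt_coordCurve h₀)
      (contDiffAt_coordLagrangian_coordCurve hL h₀)).fderiv_infty.continuousAt
  have hc := (hf.comp_continuousWithinAt (f := fun r => (coordCurve V (basePath h γ s) h γ r,
        ((coordLift (basePath h γ s) h Δ r).1.2,
          (derivWithin (coordLift (basePath h γ s) h Δ) (Icc t₀ t₁) r).1.2)))
      (c1.prodMk (c3.fst.snd.prodMk c4.fst.snd))).clm_apply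
    (c2.prodMk (c3.snd.snd.prodMk c4.snd.snd))
  refine hc.congr_of_eventuallyEq_of_mem ?_ hs
  filter_upwards [hγ.eventually_coordDomain hs h₀, self_mem_nhdsWithin] with r hr hr'
  rw [← integrandIn_eq hA hL hEL hη hγ hk H hr' hr, integrandIn_eq_firstVar hL hr]
  rfl

-- The fundamental theorem of calculus for a quantity `W` known chart by chart. Invariance glues the
-- local expressions into one function of time, whose derivative at `s` may be computed in the chart
-- centred there.
omit [FiniteDimensional ℝ F] in
theorem integral_eq_of_charts (hγ : IsCkCurve V k h γ) {W : M → ℝ → ℝ} {I : ℝ → ℝ}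
    (hinv : ∀ s ∈ Icc t₀ t₁, ∀ x₁, basePath h γ s ∈ coordDomain V F E x₁ →
      W x₁ s = W (basePath h γ s) s)
    (hder : ∀ s ∈ Icc t₀ t₁, HasDerivWithinAt (W (basePath h γ s)) (I s) (Icc t₀ t₁) s)
    (hI : ContinuousOn I (Icc t₀ t₁)) :
    ∫ s in t₀..t₁, I s = W (basePath h γ t₁) t₁ - W (basePath h γ t₀) t₀ := by
  have hd : ∀ s ∈ Icc t₀ t₁,
      HasDerivWithinAt (fun r => W (basePath h γ r) r) (I s) (Icc t₀ t₁) s := by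
    intro s hs
    refine (hder s hs).congr_of_eventuallyEq_of_mem ?_ hs
    filter_upwards [hγ.eventually_coordDomain hs (mem_coordDomain_self _), self_mem_nhdsWithin]
      with r hr hr'
    exact (hinv r hr' _ hr).symm
  refine intervalIntegral.integral_eq_sub_of_hasDerivAt_of_le h.le
    (f := fun r => W (basePath h γ r) r) (fun s hs => (hd s hs).continuousWithinAt) ?_ ?_
  · intro s hs
    exact (hd s (Ioo_subset_Icc_self hs)).hasDerivAt (Icc_mem_nhds hs.1 hs.2)
  · exact hI.intervalIntegrable_of_Icc h.le

/-- The Jacobi equation is equivalent to its momentum component in centred coordinates. -/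
theorem isJacobiField_iff (hA : A.IsAlmostLie)
    (hL : ContMDiff (𝓘(ℝ, V).prod 𝓘(ℝ, F)) 𝓘(ℝ, ℝ) ∞ L)
    (hEL : A.IsELSolution L h γ) (hη : IsCkCurve V k h (sectionCurve η)) (hγ : IsCkCurve V k h γ)
    (hk : 1 ≤ k) :
    A.IsJacobiField L h γ η ↔ ∀ s ∈ Icc t₀ t₁,
      HasDerivWithinAt (fun r => fderiv ℝ (momentum (coordLagrangian V L (basePath h γ s)))
          (coordCurve V (basePath h γ s) h γ r) (A.coordVariation (basePath h γ s) h γ η r))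
        (fderiv ℝ ((A.coord (basePath h γ s)).force (coordLagrangian V L (basePath h γ s)))
          (coordCurve V (basePath h γ s) h γ s) (A.coordVariation (basePath h γ s) h γ η s))
        (Icc t₀ t₁) s := by
  have key : ∀ s ∈ Icc t₀ t₁, ∀ (x₀ : M), x₀ = basePath h γ s →
      (HasDerivWithinAt (fun r => tangentPush (legendre (coordLagrangian V L x₀))
          (coordCurve V x₀ h γ r, A.coordVariation x₀ h γ η r))
        (canonicalFlip (tangentPush ((A.coord x₀).tulczyjew (coordLagrangian V L x₀))
          (coordCurve V x₀ h γ s, A.coordVariation x₀ h γ η s))).2 (Icc t₀ t₁) s ↔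
      HasDerivWithinAt (fun r => fderiv ℝ (momentum (coordLagrangian V L x₀))
          (coordCurve V x₀ h γ r) (A.coordVariation x₀ h γ η r))
        (fderiv ℝ ((A.coord x₀).force (coordLagrangian V L x₀))
          (coordCurve V x₀ h γ s) (A.coordVariation x₀ h γ η s))
        (Icc t₀ t₁) s) := by
    rintro s hs x₀ rfl
    have h₀ : basePath h γ s ∈ coordDomain V F E (basePath h γ s) := mem_coordDomain_self _
    have e1 : (fun r => tangentPush (legendre (coordLagrangian V L (basePath h γ s)))
        (coordCurve V (basePath h γ s) h γ r, A.coordVariation (basePath h γ s) h γ η r))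
        =ᶠ[𝓝[Icc t₀ t₁] s] fun r => (legendre (coordLagrangian V L (basePath h γ s))
          (coordCurve V (basePath h γ s) h γ r), ((A.coordVariation (basePath h γ s) h γ η r).1,
            fderiv ℝ (momentum (coordLagrangian V L (basePath h γ s)))
              (coordCurve V (basePath h γ s) h γ r)
              (A.coordVariation (basePath h γ s) h γ η r))) := by
      filter_upwards [hγ.eventually_coordDomain hs h₀] with r hr
      rw [tangentPush, fderiv_legendre (contDiffAt_coordLagrangian_coordCurve hL hr)]
    have e2 := fderiv_tulczyjew (A.smoothAt_coordCurve h₀)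
      (contDiffAt_coordLagrangian_coordCurve hL h₀) (A.coordVariation (basePath h γ s) h γ η s)
    rw [e1.hasDerivWithinAt_iff_of_mem hs]
    simp only [canonicalFlip, tangentPush, e2]
    constructor
    · intro H
      exact H.prod_snd.prod_snd
    · intro H
      -- The components of the base point and of the momentum are the Euler–Lagrange equation, and
      -- that of `ρ(η)` is the almost-Lie identity along the curve.
      refine (hEL.hasDerivWithinAt hs).prodMk (HasDerivWithinAt.prodMk ?_ H)
      exact hA.almostLieAt_coordCurve.hasDerivWithinAt_anchor (A.smoothAt_coordCurve h₀)
        (hEL.hasDerivWithinAt_base hs)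
        ((hη.contDiffWithinAt_coordCurve (x₀ := basePath h γ s) hs
          h₀).differentiableWithinAt_of_one_le hk)
  constructor
  · intro H s hs
    exact (key s hs _ rfl).1 ((basePath_coe (h := h) (γ := γ) ⟨s, hs⟩) ▸ H ⟨s, hs⟩)
  · intro H t
    refine (key t t.2 _ (basePath_coe (h := h) t).symm).2 ?_
    have := H t t.2
    rwa [basePath_coe (h := h)] at this

end SkewAlgebroid

end Algebroid

/-! ### The antisymmetric part of the second variation for a Lie algebroid. -/

namespace CoordAlgebroid

variable {B F : Type*} [NormedAddCommGroup B] [NormedSpace ℝ B]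
  [NormedAddCommGroup F] [NormedSpace ℝ F] {ℓ : B × F → ℝ} {A : CoordAlgebroid B F} {x : B}

/-- Skew-symmetry near a point and the Jacobi identity at that point, for structure functions. -/
structure LieAt (A : CoordAlgebroid B F) (x : B) : Prop where
  almostLie : A.AlmostLieAt x
  skew : ∀ᶠ z in 𝓝 x, ∀ u w, A.bracket z u w = -A.bracket z w u
  jacobi : ∀ u v w,
    (A.bracket x (A.bracket x u v) w - fderiv ℝ A.bracket x (A.anchor x w) u v)
      + (A.bracket x (A.bracket x v w) u - fderiv ℝ A.bracket x (A.anchor x u) v w)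
      + (A.bracket x (A.bracket x w u) v - fderiv ℝ A.bracket x (A.anchor x v) w u) = 0

set_option synthInstance.maxHeartbeats 400000 in
theorem LieAt.fderiv_skew (H : A.LieAt x) (hA : A.SmoothAt x) (v : B) (u w : F) :
    fderiv ℝ A.bracket x v u w = -fderiv ℝ A.bracket x v w u := by
  have hb := hA.bracket.differentiableAt_infty.hasFDerivAt
  have h1 := (hb.clm_apply (hasFDerivAt_const u x)).clm_apply (hasFDerivAt_const w x)
  have h2 := ((hb.clm_apply (hasFDerivAt_const w x)).clm_apply (hasFDerivAt_const u x)).neg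
  have e : (fun z => A.bracket z u w) =ᶠ[𝓝 x] fun z => -A.bracket z w u := by
    filter_upwards [H.skew] with z hz using hz u w
  have := congrArg (fun T => T v) ((h1.congr_of_eventuallyEq e.symm).unique h2)
  simpa using this

-- A second expression for the derivative of the first variation. It isolates the Hessian of `ℓ`,
-- which is symmetric, from a term that involves only the structure functions.
set_option synthInstance.maxHeartbeats 400000 in
theorem SmoothAt.fderiv_firstVar_eq_hessian {Z W : (B × F) × (F × F)} (hA : A.SmoothAt Z.1.1)
    (hℓ : ContDiffAt ℝ ∞ ℓ Z.1) :
    fderiv ℝ (A.firstVar ℓ) Z W = fderiv ℝ (fderiv ℝ ℓ) Z.1 W.1 (A.kappaMap Z)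
      + fderiv ℝ ℓ Z.1 (fderiv ℝ A.kappaMap Z W) := by
  have h1 : HasFDerivAt (fun Z : (B × F) × (F × F) => Z.1) _ Z :=
    (ContinuousLinearMap.fst ℝ (B × F) (F × F)).hasFDerivAt
  have h2 := hℓ.fderiv_infty.differentiableAt_infty.hasFDerivAt.comp Z h1
  have h3 := h2.clm_apply hA.contDiffAt_kappaMap.differentiableAt_infty.hasFDerivAt
  have e : fderiv ℝ (A.firstVar ℓ) Z = _ := h3.fderiv
  rw [e]
  simp
  ring

set_option synthInstance.maxHeartbeats 400000 in
/-- The antisymmetric part of the second variation of the Lagrangian of a Lie algebroid. -/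
theorem LieAt.fderiv_momentum_sub (H : A.LieAt x) (hA : A.SmoothAt x) {y : F}
    (hℓ : ContDiffAt ℝ ∞ ℓ (x, y)) (f f' g g' : F) :
    (fderiv ℝ (momentum ℓ) (x, y) (A.kappa x y g g') f'
        + fderiv ℝ (A.force ℓ) (x, y) (A.kappa x y g g') f)
      - (fderiv ℝ (momentum ℓ) (x, y) (A.kappa x y f f') g'
        + fderiv ℝ (A.force ℓ) (x, y) (A.kappa x y f f') g)
      = A.force ℓ (x, y) (A.bracket x g f)
        + momentum ℓ (x, y) (fderiv ℝ A.bracket x (A.anchor x y) g f + A.bracket x g' f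
          + A.bracket x g f') := by
  -- The two expressions for the derivative of `firstVar` are compared in the direction `(κ(y, g),
  -- (0, 0))`.
  have key : ∀ f f' g g' : F, fderiv ℝ (momentum ℓ) (x, y) (A.kappa x y g g') f'
        + fderiv ℝ (A.force ℓ) (x, y) (A.kappa x y g g') f =
      fderiv ℝ (fderiv ℝ ℓ) (x, y) (A.kappa x y g g') (A.kappa x y f f')
        + fderiv ℝ ℓ (x, y) (fderiv ℝ A.anchor x (A.anchor x g) f,
          fderiv ℝ A.bracket x (A.anchor x g) y f + A.bracket x (g' + A.bracket x y g) f) := by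
    intro f f' g g'
    have hA' : A.SmoothAt (((x, y), (f, f')) : (B × F) × (F × F)).1.1 := hA
    have e1 := hA'.fderiv_firstVar hℓ (A.kappa x y g g', (0, 0))
    have e2 := SmoothAt.fderiv_firstVar_eq_hessian (W := (A.kappa x y g g', (0, 0))) hA' hℓ
    rw [hA'.fderiv_kappaMap, e1] at e2
    simp only [map_zero, add_zero, zero_add] at e2
    rw [e2]
    rfl
  have hsymm : IsSymmSndFDerivAt ℝ ℓ (x, y) := by
    refine hℓ.isSymmSndFDerivAt ?_
    simp only [minSmoothness_of_isRCLikeNormedField]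
    exact WithTop.coe_le_coe.2 le_top
  -- The Hessian terms cancel, and `dℓ` is left on a difference of derivatives of `κ`.
  rw [key, key, hsymm.eq (A.kappa x y g g') (A.kappa x y f f'), add_sub_add_left_eq_sub, ← map_sub]
  have e3 : A.force ℓ (x, y) (A.bracket x g f) = fderiv ℝ ℓ (x, y)
      (A.anchor x (A.bracket x g f), A.bracket x y (A.bracket x g f)) := by
    have : (A.anchor x (A.bracket x g f), A.bracket x y (A.bracket x g f)) =
      ContinuousLinearMap.inr ℝ B F (A.bracket x y (A.bracket x g f))
        + ContinuousLinearMap.inl ℝ B F (A.anchor x (A.bracket x g f)) := by simp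
    rw [this, map_add]
    rfl
  rw [e3, momentum, ContinuousLinearMap.comp_apply, ← map_add]
  congr 1
  have j := H.jacobi y g f
  have sk := H.skew.self_of_nhds
  have sk' : A.bracket x (A.bracket x f y) g = -A.bracket x (A.bracket x y f) g := by
    rw [sk f y, map_neg]
    rfl
  rw [sk (A.bracket x g f) y, sk', H.fderiv_skew hA _ f y] at j
  -- The base component is the almost-Lie identity for `(g, f)`; the fibre component is the Jacobi
  -- identity for `(y, g, f)`, rearranged by skew-symmetry.
  ext1
  · simp [H.almostLie g f]
  · have : fderiv ℝ A.bracket x (A.anchor x g) y f + A.bracket x (A.bracket x y g) f -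
        (fderiv ℝ A.bracket x (A.anchor x f) y g + A.bracket x (A.bracket x y f) g) =
        A.bracket x y (A.bracket x g f) + fderiv ℝ A.bracket x (A.anchor x y) g f := by
      rw [← sub_eq_zero, ← j]
      abel
    simp only [ContinuousLinearMap.inr_apply, Prod.snd_sub, Prod.snd_add, map_add, _root_.add_apply]
    rw [sk g f']
    have e4 : ∀ a b c d e p q r : F, a + b - (c + d) = p + q →
        a + (e + b) - (c + (r + d)) = p + (q + e + -r) := by
      intro a b c d e p q r hh
      rw [show a + (e + b) - (c + (r + d)) = (a + b - (c + d)) + e - r by abel, hh]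
      abel
    exact e4 _ _ _ _ _ _ _ _ this

end CoordAlgebroid

/-! ### Integration by parts along the curve. -/

section Algebroid

variable {V : Type*} [NormedAddCommGroup V] [NormedSpace ℝ V]
  {F : Type*} [NormedAddCommGroup F] [NormedSpace ℝ F]
  {M : Type*} [TopologicalSpace M] [ChartedSpace V M]
  {E : M → Type*} [∀ x, AddCommGroup (E x)] [∀ x, Module ℝ (E x)]
  [∀ x, TopologicalSpace (E x)] [TopologicalSpace (TotalSpace F E)]
  [FiberBundle F E] [VectorBundle ℝ F E] [IsManifold 𝓘(ℝ, V) ∞ M]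
  [FiniteDimensional ℝ V] [T2Space M] [ContMDiffVectorBundle ∞ F E 𝓘(ℝ, V)]

variable {x₀ x₁ x : M} {k : ℕ∞} {t₀ t₁ : ℝ} {h : t₀ < t₁} {γ : Icc t₀ t₁ → TotalSpace F E} {s : ℝ}
  {Δ Δ' : Icc t₀ t₁ → TangentBundle (𝓘(ℝ, V).prod 𝓘(ℝ, F)) (TotalSpace F E)}
  [FiniteDimensional ℝ F] {A : SkewAlgebroid V F E} {η ξ : ∀ t, E (γ t).proj}
  {L : TotalSpace F E → ℝ}

open CoordAlgebroid

namespace SkewAlgebroid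

theorem IsLie.lieAt_coordCurve (hA : A.IsLie) :
    (A.coord (basePath h γ s)).LieAt (coordCurve V (basePath h γ s) h γ s).1 := by
  have h₀ : basePath h γ s ∈ coordDomain V F E (basePath h γ s) := mem_coordDomain_self _
  rw [coordCurve_fst h₀]
  refine ⟨hA.1.coord_almostLieAt _, ?_, fun u v w => hA.coord_jacobi h₀ u v w⟩
  filter_upwards [eventually_coordDomain h₀] with q hq u w
  have := A.coord_bracket_skew hq.1 u w
  rwa [hq.2] at this

omit [FiniteDimensional ℝ F] in
theorem coordCurve_sectionCurve_trans (ξ : ∀ t, E (γ t).proj)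
    (h₀ : basePath h γ s ∈ coordDomain V F E x₀) (h₁ : basePath h γ s ∈ coordDomain V F E x₁) :
    (coordCurve V x₁ h (sectionCurve (F := F) ξ) s).2 =
      fiberTrans V F E x₀ x₁ (coordCurve V x₀ h γ s).1
        (coordCurve V x₀ h (sectionCurve (F := F) ξ) s).2 := by
  have e := coordCurve_trans (γ := sectionCurve (F := F) ξ) (h := h) (s := s) h₀ h₁
  rw [e, fiberMap, coordCurve_sectionCurve_fst ξ h₀]

omit [FiniteDimensional ℝ F] in
theorem coordCurve_sectionCurve_eq_zero (hx : basePath h γ s ∈ coordDomain V F E x₀)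
    (hs : s ∈ Icc t₀ t₁) (hξ : ξ ⟨s, hs⟩ = 0) :
    (coordCurve V x₀ h (sectionCurve (F := F) ξ) s).2 = 0 := by
  rw [coordCurve_sectionCurve ξ hx]
  have e : extendSection h ξ s = 0 := by
    have key : ∀ t : Icc t₀ t₁, t = ⟨s, hs⟩ → ξ t = 0 := by
      rintro _ rfl
      exact hξ
    exact key _ (projIcc_of_mem h.le hs)
  simp only [e, map_zero]

/-- The vertical component transforms affinely, with an inhomogeneous term depending only on `η` and
`ξ`. Differences of vertical components of two lifts are therefore genuine sections. -/
theorem IsGeneratorLift.trans_snd_snd (H : A.IsGeneratorLift k h γ η ξ Δ)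
    (h₀ : basePath h γ s ∈ coordDomain V F E x₀) (h₁ : basePath h γ s ∈ coordDomain V F E x₁) :
    (coordLift x₁ h Δ s).2.2 =
      fiberTrans V F E x₀ x₁ (coordCurve V x₀ h γ s).1 (coordLift x₀ h Δ s).2.2
        + fderiv ℝ (fiberTrans V F E x₀ x₁) (coordCurve V x₀ h γ s).1
          ((A.coord x₀).anchor (coordCurve V x₀ h γ s).1
            (coordCurve V x₀ h (sectionCurve (F := F) η) s).2)
          (coordCurve V x₀ h (sectionCurve (F := F) ξ) s).2 := by
  have C := A.coordChange_coordCurve h₀ h₁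
  have e1 := H.coordLift_fst_fst h₀
  rw [H.trans h₀ h₁, tangentPush, fderiv_fiberMap, e1, H.coordLift_snd_fst h₀, H.coordLift_fst h₀]
  · rw [e1]; exact C.base.differentiableAt_infty
  · rw [e1]; exact C.fiber.differentiableAt_infty

theorem momentum_trans (A : SkewAlgebroid V F E)
    (hL : ContMDiff (𝓘(ℝ, V).prod 𝓘(ℝ, F)) 𝓘(ℝ, ℝ) ∞ L)
    (h₀ : basePath h γ s ∈ coordDomain V F E x₀) (h₁ : basePath h γ s ∈ coordDomain V F E x₁)
    (f : F) :
    momentum (coordLagrangian V L x₁) (coordCurve V x₁ h γ s)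
        (fiberTrans V F E x₀ x₁ (coordCurve V x₀ h γ s).1 f) =
      momentum (coordLagrangian V L x₀) (coordCurve V x₀ h γ s) f := by
  have hℓ₁ := contDiffAt_coordLagrangian_coordCurve hL h₁
  rw [coordCurve_trans h₀ h₁] at hℓ₁ ⊢
  exact ((A.coordChange_coordCurve h₀ h₁).momentum_apply (y := (coordCurve V x₀ h γ s).2) hℓ₁
    (coordLagrangian_trans L (p := extendCurve h γ s) h₀ h₁)).self_of_nhds f

/-- The second variation does not depend on the lift of the generator. -/
theorem integral_eq_of_lifts (hA : A.IsAlmostLie)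
    (hL : ContMDiff (𝓘(ℝ, V).prod 𝓘(ℝ, F)) 𝓘(ℝ, ℝ) ∞ L)
    (hEL : A.IsELSolution L h γ) (hη : IsCkCurve V k h (sectionCurve η)) (hγ : IsCkCurve V k h γ)
    (hk : 1 ≤ k) (H : A.IsGeneratorLift k h γ η ξ Δ) (H' : A.IsGeneratorLift k h γ η ξ Δ') :
    ∫ t in t₀..t₁, A.secondVariationIntegrand L h γ η Δ t =
      ∫ t in t₀..t₁, A.secondVariationIntegrand L h γ η Δ' t := by
  have c := continuousOn_integrand hA hL hEL hη hγ hk H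
  have c' := continuousOn_integrand hA hL hEL hη hγ hk H'
  rw [← sub_eq_zero, ← intervalIntegral.integral_sub (c.intervalIntegrable_of_Icc h.le)
    (c'.intervalIntegrable_of_Icc h.le)]
  -- The two lifts have the same `ξ` and `ξ̇`, so the integrands differ by `⟨p, (Δ - Δ')˙⟩ + ⟨R, Δ -
  -- Δ'⟩`, the derivative of `⟨p, Δ - Δ'⟩`.
  rw [integral_eq_of_charts (I := fun s => A.secondVariationIntegrand L h γ η Δ s -
      A.secondVariationIntegrand L h γ η Δ' s) hγ (W := fun x r =>
    momentum (coordLagrangian V L x) (coordCurve V x h γ r)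
      ((coordLift x h Δ r).2.2 - (coordLift x h Δ' r).2.2)) ?_ ?_ (c.sub c')]
  · rw [H.coordLift_snd_snd (.inr rfl) (mem_coordDomain_self _),
      H'.coordLift_snd_snd (.inr rfl) (mem_coordDomain_self _),
      H.coordLift_snd_snd (.inl rfl) (mem_coordDomain_self _),
      H'.coordLift_snd_snd (.inl rfl) (mem_coordDomain_self _)]
    simp
  · intro s hs x₁ h₁
    have h₀ : basePath h γ s ∈ coordDomain V F E (basePath h γ s) := mem_coordDomain_self _
    rw [H.trans_snd_snd h₀ h₁, H'.trans_snd_snd h₀ h₁, add_sub_add_right_eq_sub, ← map_sub,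
      momentum_trans A hL h₀ h₁]
  · intro s hs
    have h₀ : basePath h γ s ∈ coordDomain V F E (basePath h γ s) := mem_coordDomain_self _
    have d := ((H.contDiffWithinAt hs h₀).differentiableWithinAt_of_one_le hk).hasDerivWithinAt
    have d' := ((H'.contDiffWithinAt hs h₀).differentiableWithinAt_of_one_le hk).hasDerivWithinAt
    have hm := (hEL.hasDerivWithinAt_momentum hs).clm_apply (d.prod_snd.prod_snd.sub
      d'.prod_snd.prod_snd)
    refine hm.congr_deriv ?_
    have e : (fun r => (coordLift (basePath h γ s) h Δ r).1) =ᶠ[𝓝[Icc t₀ t₁] s]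
        fun r => (coordLift (basePath h γ s) h Δ' r).1 := by
      filter_upwards [hγ.eventually_coordDomain hs h₀] with r hr
      rw [H.coordLift_fst hr, H'.coordLift_fst hr]
    have e1 := d'.prod_fst.derivWithin_eq_of_eventuallyEq (uniqueDiffWithinAt_Icc_of_mem h hs) hs e
    rw [d.prod_fst.derivWithin (uniqueDiffWithinAt_Icc_of_mem h hs)] at e1
    rw [secondVariationIntegrand_eq_integrandIn, secondVariationIntegrand_eq_integrandIn,
      integrandIn_eq_sum hL h₀, integrandIn_eq_sum hL h₀, e1, H.coordLift_fst h₀,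
      H'.coordLift_fst h₀]
    simp only [map_sub, Pi.sub_apply]
    ring

omit [FiniteDimensional ℝ F] in
theorem boundary_eq_zero {W : M → ℝ → ℝ}
    (hW : ∀ s x, (s = t₀ ∨ s = t₁) → basePath h γ s ∈ coordDomain V F E x → W x s = 0) :
    W (basePath h γ t₁) t₁ - W (basePath h γ t₀) t₀ = 0 := by
  rw [hW _ _ (.inr rfl) (mem_coordDomain_self _), hW _ _ (.inl rfl) (mem_coordDomain_self _),
    sub_zero]

theorem coordCurve_sectionCurve_endpoint (hξ : ∀ t : Icc t₀ t₁, (t : ℝ) = t₀ ∨ (t : ℝ) = t₁ → ξ t = 0)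
    (hs : s = t₀ ∨ s = t₁) (hx : basePath h γ s ∈ coordDomain V F E x₀) :
    (coordCurve V x₀ h (sectionCurve (F := F) ξ) s).2 = 0 := by
  have hs' : s ∈ Icc t₀ t₁ := by
    rcases hs with rfl | rfl
    exacts [left_mem_Icc.2 h.le, right_mem_Icc.2 h.le]
  exact coordCurve_sectionCurve_eq_zero hx hs' (hξ _ hs)

/-- The Jacobi and Euler–Lagrange equations make the integrand the derivative of `⟨Dp·δ_ηγ, ξ⟩ + ⟨p,
Δ⟩`. This sum is invariant under changes of chart, and both `ξ` and `Δ` vanish at the ends. -/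
theorem IsJacobiField.integral_eq_zero (hJ : A.IsJacobiField L h γ η) (hA : A.IsAlmostLie)
    (hL : ContMDiff (𝓘(ℝ, V).prod 𝓘(ℝ, F)) 𝓘(ℝ, ℝ) ∞ L)
    (hEL : A.IsELSolution L h γ) (hη : IsCkCurve V k h (sectionCurve η)) (hγ : IsCkCurve V k h γ)
    (hk : 1 ≤ k) (H : A.IsGeneratorLift k h γ η ξ Δ)
    (hξ : ∀ t : Icc t₀ t₁, (t : ℝ) = t₀ ∨ (t : ℝ) = t₁ → ξ t = 0) :
    ∫ t in t₀..t₁, A.secondVariationIntegrand L h γ η Δ t = 0 := by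
  rw [isJacobiField_iff hA hL hEL hη hγ hk] at hJ
  rw [integral_eq_of_charts hγ (W := fun x r =>
    fderiv ℝ (momentum (coordLagrangian V L x)) (coordCurve V x h γ r)
        (A.coordVariation x h γ η r) (coordLift x h Δ r).1.2
      + momentum (coordLagrangian V L x) (coordCurve V x h γ r) (coordLift x h Δ r).2.2) ?_ ?_
    (continuousOn_integrand hA hL hEL hη hγ hk H)]
  · refine boundary_eq_zero (V := V) (γ := γ) (h := h) (E := E) (W := fun x r =>
      fderiv ℝ (momentum (coordLagrangian V L x)) (coordCurve V x h γ r)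
        (A.coordVariation x h γ η r) (coordLift x h Δ r).1.2
      + momentum (coordLagrangian V L x) (coordCurve V x h γ r) (coordLift x h Δ r).2.2) ?_
    intro s x hs hx
    rw [H.coordLift_snd_snd hs hx, H.coordLift_fst hx, coordCurve_sectionCurve_endpoint hξ hs hx,
      map_zero, map_zero, add_zero]
  · intro s hs x₁ h₁
    have h₀ : basePath h γ s ∈ coordDomain V F E (basePath h γ s) := mem_coordDomain_self _
    have hℓ₁ := contDiffAt_coordLagrangian_coordCurve (h := h) (γ := γ) hL h₁
    have e := coordCurve_trans h₀ h₁
    have key := (A.coordChange_coordCurve h₀ h₁).fderiv_momentum_apply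
      (y := (coordCurve V (basePath h γ s) h γ s).2)
      (contDiffAt_coordLagrangian_coordCurve hL h₀) (e ▸ hℓ₁)
      (coordLagrangian_trans L (p := extendCurve h γ s) h₀ h₁)
      (A.coordVariation (basePath h γ s) h γ η s)
      (coordCurve V (basePath h γ s) h (sectionCurve (F := F) ξ) s).2
      (coordLift (basePath h γ s) h Δ s).2.2
    rw [H.coordLift_fst h₁, H.coordLift_fst h₀, ← key, coordVariation_trans hEL hη hγ hk hs h₁,
      H.trans_snd_snd h₀ h₁, coordCurve_sectionCurve_trans ξ h₀ h₁, e, add_comm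
        (fiberTrans V F E (basePath h γ s) x₁ _ _)]
    rfl
  · intro s hs
    have h₀ : basePath h γ s ∈ coordDomain V F E (basePath h γ s) := mem_coordDomain_self _
    have d := ((H.contDiffWithinAt hs h₀).differentiableWithinAt_of_one_le hk).hasDerivWithinAt
    have hm := ((hJ s hs).clm_apply d.prod_fst.prod_snd).add
      ((hEL.hasDerivWithinAt_momentum hs).clm_apply d.prod_snd.prod_snd)
    refine hm.congr_deriv ?_
    rw [secondVariationIntegrand_eq_integrandIn, integrandIn_eq_sum hL h₀]
    ring

-- The difference of the two integrands is the derivative of `⟨p, c(η, ξ) + Δ - Δ'⟩`. The first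
-- summand comes from the antisymmetric part of the second variation, the others from the
-- Euler–Lagrange equation; the bracket and both vertical components vanish at the ends.
set_option synthInstance.maxHeartbeats 400000 in
theorem IsLie.integral_symm (hA : A.IsLie)
    (hL : ContMDiff (𝓘(ℝ, V).prod 𝓘(ℝ, F)) 𝓘(ℝ, ℝ) ∞ L)
    (hEL : A.IsELSolution L h γ) (hη : IsCkCurve V k h (sectionCurve η))
    (hξ : IsCkCurve V k h (sectionCurve ξ)) (hγ : IsCkCurve V k h γ)
    (hk : 1 ≤ k) (H : A.IsGeneratorLift k h γ η ξ Δ) (H' : A.IsGeneratorLift k h γ ξ η Δ')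
    (hη₀ : ∀ t : Icc t₀ t₁, (t : ℝ) = t₀ ∨ (t : ℝ) = t₁ → η t = 0) :
    ∫ t in t₀..t₁, A.secondVariationIntegrand L h γ η Δ t =
      ∫ t in t₀..t₁, A.secondVariationIntegrand L h γ ξ Δ' t := by
  have c := continuousOn_integrand hA.1 hL hEL hη hγ hk H
  have c' := continuousOn_integrand hA.1 hL hEL hξ hγ hk H'
  rw [← sub_eq_zero, ← intervalIntegral.integral_sub (c.intervalIntegrable_of_Icc h.le)
    (c'.intervalIntegrable_of_Icc h.le)]
  rw [integral_eq_of_charts (I := fun s => A.secondVariationIntegrand L h γ η Δ s -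
      A.secondVariationIntegrand L h γ ξ Δ' s) hγ (W := fun x r =>
    momentum (coordLagrangian V L x) (coordCurve V x h γ r)
      ((A.coord x).bracket (coordCurve V x h γ r).1 (coordLift x h Δ' r).1.2
        (coordLift x h Δ r).1.2 + (coordLift x h Δ r).2.2 - (coordLift x h Δ' r).2.2))
    ?_ ?_ (c.sub c')]
  · refine boundary_eq_zero (V := V) (γ := γ) (h := h) (E := E) (W := fun x r =>
      momentum (coordLagrangian V L x) (coordCurve V x h γ r)
      ((A.coord x).bracket (coordCurve V x h γ r).1 (coordLift x h Δ' r).1.2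
        (coordLift x h Δ r).1.2 + (coordLift x h Δ r).2.2 - (coordLift x h Δ' r).2.2)) ?_
    intro s x hs hx
    rw [H.coordLift_snd_snd hs hx, H'.coordLift_snd_snd hs hx, H'.coordLift_fst hx,
      coordCurve_sectionCurve_endpoint hη₀ hs hx]
    simp
  -- The terms `Dg(ρ η) ξ - Dg(ρ ξ) η` in the bracket law cancel those in the affine laws of `Δ` and
  -- `Δ'`.
  · intro s hs x₁ h₁
    have h₀ : basePath h γ s ∈ coordDomain V F E (basePath h γ s) := mem_coordDomain_self _
    have C := A.coordChange_coordCurve h₀ h₁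
    rw [← momentum_trans A hL h₀ h₁]
    congr 1
    rw [map_sub, map_add, C.bracket.self_of_nhds, H.trans_snd_snd h₀ h₁, H'.trans_snd_snd h₀ h₁,
      H.coordLift_fst h₁, H'.coordLift_fst h₁, H.coordLift_fst h₀, H'.coordLift_fst h₀,
      coordCurve_sectionCurve_trans ξ h₀ h₁, coordCurve_sectionCurve_trans η h₀ h₁]
    have e := congrArg Prod.fst (coordCurve_trans h₀ h₁)
    rw [e]
    simp only [fiberMap]
    abel
  · intro s hs
    have h₀ : basePath h γ s ∈ coordDomain V F E (basePath h γ s) := mem_coordDomain_self _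
    have u := uniqueDiffWithinAt_Icc_of_mem h hs
    have d := ((H.contDiffWithinAt hs h₀).differentiableWithinAt_of_one_le hk).hasDerivWithinAt
    have d' := ((H'.contDiffWithinAt hs h₀).differentiableWithinAt_of_one_le hk).hasDerivWithinAt
    have sm := A.smoothAt_coordCurve h₀
    have hb := sm.bracket.differentiableAt_infty.hasFDerivAt.comp_hasDerivWithinAt s
      (hEL.hasDerivWithinAt_base hs)
    have hm := (hEL.hasDerivWithinAt_momentum hs).clm_apply (((((hb.clm_apply
      d'.prod_fst.prod_snd).clm_apply d.prod_fst.prod_snd).add d.prod_snd.prod_snd)).sub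
      d'.prod_snd.prod_snd)
    refine hm.congr_deriv ?_
    have ev := hγ.eventually_coordDomain hs h₀
    have e1 : (derivWithin (coordLift (basePath h γ s) h Δ) (Icc t₀ t₁) s).1 =
        derivWithin (coordCurve V (basePath h γ s) h (sectionCurve (F := F) ξ)) (Icc t₀ t₁) s := by
      refine (d.prod_fst.derivWithin_eq_of_eventuallyEq u hs ?_).symm
      filter_upwards [ev] with r hr using (H.coordLift_fst hr).symm
    have e2 : (derivWithin (coordLift (basePath h γ s) h Δ') (Icc t₀ t₁) s).1 =
        derivWithin (coordCurve V (basePath h γ s) h (sectionCurve (F := F) η)) (Icc t₀ t₁) s := by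
      refine (d'.prod_fst.derivWithin_eq_of_eventuallyEq u hs ?_).symm
      filter_upwards [ev] with r hr using (H'.coordLift_fst hr).symm
    -- Here `(f, f')` stands for `ξ` and `(g, g')` for `η`. The argument of `momentum` on the
    -- right-hand side is `d/dt c(η, ξ)`, since `ẋ = ρ(x) y`.
    have key := LieAt.fderiv_momentum_sub (hA.lieAt_coordCurve (h := h) (γ := γ) (s := s)) sm
      (y := (coordCurve V (basePath h γ s) h γ s).2) (contDiffAt_coordLagrangian_coordCurve hL h₀)
      (coordCurve V (basePath h γ s) h (sectionCurve (F := F) ξ) s).2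
      (derivWithin (coordCurve V (basePath h γ s) h (sectionCurve (F := F) ξ)) (Icc t₀ t₁) s).2
      (coordCurve V (basePath h γ s) h (sectionCurve (F := F) η) s).2
      (derivWithin (coordCurve V (basePath h γ s) h (sectionCurve (F := F) η)) (Icc t₀ t₁) s).2
    rw [secondVariationIntegrand_eq_integrandIn, secondVariationIntegrand_eq_integrandIn,
      integrandIn_eq_sum hL h₀, integrandIn_eq_sum hL h₀]
    rw [sub_eq_iff_eq_add] at key
    have v : ∀ ζ : ∀ t, E (γ t).proj, A.coordVariation (basePath h γ s) h γ ζ s =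
        (A.coord (basePath h γ s)).kappa (coordCurve V (basePath h γ s) h γ s).1
          (coordCurve V (basePath h γ s) h γ s).2
          (coordCurve V (basePath h γ s) h (sectionCurve (F := F) ζ) s).2
          (derivWithin (coordCurve V (basePath h γ s) h (sectionCurve (F := F) ζ))
            (Icc t₀ t₁) s).2 := fun ζ => rfl
    rw [v, v]
    simp only [Prod.mk.eta, Function.comp_apply, e1, e2, H.coordLift_fst h₀, H'.coordLift_fst h₀, Pi.add_apply, Pi.sub_apply,
      _root_.add_apply, map_add, map_sub] at key ⊢
    linarith

end SkewAlgebroid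

end Algebroid

/-! ### Existence of lifts by gluing horizontal vectors. -/

section Algebroid

variable {V : Type*} [NormedAddCommGroup V] [NormedSpace ℝ V]
  {F : Type*} [NormedAddCommGroup F] [NormedSpace ℝ F]
  {M : Type*} [TopologicalSpace M] [ChartedSpace V M]
  {E : M → Type*} [∀ x, AddCommGroup (E x)] [∀ x, Module ℝ (E x)]
  [∀ x, TopologicalSpace (E x)] [TopologicalSpace (TotalSpace F E)]
  [FiberBundle F E] [VectorBundle ℝ F E] [IsManifold 𝓘(ℝ, V) ∞ M]
  [FiniteDimensional ℝ V] [T2Space M] [ContMDiffVectorBundle ∞ F E 𝓘(ℝ, V)]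

variable {x₀ x₁ x : M} {k : ℕ∞} {t₀ t₁ : ℝ} {h : t₀ < t₁} {γ : Icc t₀ t₁ → TotalSpace F E} {s : ℝ}
  {Δ Δ' : Icc t₀ t₁ → TangentBundle (𝓘(ℝ, V).prod 𝓘(ℝ, F)) (TotalSpace F E)}

/-- The components of the tangent vectors at `p` in the bundle coordinates at `x₀`. -/
def vecComponents (x₀ : M) (p : TotalSpace F E) :
    TangentSpace (𝓘(ℝ, V).prod 𝓘(ℝ, F)) p →L[ℝ] V × F :=
  mfderiv (𝓘(ℝ, V).prod 𝓘(ℝ, F)) 𝓘(ℝ, V × F) (bundleChart V F E x₀) p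

omit [FiniteDimensional ℝ V] [T2Space M] in
theorem vecCoord_mk (p : TotalSpace F E) (v : TangentSpace (𝓘(ℝ, V).prod 𝓘(ℝ, F)) p) :
    vecCoord x₀ ⟨p, v⟩ = vecComponents x₀ p v := rfl

theorem vecComponents_isInvertible {p : TotalSpace F E} (hp : p.proj ∈ coordDomain V F E x₀) :
    (vecComponents (V := V) x₀ p).IsInvertible :=
  haveI : IsManifold (𝓘(ℝ, V).prod 𝓘(ℝ, F)) 1 (TotalSpace F E) := .of_le (n := ∞) (by simp)
  isInvertible_mfderiv_extChartAt (bundleChart_source hp)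

theorem vecCoord_injective {q q' : TangentBundle (𝓘(ℝ, V).prod 𝓘(ℝ, F)) (TotalSpace F E)}
    (hq : q.proj.proj ∈ coordDomain V F E x₀) (e : q.proj = q'.proj)
    (hv : vecCoord x₀ q = vecCoord x₀ q') : q = q' := by
  obtain ⟨p, v⟩ := q
  obtain ⟨p', v'⟩ := q'
  obtain rfl : p = p' := e
  have inj : Function.Injective (vecComponents (V := V) x₀ p) := by
    obtain ⟨e, he⟩ := vecComponents_isInvertible (V := V) (p := p) hq
    rw [← he]
    exact e.injective
  exact congrArg _ (inj hv)

/-- The tangent vector at `p` with the components `(v, 0)` in the bundle coordinates at `x₀`. -/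
def horizontalVector (x₀ : M) (p : TotalSpace F E) (v : V) :
    TangentSpace (𝓘(ℝ, V).prod 𝓘(ℝ, F)) p :=
  (vecComponents x₀ p).inverse (v, 0)

open CoordAlgebroid in
theorem vecComponents_horizontalVector {p : TotalSpace F E} (h₀ : p.proj ∈ coordDomain V F E x₀)
    (h₁ : p.proj ∈ coordDomain V F E x₁) (v : V) :
    vecComponents x₁ p (horizontalVector x₀ p v) =
      (fderiv ℝ (chartTrans V x₀ x₁) (bundleChart V F E x₀ p).1 v,
        fderiv ℝ (fiberTrans V F E x₀ x₁) (bundleChart V F E x₀ p).1 v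
          (bundleChart V F E x₀ p).2) := by
  have e : (bundleChart V F E x₀ p).1 = extChartAt 𝓘(ℝ, V) x₀ p.proj := by
    rw [bundleChart_apply V F E x₀ (coordDomain_baseSet h₀)]
  have e1 := mfderiv_bundleChart_trans h₀ h₁ (horizontalVector x₀ p v)
  have e2 : vecComponents x₀ p (horizontalVector x₀ p v) = (v, 0) :=
    (vecComponents_isInvertible h₀).self_apply_inverse _
  refine e1.trans ((congrArg _ e2).trans ?_)
  rw [fderiv_fiberMap]
  · simp
    rfl
  · rw [e]
    exact (contDiffAt_chartTrans h₀ h₁).differentiableAt_infty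
  · rw [e]
    exact (contDiffAt_fiberTrans h₀ h₁).differentiableAt_infty

theorem fderiv_chartTrans_vecDeriv (h₀ : x ∈ coordDomain V F E x₀)
    (h₁ : x ∈ coordDomain V F E x₁) (v : TangentSpace 𝓘(ℝ, V) x) :
    fderiv ℝ (chartTrans V x₀ x₁) (extChartAt 𝓘(ℝ, V) x₀ x)
      (vecDeriv (extChartAt 𝓘(ℝ, V) x₀) x v) = vecDeriv (extChartAt 𝓘(ℝ, V) x₁) x v :=
  (mfderiv_extChartAt_trans (coordDomain_source h₀) (coordDomain_source h₁) v).symm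

/-- A curve in `T E` over a `C^k` curve in `E` is `C^k` if its components are. -/
theorem contMDiffWithinAt_of_coordLift {S : Set ℝ} {Δ : ℝ → TangentBundle
      (𝓘(ℝ, V).prod 𝓘(ℝ, F)) (TotalSpace F E)}
    (hev : ∀ᶠ r in 𝓝[S] s, (Δ r).proj.proj ∈ coordDomain V F E x₀)
    (hs : s ∈ S) (hc : ContDiffWithinAt ℝ k (fun r =>
      (bundleChart V F E x₀ (Δ r).proj, vecCoord x₀ (Δ r))) S s) :
    ContMDiffWithinAt 𝓘(ℝ, ℝ) (𝓘(ℝ, V).prod 𝓘(ℝ, F)).tangent k Δ S s := by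
  let q₀ : TangentBundle (𝓘(ℝ, V).prod 𝓘(ℝ, F)) (TotalSpace F E) := ⟨zeroSection F E x₀, 0⟩
  have hsrc : ∀ r, (Δ r).proj.proj ∈ coordDomain V F E x₀ →
      Δ r ∈ (extChartAt (𝓘(ℝ, V).prod 𝓘(ℝ, F)).tangent q₀).source := fun r hr =>
    tangent_extChartAt_source (bundleChart_source hr)
  have hx := hev.self_of_nhdsWithin hs
  have e : (fun r => extChartAt (𝓘(ℝ, V).prod 𝓘(ℝ, F)).tangent q₀ (Δ r)) =ᶠ[𝓝[S] s]
      fun r => (bundleChart V F E x₀ (Δ r).proj, vecCoord x₀ (Δ r)) := by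
    filter_upwards [hev] with r hr
    exact tangent_extChartAt_apply (bundleChart_source hr)
  have hc' : ContDiffWithinAt ℝ k (fun r => extChartAt (𝓘(ℝ, V).prod 𝓘(ℝ, F)).tangent q₀ (Δ r))
      S s := hc.congr_of_eventuallyEq e (e.self_of_nhdsWithin hs)
  have hM : IsManifold (𝓘(ℝ, V).prod 𝓘(ℝ, F)).tangent k
      (TangentBundle (𝓘(ℝ, V).prod 𝓘(ℝ, F)) (TotalSpace F E)) :=
    .of_le (n := ∞) (by exact_mod_cast le_top)
  have hmem : Δ s ∈ (chartAt (ModelProd (ModelProd V F) (V × F)) q₀).source := by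
    have := hsrc s hx
    rwa [extChartAt_source] at this
  refine (contMDiffWithinAt_iff_target_of_mem_source hmem).2 ⟨?_, hc'.contMDiffWithinAt⟩
  have c1 : ContinuousAt (extChartAt (𝓘(ℝ, V).prod 𝓘(ℝ, F)).tangent q₀).symm
      (extChartAt (𝓘(ℝ, V).prod 𝓘(ℝ, F)).tangent q₀ (Δ s)) :=
    continuousAt_extChartAt_symm' (hsrc s hx)
  refine (c1.comp_continuousWithinAt (f := fun r => extChartAt
    (𝓘(ℝ, V).prod 𝓘(ℝ, F)).tangent q₀ (Δ r)) hc'.continuousWithinAt).congr_of_eventuallyEq ?_ ?_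
  · filter_upwards [hev] with r hr
    exact ((extChartAt _ q₀).left_inv (hsrc r hr)).symm
  · exact ((extChartAt _ q₀).left_inv (hsrc s hx)).symm

variable [FiniteDimensional ℝ F] {A : SkewAlgebroid V F E} {η ξ : ∀ t, E (γ t).proj}

namespace SkewAlgebroid

/-- The lift of `ξ` over `ρ(η)` obtained by gluing the horizontal lifts in bundle coordinates. -/
def gluedLift (A : SkewAlgebroid V F E) (φ : SmoothPartitionOfUnity M 𝓘(ℝ, ℝ) ℝ univ)
    {γ : Icc t₀ t₁ → TotalSpace F E} (η ξ : ∀ t, E (γ t).proj) (t : Icc t₀ t₁) :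
    TangentBundle (𝓘(ℝ, V).prod 𝓘(ℝ, F)) (TotalSpace F E) :=
  ⟨sectionCurve ξ t, ∑ᶠ i, φ i t • horizontalVector i (sectionCurve (F := F) ξ t)
    (vecDeriv (extChartAt 𝓘(ℝ, V) i) (γ t).proj (A.anchor (γ t).proj (η t)))⟩

/-- The vertical components of `gluedLift`. -/
def gluedComponent (A : SkewAlgebroid V F E) (φ : SmoothPartitionOfUnity M 𝓘(ℝ, ℝ) ℝ univ)
    (h : t₀ < t₁) {γ : Icc t₀ t₁ → TotalSpace F E} (η ξ : ∀ t, E (γ t).proj) (x₁ : M) (s : ℝ) : F :=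
  ∑ᶠ i, φ i s • fderiv ℝ (fiberTrans V F E i x₁) (coordCurve V i h γ s).1
    ((A.coord i).anchor (coordCurve V i h γ s).1 (coordCurve V i h (sectionCurve (F := F) η) s).2)
    (coordCurve V i h (sectionCurve (F := F) ξ) s).2

variable {φ : SmoothPartitionOfUnity M 𝓘(ℝ, ℝ) ℝ univ}

theorem mem_coordDomain_of_ne_zero
    (hφ : φ.IsSubordinate (fun i => {s | basePath h γ s ∈ coordDomain V F E i})) {i : M}
    (hi : φ i s ≠ 0) : basePath h γ s ∈ coordDomain V F E i :=
  hφ i (subset_tsupport _ hi)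

theorem finite_support_smul {W : Type*} [AddCommGroup W] [Module ℝ W]
    (φ : SmoothPartitionOfUnity M 𝓘(ℝ, ℝ) ℝ univ) (s : ℝ) (g : M → W) :
    Function.HasFiniteSupport fun i => φ i s • g i := by
  refine (φ.locallyFinite.point_finite s).subset fun i hi => ?_
  have : φ i s ≠ 0 := by
    intro h0
    exact hi (by simp [h0])
  exact this

/-- All vectors being averaged project to the same `ρ(η)`, and the weights sum to `1`, so the base
part is `ρ(η)`. The vertical parts are the connection-like terms `Dg(ρ η) ξ` created by passing from
chart `i` to chart `x₁`, and are bilinear in `(η, ξ)`. -/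
theorem vecCoord_gluedLift
    (hφ : φ.IsSubordinate (fun i => {s | basePath h γ s ∈ coordDomain V F E i}))
    (hs : s ∈ Icc t₀ t₁) (hx : basePath h γ s ∈ coordDomain V F E x₁) :
    vecCoord x₁ (A.gluedLift φ η ξ ⟨s, hs⟩) =
      (vecDeriv (extChartAt 𝓘(ℝ, V) x₁) (γ ⟨s, hs⟩).proj
        (A.anchor (γ ⟨s, hs⟩).proj (η ⟨s, hs⟩)), A.gluedComponent φ h η ξ x₁ s) := by
  have hb : basePath h γ s = (γ ⟨s, hs⟩).proj := basePath_coe (h := h) ⟨s, hs⟩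
  have hE : extendCurve h (sectionCurve (F := F) ξ) s = sectionCurve ξ ⟨s, hs⟩ :=
    extendCurve_of_mem _ hs
  set a := A.anchor (γ ⟨s, hs⟩).proj (η ⟨s, hs⟩) with ha
  have h1 : vecCoord x₁ (A.gluedLift φ η ξ ⟨s, hs⟩) = ∑ᶠ i, φ i s •
      (vecDeriv (extChartAt 𝓘(ℝ, V) x₁) (γ ⟨s, hs⟩).proj a,
        fderiv ℝ (fiberTrans V F E i x₁) (coordCurve V i h γ s).1
    ((A.coord i).anchor (coordCurve V i h γ s).1 (coordCurve V i h (sectionCurve (F := F) η) s).2)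
    (coordCurve V i h (sectionCurve (F := F) ξ) s).2) := by
    rw [gluedLift, vecCoord_mk, map_finsum _ (finite_support_smul φ s _)]
    refine finsum_congr fun i => ?_
    rw [map_smul]
    by_cases hi : φ i s = 0
    · simp only [hi, zero_smul]
    congr 1
    have hm := mem_coordDomain_of_ne_zero hφ hi
    have hm' := hm
    have hx' := hx
    rw [hb] at hm' hx'
    rw [vecComponents_horizontalVector (p := sectionCurve (F := F) ξ ⟨s, hs⟩) hm' hx',
      coord_anchor_coordCurve η hm]
    have hc : bundleChart V F E i (sectionCurve (F := F) ξ ⟨s, hs⟩) =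
      coordCurve V i h (sectionCurve (F := F) ξ) s := by rw [← hE]; rfl
    have hc1 : (coordCurve V i h γ s).1 = extChartAt 𝓘(ℝ, V) i (γ ⟨s, hs⟩).proj := by
      rw [coordCurve_fst hm, hb]
    rw [hc, coordCurve_sectionCurve_fst ξ hm, hc1, fderiv_chartTrans_vecDeriv hm' hx']
    have e : extendSection h η s = η (projIcc t₀ t₁ h.le s) := rfl
    have key : ∀ t : Icc t₀ t₁, t = ⟨s, hs⟩ → vecDeriv (extChartAt 𝓘(ℝ, V) i) (γ t).proj
        (A.anchor (γ t).proj (η t)) = vecDeriv (extChartAt 𝓘(ℝ, V) i) (γ ⟨s, hs⟩).proj a := by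
      rintro _ rfl
      rfl
    exact congrArg (fun z => (_, fderiv ℝ (fiberTrans V F E i x₁) _ z _))
      (key _ (projIcc_of_mem h.le hs)).symm
  rw [h1]
  ext1
  · refine (map_finsum (ContinuousLinearMap.fst ℝ V F) (finite_support_smul φ s _)).trans ?_
    simp only [map_smul, ContinuousLinearMap.coe_fst']
    rw [← finsum_smul, φ.sum_eq_one (mem_univ s), one_smul]
  · refine (map_finsum (ContinuousLinearMap.snd ℝ V F) (finite_support_smul φ s _)).trans ?_
    simp only [map_smul, ContinuousLinearMap.coe_snd']
    rfl

/-- Only locally finitely many terms matter. On the support of `φ i` the chart `i` is valid and the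
term is smooth in `C^k` data; off the support it vanishes locally. -/
theorem contDiffWithinAt_gluedComponent
    (hφ : φ.IsSubordinate (fun i => {s | basePath h γ s ∈ coordDomain V F E i}))
    (hη : IsCkCurve V k h (sectionCurve η)) (hξ : IsCkCurve V k h (sectionCurve ξ))
    (hγ : IsCkCurve V k h γ) (hs : s ∈ Icc t₀ t₁) (hx : basePath h γ s ∈ coordDomain V F E x₁) :
    ContDiffWithinAt ℝ k (A.gluedComponent φ h η ξ x₁) (Icc t₀ t₁) s := by
  rw [← contMDiffWithinAt_iff_contDiffWithinAt]
  refine contMDiffWithinAt_finsum (φ.locallyFinite.smul_left _) fun i => ?_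
  rw [contMDiffWithinAt_iff_contDiffWithinAt]
  by_cases hi : s ∈ tsupport (φ i)
  · have hm : basePath h γ s ∈ coordDomain V F E i := hφ i hi
    have C := A.coordChange_coordCurve hm hx
    have c := (hγ.contDiffWithinAt_coordCurve hs hm).fst
    have ch := (hη.contDiffWithinAt_coordCurve (x₀ := i) hs hm).snd
    have cf := (hξ.contDiffWithinAt_coordCurve (x₀ := i) hs hm).snd
    have le : (k : WithTop ℕ∞) ≤ ∞ := by exact_mod_cast le_top
    have g := (C.fiber.fderiv_infty.of_le le).comp_contDiffWithinAt s c
    have r := (C.smooth_left.anchor.of_le le).comp_contDiffWithinAt s c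
    have p : ContDiffWithinAt ℝ k (φ i) (Icc t₀ t₁) s :=
      ((φ i).contMDiff.contDiff.of_le le).contDiffAt.contDiffWithinAt
    exact p.smul ((g.clm_apply (r.clm_apply ch)).clm_apply cf)
  · refine contDiffWithinAt_const (c := (0 : F)).congr_of_eventuallyEq ?_ ?_
    · have : ∀ᶠ r in 𝓝 s, r ∉ tsupport (φ i) := (isClosed_tsupport _).isOpen_compl.mem_nhds hi
      filter_upwards [mem_nhdsWithin_of_mem_nhds this] with r hr
      rw [Pi.smul_apply', image_eq_zero_of_notMem_tsupport hr, zero_smul]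
    · rw [Pi.smul_apply', image_eq_zero_of_notMem_tsupport hi, zero_smul]

theorem gluedComponent_eq_zero
    (hφ : φ.IsSubordinate (fun i => {s | basePath h γ s ∈ coordDomain V F E i}))
    (hs : s ∈ Icc t₀ t₁) (hξ : ξ ⟨s, hs⟩ = 0) : A.gluedComponent φ h η ξ x₁ s = 0 := by
  rw [gluedComponent]
  refine (finsum_congr fun i => ?_).trans finsum_zero
  by_cases hi : φ i s = 0
  · rw [hi, zero_smul]
  · rw [coordCurve_sectionCurve_eq_zero (mem_coordDomain_of_ne_zero hφ hi) hs hξ, map_zero,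
      smul_zero]

theorem coordLift_gluedLift
    (hφ : φ.IsSubordinate (fun i => {s | basePath h γ s ∈ coordDomain V F E i}))
    (hs : s ∈ Icc t₀ t₁) (hx : basePath h γ s ∈ coordDomain V F E x₁) :
    (coordLift x₁ h (A.gluedLift φ η ξ) s).2.2 = A.gluedComponent φ h η ξ x₁ s := by
  have e : extendCurve h (A.gluedLift φ η ξ) s = A.gluedLift φ η ξ ⟨s, hs⟩ :=
    extendCurve_of_mem _ hs
  rw [coordLift_apply, e, vecCoord_gluedLift hφ hs hx]
  rw [e]
  rwa [basePath, extendCurve_of_mem γ hs] at hx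

/-- Where `ξ = 0`, each horizontal vector is tangent to the zero section, so the average is a null
vector. The remaining conditions are read off from the components. -/
theorem isGeneratorLift_gluedLift
    (hφ : φ.IsSubordinate (fun i => {s | basePath h γ s ∈ coordDomain V F E i}))
    (hη : IsCkCurve V k h (sectionCurve η)) (hξ : IsCkCurve V k h (sectionCurve ξ))
    (hγ : IsCkCurve V k h γ) (hξ₀ : ∀ t : Icc t₀ t₁, (t : ℝ) = t₀ ∨ (t : ℝ) = t₁ → ξ t = 0) :
    A.IsGeneratorLift k h γ η ξ (A.gluedLift φ η ξ) where
  contMDiffOn := by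
    intro s hs
    have h₀ : basePath h γ s ∈ coordDomain V F E (basePath h γ s) := mem_coordDomain_self _
    have hev := hγ.eventually_coordDomain hs h₀
    refine contMDiffWithinAt_of_coordLift (x₀ := basePath h γ s) hev hs ?_
    have c1 := hξ.contDiffWithinAt_coordCurve (x₀ := basePath h γ s) hs h₀
    have c2 := (hη.contDiffWithinAt_coordCurve (x₀ := basePath h γ s) hs h₀).snd
    have c3 := contDiffWithinAt_gluedComponent (A := A) hφ hη hξ hγ hs h₀
    have le : (k : WithTop ℕ∞) ≤ ∞ := by exact_mod_cast le_top
    have c4 := ((A.smoothAt_coordCurve h₀).anchor.of_le le).comp_contDiffWithinAt s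
      (hγ.contDiffWithinAt_coordCurve hs h₀).fst
    refine (c1.prodMk ((c4.clm_apply c2).prodMk c3)).congr_of_eventuallyEq_of_mem ?_ hs
    filter_upwards [hev, self_mem_nhdsWithin] with r hr hr'
    have e : extendCurve h (A.gluedLift φ η ξ) r = A.gluedLift φ η ξ ⟨r, hr'⟩ :=
      extendCurve_of_mem _ hr'
    rw [e, vecCoord_gluedLift hφ hr' hr]
    have key : ∀ t : Icc t₀ t₁, t = ⟨r, hr'⟩ → vecDeriv (extChartAt 𝓘(ℝ, V) (basePath h γ s))
        (γ t).proj (A.anchor (γ t).proj (η t)) = vecDeriv (extChartAt 𝓘(ℝ, V) (basePath h γ s))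
        (γ ⟨r, hr'⟩).proj (A.anchor (γ ⟨r, hr'⟩).proj (η ⟨r, hr'⟩)) := by
      rintro _ rfl
      rfl
    have e2 : (A.coord (basePath h γ s)).anchor (coordCurve V (basePath h γ s) h γ r).1
        (coordCurve V (basePath h γ s) h (sectionCurve (F := F) η) r).2 = _ :=
      (coord_anchor_coordCurve η hr).trans (key _ (projIcc_of_mem h.le hr'))
    have e3 : bundleChart V F E (basePath h γ s) (sectionCurve ξ ⟨r, hr'⟩) =
        coordCurve V (basePath h γ s) h (sectionCurve (F := F) ξ) r := by
      rw [coordCurve, extendCurve_of_mem _ hr']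
    rw [← e2]
    exact congrArg (fun z => (z, _)) e3
  proj_eq _ := rfl
  base := by
    intro t
    have h₀ : (γ t).proj ∈ coordDomain V F E (γ t).proj := mem_coordDomain_self _
    have h₀' : basePath h γ t ∈ coordDomain V F E (γ t).proj := by rwa [basePath_coe]
    have e := vecCoord_gluedLift (A := A) (η := η) (ξ := ξ) hφ t.2 h₀'
    have e1 := vecCoord_fst (A.gluedLift φ η ξ t) (x₀ := (γ t).proj) h₀
    rw [e] at e1
    have e2 := mfderiv_extChartAt_injective (coordDomain_source h₀) e1
    exact congrArg (fun v => (⟨(γ t).proj, v⟩ : TangentBundle 𝓘(ℝ, V) M)) e2.symm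
  null := by
    intro t ht
    have h₀ : (γ t).proj ∈ coordDomain V F E (γ t).proj := mem_coordDomain_self _
    have h₀' : basePath h γ t ∈ coordDomain V F E (γ t).proj := by rwa [basePath_coe]
    refine vecCoord_injective (x₀ := (γ t).proj) h₀ ?_ ?_
    · exact congrArg (fun v => (⟨(γ t).proj, v⟩ : TotalSpace F E)) (hξ₀ t ht)
    · rw [vecCoord_tangentMap_zeroSection _ h₀]
      refine (vecCoord_gluedLift hφ t.2 h₀').trans ?_
      rw [gluedComponent_eq_zero hφ t.2 (hξ₀ t ht)]

theorem continuous_basePath (hγ : IsCkCurve V k h γ) : Continuous (basePath h γ) := by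
  have c : ContinuousOn (basePath h γ) (Icc t₀ t₁) := fun s hs => hγ.continuousWithinAt_basePath hs
  rw [continuousOn_iff_continuous_domRestrict] at c
  have e : basePath h γ = IccExtend h.le ((Icc t₀ t₁).restrict (basePath h γ)) := by
    funext s
    exact (basePath_coe (h := h) (projIcc t₀ t₁ h.le s)).symm
  rw [e]
  exact c.Icc_extend'

/-- A partition of unity subordinate to the coordinate domains along a curve, which reduces to one
function on a given closed set of times. -/
theorem exists_partition (hγ : IsCkCurve V k h γ) (x₀ : M) {J : Set ℝ} (hJ : IsClosed J)
    (hJx : ∀ s ∈ J, basePath h γ s ∈ coordDomain V F E x₀) :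
    ∃ φ : SmoothPartitionOfUnity M 𝓘(ℝ, ℝ) ℝ univ,
      φ.IsSubordinate (fun i => {s | basePath h γ s ∈ coordDomain V F E i}) ∧
      ∀ s ∈ J, ∀ i ≠ x₀, φ i s = 0 := by
  have ho : ∀ i, IsOpen {s | basePath h γ s ∈ coordDomain V F E i} := fun i =>
    (isOpen_coordDomain i).preimage (continuous_basePath hγ)
  obtain ⟨φ, hφ⟩ := SmoothPartitionOfUnity.exists_isSubordinate 𝓘(ℝ, ℝ) (s := univ) isClosed_univ
    -- The second set is everything for `i = x₀` and the complement of `J` otherwise, so a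
    -- subordinate `φ i` with `i ≠ x₀` vanishes on `J`.
    (fun i => {s | basePath h γ s ∈ coordDomain V F E i} ∩ {s | s ∈ J → i = x₀})
    (fun i => by
      by_cases hi : i = x₀
      · simpa [hi] using ho x₀
      · simpa [hi, compl_def] using (ho i).inter hJ.isOpen_compl)
    -- Times in `J` are covered by the index `x₀`, all others by the base point of the curve at that
    -- time.
    (fun s _ => by
      rw [mem_iUnion]
      by_cases hs : s ∈ J
      · exact ⟨x₀, hJx s hs, fun _ => rfl⟩
      · exact ⟨basePath h γ s, mem_coordDomain_self _, fun h => absurd h hs⟩)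
  refine ⟨φ, fun i => (hφ i).trans inter_subset_left, fun s hs i hi => ?_⟩
  by_contra h0
  exact hi ((hφ i (subset_tsupport _ h0)).2 hs)

end SkewAlgebroid

end Algebroid

/-! ### Bilinearity of the second variation. -/

section Algebroid

variable {V : Type*} [NormedAddCommGroup V] [NormedSpace ℝ V]
  {F : Type*} [NormedAddCommGroup F] [NormedSpace ℝ F]
  {M : Type*} [TopologicalSpace M] [ChartedSpace V M]
  {E : M → Type*} [∀ x, AddCommGroup (E x)] [∀ x, Module ℝ (E x)]
  [∀ x, TopologicalSpace (E x)] [TopologicalSpace (TotalSpace F E)]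
  [FiberBundle F E] [VectorBundle ℝ F E] [IsManifold 𝓘(ℝ, V) ∞ M]
  [FiniteDimensional ℝ V] [T2Space M] [ContMDiffVectorBundle ∞ F E 𝓘(ℝ, V)]

variable {x₀ x₁ x : M} {k : ℕ∞} {t₀ t₁ : ℝ} {h : t₀ < t₁} {γ : Icc t₀ t₁ → TotalSpace F E} {s : ℝ}
  [FiniteDimensional ℝ F] {A : SkewAlgebroid V F E} {η η' ξ ξ' : ∀ t, E (γ t).proj}
  {L : TotalSpace F E → ℝ}
  {φ : SmoothPartitionOfUnity M 𝓘(ℝ, ℝ) ℝ univ} {a : ℝ}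

open CoordAlgebroid

namespace SkewAlgebroid

/-- Here the integrand is written through `ξ` and `gluedComponent` only, so that its bilinearity in
`(η, ξ)` is visible term by term. -/
theorem integrand_gluedLift
    (hφ : φ.IsSubordinate (fun i => {s | basePath h γ s ∈ coordDomain V F E i}))
    (hA : A.IsAlmostLie) (hL : ContMDiff (𝓘(ℝ, V).prod 𝓘(ℝ, F)) 𝓘(ℝ, ℝ) ∞ L)
    (hEL : A.IsELSolution L h γ) (hη : IsCkCurve V k h (sectionCurve η))
    (hξ : IsCkCurve V k h (sectionCurve ξ)) (hγ : IsCkCurve V k h γ) (hk : 1 ≤ k)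
    (hξ₀ : ∀ t : Icc t₀ t₁, (t : ℝ) = t₀ ∨ (t : ℝ) = t₁ → ξ t = 0) (hs : s ∈ Icc t₀ t₁)
    (hx : basePath h γ s ∈ coordDomain V F E x₁) :
    A.secondVariationIntegrand L h γ η (A.gluedLift φ η ξ) s =
      (fderiv ℝ (momentum (coordLagrangian V L x₁)) (coordCurve V x₁ h γ s)
          (A.coordVariation x₁ h γ η s)
          (derivWithin (coordCurve V x₁ h (sectionCurve (F := F) ξ)) (Icc t₀ t₁) s).2
        + momentum (coordLagrangian V L x₁) (coordCurve V x₁ h γ s)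
          (derivWithin (A.gluedComponent φ h η ξ x₁) (Icc t₀ t₁) s))
      + (fderiv ℝ ((A.coord x₁).force (coordLagrangian V L x₁)) (coordCurve V x₁ h γ s)
          (A.coordVariation x₁ h γ η s) (coordCurve V x₁ h (sectionCurve (F := F) ξ) s).2
        + (A.coord x₁).force (coordLagrangian V L x₁) (coordCurve V x₁ h γ s)
          (A.gluedComponent φ h η ξ x₁ s)) := by
  have H := isGeneratorLift_gluedLift (A := A) hφ hη hξ hγ hξ₀
  have u := uniqueDiffWithinAt_Icc_of_mem h hs
  have d := ((H.contDiffWithinAt hs hx).differentiableWithinAt_of_one_le hk).hasDerivWithinAt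
  have ev := hγ.eventually_coordDomain hs hx
  rw [← integrandIn_eq hA hL hEL hη hγ hk H hs hx, integrandIn_eq_sum hL hx, H.coordLift_fst hx,
    coordLift_gluedLift hφ hs hx]
  have e1 : derivWithin (coordCurve V x₁ h (sectionCurve (F := F) ξ)) (Icc t₀ t₁) s =
      (derivWithin (coordLift x₁ h (A.gluedLift φ η ξ)) (Icc t₀ t₁) s).1 := by
    refine d.prod_fst.derivWithin_eq_of_eventuallyEq u hs ?_
    filter_upwards [ev] with r hr using (H.coordLift_fst hr).symm
  have e2 : derivWithin (A.gluedComponent φ h η ξ x₁) (Icc t₀ t₁) s =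
      (derivWithin (coordLift x₁ h (A.gluedLift φ η ξ)) (Icc t₀ t₁) s).2.2 := by
    refine d.prod_snd.prod_snd.derivWithin_eq_of_eventuallyEq u hs ?_
    filter_upwards [ev, self_mem_nhdsWithin] with r hr hr'
      using (coordLift_gluedLift hφ hr' hr).symm
  rw [e1, e2]

theorem coordCurve_sectionCurve_linear (hx : basePath h γ s ∈ coordDomain V F E x₀) :
    (coordCurve V x₀ h (sectionCurve (F := F) (a • η + η')) s).2 =
      a • (coordCurve V x₀ h (sectionCurve (F := F) η) s).2
        + (coordCurve V x₀ h (sectionCurve (F := F) η') s).2 := by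
  rw [coordCurve_sectionCurve _ hx, coordCurve_sectionCurve _ hx, coordCurve_sectionCurve _ hx]
  have e : extendSection h (a • η + η') s = a • extendSection h η s + extendSection h η' s := rfl
  simp only [e, map_add, map_smul]

theorem derivWithin_linear {X : Type*} [NormedAddCommGroup X] [NormedSpace ℝ X] {S : Set ℝ}
    {u u₁ u₂ : ℝ → X} {u₁' u₂' : X} (hs : UniqueDiffWithinAt ℝ S s) (hsS : s ∈ S)
    (h₁ : HasDerivWithinAt u₁ u₁' S s) (h₂ : HasDerivWithinAt u₂ u₂' S s)
    (e : ∀ᶠ r in 𝓝[S] s, u r = a • u₁ r + u₂ r) : derivWithin u S s = a • u₁' + u₂' :=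
  ((h₁.const_smul a).add h₂).derivWithin_eq_of_eventuallyEq hs hsS e

theorem derivWithin_coordCurve_linear (hη : IsCkCurve V k h (sectionCurve η))
    (hη' : IsCkCurve V k h (sectionCurve η')) (hη'' : IsCkCurve V k h (sectionCurve (a • η + η')))
    (hγ : IsCkCurve V k h γ) (hk : 1 ≤ k) (hs : s ∈ Icc t₀ t₁)
    (hx : basePath h γ s ∈ coordDomain V F E x₀) :
    (derivWithin (coordCurve V x₀ h (sectionCurve (F := F) (a • η + η'))) (Icc t₀ t₁) s).2 =
      a • (derivWithin (coordCurve V x₀ h (sectionCurve (F := F) η)) (Icc t₀ t₁) s).2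
        + (derivWithin (coordCurve V x₀ h (sectionCurve (F := F) η')) (Icc t₀ t₁) s).2 := by
  have u := uniqueDiffWithinAt_Icc_of_mem h hs
  have d := ((hη.contDiffWithinAt_coordCurve (x₀ := x₀) hs
    hx).differentiableWithinAt_of_one_le hk).hasDerivWithinAt
  have d' := ((hη'.contDiffWithinAt_coordCurve (x₀ := x₀) hs
    hx).differentiableWithinAt_of_one_le hk).hasDerivWithinAt
  have d'' := ((hη''.contDiffWithinAt_coordCurve (x₀ := x₀) hs
    hx).differentiableWithinAt_of_one_le hk).hasDerivWithinAt
  rw [← d''.prod_snd.derivWithin u]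
  refine derivWithin_linear u hs d.prod_snd d'.prod_snd ?_
  filter_upwards [hγ.eventually_coordDomain hs hx] with r hr using coordCurve_sectionCurve_linear hr

theorem coordVariation_linear (hη : IsCkCurve V k h (sectionCurve η))
    (hη' : IsCkCurve V k h (sectionCurve η')) (hη'' : IsCkCurve V k h (sectionCurve (a • η + η')))
    (hγ : IsCkCurve V k h γ) (hk : 1 ≤ k) (hs : s ∈ Icc t₀ t₁)
    (hx : basePath h γ s ∈ coordDomain V F E x₀) :
    A.coordVariation x₀ h γ (a • η + η') s =
      a • A.coordVariation x₀ h γ η s + A.coordVariation x₀ h γ η' s := by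
  simp only [coordVariation, kappa, coordCurve_sectionCurve_linear hx,
    derivWithin_coordCurve_linear hη hη' hη'' hγ hk hs hx, map_add, map_smul]
  ext1
  · rfl
  · simp only [Prod.snd_add, Prod.smul_snd, smul_add]
    abel

/-- Linearity is asked only where `φ i s ≠ 0`, since the chart `i` is meaningful only there. -/
theorem finsum_smul_linear {W : Type*} [AddCommGroup W] [Module ℝ W] (g g₁ g₂ : M → W)
    (e : ∀ i, φ i s ≠ 0 → g i = a • g₁ i + g₂ i) :
    ∑ᶠ i, φ i s • g i = a • (∑ᶠ i, φ i s • g₁ i) + ∑ᶠ i, φ i s • g₂ i := by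
  rw [smul_finsum' a (finite_support_smul φ s g₁), ← finsum_add_distrib]
  · refine finsum_congr fun i => ?_
    by_cases hi : φ i s = 0
    · simp [hi]
    · rw [e i hi, smul_add, smul_comm]
  · refine (finite_support_smul φ s g₁).subset fun i hi h0 => hi ?_
    simp only [h0, smul_zero]
  · exact finite_support_smul φ s g₂

theorem gluedComponent_linear_left
    (hφ : φ.IsSubordinate (fun i => {s | basePath h γ s ∈ coordDomain V F E i})) :
    A.gluedComponent φ h (a • η + η') ξ x₁ s =
      a • A.gluedComponent φ h η ξ x₁ s + A.gluedComponent φ h η' ξ x₁ s :=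
  finsum_smul_linear _ _ _ fun i hi => by
    rw [coordCurve_sectionCurve_linear (mem_coordDomain_of_ne_zero hφ hi)]
    simp only [map_add, map_smul, _root_.add_apply, _root_.smul_apply]

theorem gluedComponent_linear_right
    (hφ : φ.IsSubordinate (fun i => {s | basePath h γ s ∈ coordDomain V F E i})) :
    A.gluedComponent φ h η (a • ξ + ξ') x₁ s =
      a • A.gluedComponent φ h η ξ x₁ s + A.gluedComponent φ h η ξ' x₁ s :=
  finsum_smul_linear _ _ _ fun i hi => by
    rw [coordCurve_sectionCurve_linear (mem_coordDomain_of_ne_zero hφ hi), map_add, map_smul]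

theorem vanish_linear (hξ₀ : ∀ t : Icc t₀ t₁, (t : ℝ) = t₀ ∨ (t : ℝ) = t₁ → ξ t = 0)
    (hξ₀' : ∀ t : Icc t₀ t₁, (t : ℝ) = t₀ ∨ (t : ℝ) = t₁ → ξ' t = 0) :
    ∀ t : Icc t₀ t₁, (t : ℝ) = t₀ ∨ (t : ℝ) = t₁ → (a • ξ + ξ') t = 0 := by
  intro t ht
  simp [hξ₀ t ht, hξ₀' t ht]

theorem integrand_linear_left
    (hφ : φ.IsSubordinate (fun i => {s | basePath h γ s ∈ coordDomain V F E i}))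
    (hA : A.IsAlmostLie) (hL : ContMDiff (𝓘(ℝ, V).prod 𝓘(ℝ, F)) 𝓘(ℝ, ℝ) ∞ L)
    (hEL : A.IsELSolution L h γ) (hη : IsCkCurve V k h (sectionCurve η))
    (hη' : IsCkCurve V k h (sectionCurve η')) (hη'' : IsCkCurve V k h (sectionCurve (a • η + η')))
    (hξ : IsCkCurve V k h (sectionCurve ξ)) (hγ : IsCkCurve V k h γ) (hk : 1 ≤ k)
    (hξ₀ : ∀ t : Icc t₀ t₁, (t : ℝ) = t₀ ∨ (t : ℝ) = t₁ → ξ t = 0) (hs : s ∈ Icc t₀ t₁) :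
    A.secondVariationIntegrand L h γ (a • η + η') (A.gluedLift φ (a • η + η') ξ) s =
      a * A.secondVariationIntegrand L h γ η (A.gluedLift φ η ξ) s
        + A.secondVariationIntegrand L h γ η' (A.gluedLift φ η' ξ) s := by
  have h₀ : basePath h γ s ∈ coordDomain V F E (basePath h γ s) := mem_coordDomain_self _
  have g := ((contDiffWithinAt_gluedComponent (A := A) hφ hη hξ hγ hs
    h₀).differentiableWithinAt_of_one_le hk).hasDerivWithinAt
  have g' := ((contDiffWithinAt_gluedComponent (A := A) hφ hη' hξ hγ hs
    h₀).differentiableWithinAt_of_one_le hk).hasDerivWithinAt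
  rw [integrand_gluedLift hφ hA hL hEL hη hξ hγ hk hξ₀ hs h₀,
    integrand_gluedLift hφ hA hL hEL hη' hξ hγ hk hξ₀ hs h₀,
    integrand_gluedLift hφ hA hL hEL hη'' hξ hγ hk hξ₀ hs h₀,
    coordVariation_linear hη hη' hη'' hγ hk hs h₀, gluedComponent_linear_left hφ,
    derivWithin_linear (uniqueDiffWithinAt_Icc_of_mem h hs) hs g g'
      (Filter.Eventually.of_forall fun r => gluedComponent_linear_left hφ)]
  simp only [map_add, map_smul, _root_.add_apply, _root_.smul_apply, smul_eq_mul]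
  ring

theorem integrand_linear_right
    (hφ : φ.IsSubordinate (fun i => {s | basePath h γ s ∈ coordDomain V F E i}))
    (hA : A.IsAlmostLie) (hL : ContMDiff (𝓘(ℝ, V).prod 𝓘(ℝ, F)) 𝓘(ℝ, ℝ) ∞ L)
    (hEL : A.IsELSolution L h γ) (hη : IsCkCurve V k h (sectionCurve η))
    (hξ : IsCkCurve V k h (sectionCurve ξ)) (hξ' : IsCkCurve V k h (sectionCurve ξ'))
    (hξ'' : IsCkCurve V k h (sectionCurve (a • ξ + ξ'))) (hγ : IsCkCurve V k h γ) (hk : 1 ≤ k)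
    (hξ₀ : ∀ t : Icc t₀ t₁, (t : ℝ) = t₀ ∨ (t : ℝ) = t₁ → ξ t = 0)
    (hξ₀' : ∀ t : Icc t₀ t₁, (t : ℝ) = t₀ ∨ (t : ℝ) = t₁ → ξ' t = 0) (hs : s ∈ Icc t₀ t₁) :
    A.secondVariationIntegrand L h γ η (A.gluedLift φ η (a • ξ + ξ')) s =
      a * A.secondVariationIntegrand L h γ η (A.gluedLift φ η ξ) s
        + A.secondVariationIntegrand L h γ η (A.gluedLift φ η ξ') s := by
  have h₀ : basePath h γ s ∈ coordDomain V F E (basePath h γ s) := mem_coordDomain_self _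
  have g := ((contDiffWithinAt_gluedComponent (A := A) hφ hη hξ hγ hs
    h₀).differentiableWithinAt_of_one_le hk).hasDerivWithinAt
  have g' := ((contDiffWithinAt_gluedComponent (A := A) hφ hη hξ' hγ hs
    h₀).differentiableWithinAt_of_one_le hk).hasDerivWithinAt
  rw [integrand_gluedLift hφ hA hL hEL hη hξ hγ hk hξ₀ hs h₀,
    integrand_gluedLift hφ hA hL hEL hη hξ' hγ hk hξ₀' hs h₀,
    integrand_gluedLift hφ hA hL hEL hη hξ'' hγ hk (vanish_linear hξ₀ hξ₀') hs h₀,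
    derivWithin_coordCurve_linear hξ hξ' hξ'' hγ hk hs h₀, coordCurve_sectionCurve_linear h₀,
    gluedComponent_linear_right hφ,
    derivWithin_linear (uniqueDiffWithinAt_Icc_of_mem h hs) hs g g'
      (Filter.Eventually.of_forall fun r => gluedComponent_linear_right hφ)]
  simp only [map_add, map_smul, smul_eq_mul]
  ring

/-- The second variation evaluated on the lifts glued by a partition of unity. -/
def gluedVariation (A : SkewAlgebroid V F E) (L : TotalSpace F E → ℝ) (h : t₀ < t₁)
    (φ : SmoothPartitionOfUnity M 𝓘(ℝ, ℝ) ℝ univ) {γ : Icc t₀ t₁ → TotalSpace F E}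
    (η ξ : ∀ t, E (γ t).proj) : ℝ :=
  ∫ t in t₀..t₁, A.secondVariationIntegrand L h γ η (A.gluedLift φ η ξ) t

theorem vanish_of_mem (hγ : IsCkCurve V k h γ) (ξ : sectionsAlongZero V k h γ hγ) :
    ∀ t : Icc t₀ t₁, (t : ℝ) = t₀ ∨ (t : ℝ) = t₁ → ξ.1.1 t = 0 := by
  intro t ht
  have key : ∀ r : Icc t₀ t₁, t = r → ξ.1.1 r = 0 → ξ.1.1 t = 0 := by
    rintro _ rfl hr
    exact hr
  exact ht.elim (fun e => key _ (Subtype.ext e) ξ.2.1) (fun e => key _ (Subtype.ext e) ξ.2.2)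

theorem continuousOn_integrand_gluedLift
    (hφ : φ.IsSubordinate (fun i => {s | basePath h γ s ∈ coordDomain V F E i}))
    (hA : A.IsAlmostLie) (hL : ContMDiff (𝓘(ℝ, V).prod 𝓘(ℝ, F)) 𝓘(ℝ, ℝ) ∞ L)
    (hEL : A.IsELSolution L h γ) (hγ : IsCkCurve V k h γ) (hk : 1 ≤ k)
    (η : sectionsAlong V k h γ hγ) (ξ : sectionsAlongZero V k h γ hγ) :
    ContinuousOn (A.secondVariationIntegrand L h γ η.1 (A.gluedLift φ η.1 ξ.1.1)) (Icc t₀ t₁) :=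
  continuousOn_integrand hA hL hEL η.2 hγ hk
    (isGeneratorLift_gluedLift hφ η.2 ξ.1.2 hγ (vanish_of_mem hγ ξ))

theorem gluedVariation_linear_left
    (hφ : φ.IsSubordinate (fun i => {s | basePath h γ s ∈ coordDomain V F E i}))
    (hA : A.IsAlmostLie) (hL : ContMDiff (𝓘(ℝ, V).prod 𝓘(ℝ, F)) 𝓘(ℝ, ℝ) ∞ L)
    (hEL : A.IsELSolution L h γ) (hγ : IsCkCurve V k h γ) (hk : 1 ≤ k) (a : ℝ)
    (η η' : sectionsAlong V k h γ hγ) (ξ : sectionsAlongZero V k h γ hγ) :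
    A.gluedVariation L h φ (a • η + η').1 ξ.1.1 =
      a * A.gluedVariation L h φ η.1 ξ.1.1 + A.gluedVariation L h φ η'.1 ξ.1.1 := by
  have c := fun η => (continuousOn_integrand_gluedLift hφ hA hL hEL hγ hk η
    ξ).intervalIntegrable_of_Icc (μ := MeasureTheory.volume) h.le
  rw [gluedVariation, gluedVariation, gluedVariation, ← intervalIntegral.integral_const_mul,
    ← intervalIntegral.integral_add ((c η).const_mul a) (c η')]
  refine intervalIntegral.integral_congr fun s hs => ?_
  rw [uIcc_of_le h.le] at hs
  exact integrand_linear_left hφ hA hL hEL η.2 η'.2 (a • η + η').2 ξ.1.2 hγ hk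
    (vanish_of_mem hγ ξ) hs

theorem gluedVariation_linear_right
    (hφ : φ.IsSubordinate (fun i => {s | basePath h γ s ∈ coordDomain V F E i}))
    (hA : A.IsAlmostLie) (hL : ContMDiff (𝓘(ℝ, V).prod 𝓘(ℝ, F)) 𝓘(ℝ, ℝ) ∞ L)
    (hEL : A.IsELSolution L h γ) (hγ : IsCkCurve V k h γ) (hk : 1 ≤ k) (a : ℝ)
    (η : sectionsAlong V k h γ hγ) (ξ ξ' : sectionsAlongZero V k h γ hγ) :
    A.gluedVariation L h φ η.1 (a • ξ + ξ').1.1 =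
      a * A.gluedVariation L h φ η.1 ξ.1.1 + A.gluedVariation L h φ η.1 ξ'.1.1 := by
  have c := fun ξ => (continuousOn_integrand_gluedLift hφ hA hL hEL hγ hk η
    ξ).intervalIntegrable_of_Icc (μ := MeasureTheory.volume) h.le
  rw [gluedVariation, gluedVariation, gluedVariation, ← intervalIntegral.integral_const_mul,
    ← intervalIntegral.integral_add ((c ξ).const_mul a) (c ξ')]
  refine intervalIntegral.integral_congr fun s hs => ?_
  rw [uIcc_of_le h.le] at hs
  exact integrand_linear_right hφ hA hL hEL η.2 ξ.1.2 ξ'.1.2 (a • ξ + ξ').1.2 hγ hk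
    (vanish_of_mem hγ ξ) (vanish_of_mem hγ ξ') hs

/-- The second variation as a bilinear form. -/
def secondVariationForm
    (hφ : φ.IsSubordinate (fun i => {s | basePath h γ s ∈ coordDomain V F E i}))
    (hA : A.IsAlmostLie) (hL : ContMDiff (𝓘(ℝ, V).prod 𝓘(ℝ, F)) 𝓘(ℝ, ℝ) ∞ L)
    (hEL : A.IsELSolution L h γ) (hγ : IsCkCurve V k h γ) (hk : 1 ≤ k) :
    sectionsAlong V k h γ hγ →ₗ[ℝ] sectionsAlongZero V k h γ hγ →ₗ[ℝ] ℝ :=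
  have hl := gluedVariation_linear_left hφ hA hL hEL hγ hk
  have hr := gluedVariation_linear_right hφ hA hL hEL hγ hk
  have hl0 : ∀ ξ : sectionsAlongZero V k h γ hγ, A.gluedVariation L h φ
      (0 : sectionsAlong V k h γ hγ).1 ξ.1.1 = 0 := fun ξ => by
    have := hl 1 0 0 ξ
    simpa using this
  have hr0 : ∀ η : sectionsAlong V k h γ hγ, A.gluedVariation L h φ η.1
      (0 : sectionsAlongZero V k h γ hγ).1.1 = 0 := fun η => by
    have := hr 1 η 0 0
    simpa using this
  LinearMap.mk₂ ℝ (fun η ξ => A.gluedVariation L h φ η.1 ξ.1.1)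
    (fun η η' ξ => by simpa using hl 1 η η' ξ)
    (fun a η ξ => by
      have := hl a η 0 ξ
      rwa [hl0, add_zero, add_zero] at this)
    (fun η ξ ξ' => by simpa using hr 1 η ξ ξ')
    (fun a η ξ => by
      have := hr a η ξ 0
      rwa [hr0, add_zero, add_zero] at this)

theorem isSecondVariation_secondVariationForm
    (hφ : φ.IsSubordinate (fun i => {s | basePath h γ s ∈ coordDomain V F E i}))
    (hA : A.IsAlmostLie) (hL : ContMDiff (𝓘(ℝ, V).prod 𝓘(ℝ, F)) 𝓘(ℝ, ℝ) ∞ L)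
    (hEL : A.IsELSolution L h γ) (hγ : IsCkCurve V k h γ) (hk : 1 ≤ k) :
    A.IsSecondVariation L k h γ hγ (secondVariationForm hφ hA hL hEL hγ hk) := by
  intro η ξ
  have H := isGeneratorLift_gluedLift (A := A) hφ η.2 ξ.1.2 hγ (vanish_of_mem hγ ξ)
  exact ⟨⟨_, H⟩, fun Δ hΔ => ⟨(continuousOn_integrand hA hL hEL η.2 hγ hk
    hΔ).intervalIntegrable_of_Icc h.le, integral_eq_of_lifts hA hL hEL η.2 hγ hk H hΔ⟩⟩

end SkewAlgebroid

end Algebroid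

/-! ### The lemma of du Bois-Reymond. -/

section DuBoisReymond

open MeasureTheory

variable {a b : ℝ}

theorem exists_Icc_of_tsupport_subset_Ioo {g : ℝ → ℝ} (hab : a < b) (hg : HasCompactSupport g)
    (hs : tsupport g ⊆ Ioo a b) :
    ∃ a' b', a < a' ∧ b' < b ∧ ∀ s ∉ Icc a' b', g s = 0 := by
  -- The midpoint keeps `K` nonempty when `g` is zero, so that its infimum and supremum lie in `K`,
  -- hence strictly inside the interval.
  let K := insert ((a + b) / 2) (tsupport g)
  have hK : IsCompact K := hg.isCompact.insert _
  have hne : K.Nonempty := insert_nonempty _ _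
  have hsub : K ⊆ Ioo a b := insert_subset ⟨by linarith, by linarith⟩ hs
  refine ⟨sInf K, sSup K, (hsub (hK.sInf_mem hne)).1, (hsub (hK.sSup_mem hne)).2, fun s hsn => ?_⟩
  by_contra h0
  have hm : s ∈ K := mem_insert_of_mem _ (subset_tsupport _ h0)
  exact hsn ⟨csInf_le hK.bddBelow hm, le_csSup hK.bddAbove hm⟩

/-- A smooth function with integral zero and support in an open interval has a primitive with
support in that interval. -/
theorem exists_primitive {g : ℝ → ℝ} (hab : a < b) (hg : ContDiff ℝ ∞ g) (hgc : HasCompactSupport g)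
    (hs : tsupport g ⊆ Ioo a b) (h0 : ∫ s in a..b, g s = 0) :
    ∃ ψ : ℝ → ℝ, ContDiff ℝ ∞ ψ ∧ tsupport ψ ⊆ Ioo a b ∧ deriv ψ = g := by
  obtain ⟨a', b', ha, hb, hz⟩ := exists_Icc_of_tsupport_subset_Ioo hab hgc hs
  have hd : ∀ s, HasDerivAt (fun u => ∫ r in a..u, g r) (g s) s := fun s =>
    intervalIntegral.integral_hasDerivAt_right (hg.continuous.intervalIntegrable _ _)
      hg.continuous.aestronglyMeasurable.stronglyMeasurableAtFilter hg.continuous.continuousAt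
  have hderiv : deriv (fun u => ∫ r in a..u, g r) = g := funext fun s => (hd s).deriv
  refine ⟨fun u => ∫ r in a..u, g r, ?_, ?_, hderiv⟩
  · rw [contDiff_infty_iff_deriv, hderiv]
    exact ⟨fun s => (hd s).differentiableAt, hg⟩
  · refine (closure_minimal (t := Icc a' b') ?_ isClosed_Icc).trans
      fun s hs => ⟨ha.trans_le hs.1, hs.2.trans_lt hb⟩
    intro s hs
    by_contra hn
    refine hs ?_
    have zero : ∀ p q, (∀ r ∈ uIcc p q, r ∉ Icc a' b') → ∫ r in p..q, g r = 0 := by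
      intro p q hpq
      rw [intervalIntegral.integral_congr (g := fun _ => (0 : ℝ)) fun r hr => hz r (hpq r hr)]
      simp
    rcases lt_or_ge s a' with hlt | hge
    · refine zero a s fun r hr hr' => ?_
      have := hr.2
      exact absurd (hr'.1.trans this) (not_le.2 (max_lt ha hlt))
    · have hgt : b' < s := by
        by_contra hc
        exact hn ⟨hge, not_lt.1 hc⟩
      -- Beyond `b'` the primitive equals the total integral, which is zero, plus an integral over
      -- points outside the support.
      have e := intervalIntegral.integral_add_adjacent_intervals
        (hg.continuous.intervalIntegrable (μ := volume) a b)
        (hg.continuous.intervalIntegrable b s)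
      refine e.symm.trans ?_
      rw [h0, zero_add]
      refine zero b s fun r hr hr' => ?_
      exact absurd (hr.1.trans hr'.2) (not_le.2 (lt_min hb hgt))

/-- Derivatives of test functions are exactly the test functions of mean zero. Subtracting a
multiple of a fixed bump `χ` of mass one makes any `g` of this kind, whence `∫ (D - c) g = 0` with
`c = ∫ D χ`. -/
theorem eqOn_const_of_integral_mul_deriv_eq_zero {D : ℝ → ℝ} (hab : a < b) (hD : Continuous D)
    (H : ∀ ψ : ℝ → ℝ, ContDiff ℝ ∞ ψ → tsupport ψ ⊆ Ioo a b → ∫ s in a..b, D s * deriv ψ s = 0) :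
    ∃ c, EqOn D (fun _ => c) (Icc a b) := by
  -- The outer radius is a quarter of the length, so the support stays strictly inside the interval.
  let f : ContDiffBump ((a + b) / 2) := ⟨(b - a) / 8, (b - a) / 4, by linarith, by linarith⟩
  let χ := f.normed volume
  have hχ : ContDiff ℝ ∞ χ := f.contDiff_normed
  have hχc : HasCompactSupport χ := f.hasCompactSupport_normed
  have hχs : tsupport χ ⊆ Ioo a b := by
    rw [f.tsupport_normed_eq, Real.closedBall_eq_Icc]
    intro s hs
    have h1 := hs.1
    have h2 := hs.2
    simp only [f] at h1 h2
    exact ⟨by linarith, by linarith⟩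
  have full : ∀ u : ℝ → ℝ, tsupport u ⊆ Ioo a b → ∀ v : ℝ → ℝ,
      ∫ s in a..b, v s * u s = ∫ s, v s * u s := fun u hu v => by
    refine intervalIntegral.integral_eq_integral_of_support_subset fun s hs => ?_
    have h1 : u s ≠ 0 := right_ne_zero_of_mul hs
    exact Ioo_subset_Ioc_self (hu (subset_tsupport _ h1))
  have hχ1 : ∫ s in a..b, χ s = 1 := by
    have := full χ hχs fun _ => 1
    simp only [one_mul] at this
    rw [this]
    exact f.integral_normed
  set c := ∫ s in a..b, D s * χ s with hc
  refine ⟨c, ?_⟩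
  have hcont : Continuous fun s => D s - c := hD.sub continuous_const
  have ae := isOpen_Ioo.ae_eq_zero_of_integral_contDiff_smul_eq_zero (U := Ioo a b) (μ := volume)
    (f := fun s => D s - c) (hcont.locallyIntegrable.locallyIntegrableOn _) ?_
  -- Vanishing almost everywhere on the open interval extends to every point of the closed one by
  -- continuity.
  · have e : EqOn (fun s => D s - c) (fun _ => 0) (Icc a b) := by
      refine Measure.eqOn_Icc_of_ae_eq (μ := volume) hab.ne ?_ hcont.continuousOn
        continuousOn_const
      rw [← restrict_Ioo_eq_restrict_Icc]
      exact (ae_restrict_iff' measurableSet_Ioo).2 ae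
    exact fun s hs => sub_eq_zero.1 (e hs)
  · intro g hg hgc hgs
    set m := ∫ s in a..b, g s with hm
    have hsub : tsupport (fun s => g s - m * χ s) ⊆ tsupport g ∪ tsupport χ := by
      refine closure_minimal (fun s hs => ?_) ((isClosed_tsupport _).union (isClosed_tsupport _))
      by_contra hn
      rw [mem_union, not_or] at hn
      exact hs (by simp [image_eq_zero_of_notMem_tsupport hn.1,
        image_eq_zero_of_notMem_tsupport hn.2])
    have ig : ∀ u v : ℝ → ℝ, Continuous u → Continuous v →
      IntervalIntegrable (fun s => u s * v s) volume a b := fun u v hu hv =>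
        (hu.mul hv).intervalIntegrable _ _
    obtain ⟨ψ, h1, h2, h3⟩ := exists_primitive (g := fun s => g s - m * χ s) hab
      (hg.sub (contDiff_const.mul hχ))
      (HasCompactSupport.of_support_subset_isCompact (hgc.isCompact.union hχc.isCompact)
        ((subset_tsupport _).trans hsub)) (hsub.trans (union_subset hgs hχs)) (by
        rw [intervalIntegral.integral_sub (hg.continuous.intervalIntegrable _ _)
          (ig _ _ continuous_const hχ.continuous), intervalIntegral.integral_const_mul, hχ1, mul_one,
          sub_self])
    have e := H ψ h1 h2
    rw [h3] at e
    have e1 : ∫ s in a..b, D s * (g s - m * χ s) = (∫ s in a..b, D s * g s) - m * c := by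
      rw [hc, ← intervalIntegral.integral_const_mul, ← intervalIntegral.integral_sub
        (ig _ _ hD hg.continuous) ((ig _ _ hD hχ.continuous).const_mul m)]
      refine intervalIntegral.integral_congr fun s _ => ?_
      ring
    have e2 : ∫ s in a..b, (D s - c) * g s = (∫ s in a..b, D s * g s) - c * m := by
      rw [hm, ← intervalIntegral.integral_const_mul, ← intervalIntegral.integral_sub
        (ig _ _ hD hg.continuous) ((hg.continuous.intervalIntegrable _ _).const_mul c)]
      refine intervalIntegral.integral_congr fun s _ => ?_
      ring
    have e3 := full g hgs fun s => D s - c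
    have e4 : ∫ s, g s • (D s - c) = ∫ s, (D s - c) * g s := by
      congr 1
      funext s
      rw [smul_eq_mul, mul_comm]
    rw [e4, ← e3, e2]
    rw [e1] at e
    linarith

/-- The lemma of du Bois-Reymond. -/
theorem eq_add_integral_of_weak_deriv {U W : ℝ → ℝ} (hab : a < b) (hU : Continuous U)
    (hW : Continuous W)
    (H : ∀ ψ : ℝ → ℝ, ContDiff ℝ ∞ ψ → tsupport ψ ⊆ Ioo a b →
      ∫ s in a..b, (U s * deriv ψ s + W s * ψ s) = 0) :
    ∀ s ∈ Icc a b, U s = U a + ∫ r in a..s, W r := by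
  have hd : ∀ s, HasDerivAt (fun u => ∫ r in a..u, W r) (W s) s := fun s =>
    intervalIntegral.integral_hasDerivAt_right (hW.intervalIntegrable _ _)
      hW.aestronglyMeasurable.stronglyMeasurableAtFilter hW.continuousAt
  have hG : Continuous fun u => ∫ r in a..u, W r :=
    continuous_iff_continuousAt.2 fun s => (hd s).continuousAt
  -- Integration by parts moves `W` onto its primitive, so `U - ∫ W` integrates to zero against
  -- every `ψ'` and is constant.
  obtain ⟨c, hc⟩ := eqOn_const_of_integral_mul_deriv_eq_zero hab (hU.sub hG) (fun ψ hψ hs => by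
    have hψ' : Continuous (deriv ψ) := (contDiff_infty_iff_deriv.1 hψ).2.continuous
    have z : ∀ s ∉ Ioo a b, ψ s = 0 := fun s hn =>
      image_eq_zero_of_notMem_tsupport fun hm => hn (hs hm)
    have ig : ∀ u v : ℝ → ℝ, Continuous u → Continuous v →
      IntervalIntegrable (fun s => u s * v s) volume a b := fun u v hu hv =>
        (hu.mul hv).intervalIntegrable _ _
    have parts := intervalIntegral.integral_mul_deriv_eq_deriv_mul (a := a) (b := b)
      (fun s _ => hd s)
      (fun s _ => ((contDiff_infty_iff_deriv.1 hψ).1 s).hasDerivAt)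
      (hW.intervalIntegrable _ _) (hψ'.intervalIntegrable _ _)
    rw [z a (by simp), z b (by simp)] at parts
    have e := H ψ hψ hs
    rw [intervalIntegral.integral_add (ig _ _ hU hψ') (ig _ _ hW hψ.continuous)] at e
    have e2 : ∫ s in a..b, (U - fun u => ∫ r in a..u, W r) s * deriv ψ s =
        (∫ s in a..b, U s * deriv ψ s) - ∫ s in a..b, (∫ r in a..s, W r) * deriv ψ s := by
      rw [← intervalIntegral.integral_sub (ig _ _ hU hψ') (ig _ _ hG hψ')]
      refine intervalIntegral.integral_congr fun s _ => ?_
      simp only [Pi.sub_apply]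
      ring
    rw [e2, parts]
    linarith)
  intro s hs
  have h1 := hc hs
  have h2 := hc (left_mem_Icc.2 hab.le)
  simp only [Pi.sub_apply, intervalIntegral.integral_same] at h1 h2
  linarith

/-- Testing against fixed vectors `v` reduces to the scalar case and gives `u = u(a) + ∫ w`.
Constant extension beyond `[a, b]` keeps the integrand continuous, so the integral is differentiable
at the end-points too. -/
theorem hasDerivWithinAt_of_weak_deriv {F : Type*} [NormedAddCommGroup F] [NormedSpace ℝ F]
    {u w : ℝ → F →L[ℝ] ℝ} (hab : a < b) (hu : ContinuousOn u (Icc a b))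
    (hw : ContinuousOn w (Icc a b))
    (H : ∀ v : F, ∀ ψ : ℝ → ℝ, ContDiff ℝ ∞ ψ → tsupport ψ ⊆ Ioo a b →
      ∫ s in Ioo a b, (u s v * deriv ψ s + w s v * ψ s) = 0) {s : ℝ} (hs : s ∈ Icc a b) :
    HasDerivWithinAt u (w s) (Icc a b) s := by
  have hu' : Continuous (IccExtend hab.le ((Icc a b).restrict u)) :=
    (continuousOn_iff_continuous_domRestrict.1 hu).Icc_extend'
  have hw' : Continuous (IccExtend hab.le ((Icc a b).restrict w)) :=
    (continuousOn_iff_continuous_domRestrict.1 hw).Icc_extend'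
  set u' := IccExtend hab.le ((Icc a b).restrict u)
  set w' := IccExtend hab.le ((Icc a b).restrict w)
  have eu : ∀ r ∈ Icc a b, u' r = u r := fun r hr => IccExtend_of_mem _ _ hr
  have ew : ∀ r ∈ Icc a b, w' r = w r := fun r hr => IccExtend_of_mem _ _ hr
  have key : ∀ r ∈ Icc a b, u r = u a + ∫ q in a..r, w' q := by
    intro r hr
    ext v
    have := eq_add_integral_of_weak_deriv hab (U := fun q => u' q v) (W := fun q => w' q v)
      (hu'.clm_apply continuous_const) (hw'.clm_apply continuous_const) (fun ψ hψ hs => by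
        rw [← H v ψ hψ hs, intervalIntegral.integral_of_le hab.le, integral_Ioc_eq_integral_Ioo]
        refine setIntegral_congr_fun measurableSet_Ioo fun q hq => ?_
        simp only [eu q (Ioo_subset_Icc_self hq), ew q (Ioo_subset_Icc_self hq)]) r hr
    rw [_root_.add_apply, ContinuousLinearMap.intervalIntegral_apply
      (hw'.intervalIntegrable _ _), ← eu r hr, ← eu a (left_mem_Icc.2 hab.le)]
    exact this
  have hd : HasDerivAt (fun r => ∫ q in a..r, w' q) (w' s) s :=
    intervalIntegral.integral_hasDerivAt_right (hw'.intervalIntegrable _ _)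
      hw'.aestronglyMeasurable.stronglyMeasurableAtFilter hw'.continuousAt
  rw [← ew s hs]
  exact (hd.hasDerivWithinAt.const_add (u a)).congr key (key s hs)

end DuBoisReymond

/-! ### Localised test sections and the converse; the second variation form. -/

section Algebroid

variable {V : Type*} [NormedAddCommGroup V] [NormedSpace ℝ V]
  {F : Type*} [NormedAddCommGroup F] [NormedSpace ℝ F]
  {M : Type*} [TopologicalSpace M] [ChartedSpace V M]
  {E : M → Type*} [∀ x, AddCommGroup (E x)] [∀ x, Module ℝ (E x)]
  [∀ x, TopologicalSpace (E x)] [TopologicalSpace (TotalSpace F E)]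
  [FiberBundle F E] [VectorBundle ℝ F E] [IsManifold 𝓘(ℝ, V) ∞ M]
  [FiniteDimensional ℝ V] [T2Space M] [ContMDiffVectorBundle ∞ F E 𝓘(ℝ, V)]

variable {x₀ x₁ x : M} {k : ℕ∞} {t₀ t₁ : ℝ} {h : t₀ < t₁} {γ : Icc t₀ t₁ → TotalSpace F E} {s : ℝ}

theorem fderiv_fiberTrans_self (hx : x ∈ coordDomain V F E x₀) :
    fderiv ℝ (fiberTrans V F E x₀ x₀) (extChartAt 𝓘(ℝ, V) x₀ x) = 0 := by
  have e : fiberTrans V F E x₀ x₀ =ᶠ[𝓝 (extChartAt 𝓘(ℝ, V) x₀ x)]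
      fun _ => ContinuousLinearMap.id ℝ F := by
    filter_upwards [eventually_coordDomain hx] with q hq
    ext u
    have e1 := fiberTrans_fiberCoord hq.1 hq.1
      ((trivializationAt F E x₀).symmL ℝ ((extChartAt 𝓘(ℝ, V) x₀).symm q) u)
    rwa [fiberCoord_symmL hq.1, hq.2] at e1
  rw [e.fderiv_eq, fderiv_fun_const]
  rfl

variable [FiniteDimensional ℝ F] {A : SkewAlgebroid V F E} {η ξ : ∀ t, E (γ t).proj}
  {L : TotalSpace F E → ℝ} {φ : SmoothPartitionOfUnity M 𝓘(ℝ, ℝ) ℝ univ}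

open CoordAlgebroid

namespace SkewAlgebroid

/-- The section `ψ(t) u(γ(t))` along a curve, where `u` is constant in the coordinates at `x₀`. -/
def bumpSection (γ : Icc t₀ t₁ → TotalSpace F E) (x₀ : M) (ψ : ℝ → ℝ) (v : F) (t : Icc t₀ t₁) :
    E (γ t).proj :=
  ψ t • constSection V E x₀ v (γ t).proj

omit [FiniteDimensional ℝ F] in
theorem isCkCurve_bumpSection (hγ : IsCkCurve V k h γ) {ψ : ℝ → ℝ} (hψ : ContDiff ℝ ∞ ψ) (v : F) :
    IsCkCurve V k h (sectionCurve (bumpSection (V := V) γ x₀ ψ v)) := by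
  intro t ht
  have le : (k : WithTop ℕ∞) ≤ ∞ := by exact_mod_cast le_top
  have h1 := (contMDiffWithinAt_totalSpace.1 (hγ t ht)).1
  have h2 := ((constSection V E x₀ v).contMDiff.of_le le).contMDiffAt.comp_contMDiffWithinAt t h1
  have h3 := contMDiffWithinAt_totalSpace.1 h2
  have h4 : ContMDiffWithinAt 𝓘(ℝ, ℝ) 𝓘(ℝ, ℝ) k ψ (Icc t₀ t₁) t :=
    (hψ.of_le le).contMDiff.contMDiffAt.contMDiffWithinAt
  refine contMDiffWithinAt_totalSpace.2 ⟨h1, ?_⟩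
  refine (h4.smul h3.2).congr_of_eventuallyEq_of_mem ?_ ht
  have hc := h1.continuousWithinAt.preimage_mem_nhdsWithin
    ((trivializationAt F E _).open_baseSet.mem_nhds (mem_baseSet_trivializationAt F E _))
  filter_upwards [hc, self_mem_nhdsWithin] with s hs hs'
  -- The section evaluates `ψ` at the projection of `s` to the interval, which is `s` only
  -- propositionally.
  have key : ∀ r : ℝ, r = s → (trivializationAt F E (extendCurve h γ t).proj
      ⟨(extendCurve h γ s).proj, ψ r • constSection V E x₀ v (extendCurve h γ s).proj⟩).2 =
      ψ s • (trivializationAt F E (extendCurve h γ t).proj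
        ⟨(extendCurve h γ s).proj, constSection V E x₀ v (extendCurve h γ s).proj⟩).2 := by
    rintro _ rfl
    exact ((trivializationAt F E _).linear ℝ hs).map_smul _ _
  exact key _ (congrArg Subtype.val (projIcc_of_mem h.le hs'))

omit [FiniteDimensional ℝ F] in
theorem coordCurve_bumpSection {ψ : ℝ → ℝ} {v : F} (hs : s ∈ Icc t₀ t₁)
    (hx : basePath h γ s ∈ coordDomain V F E x₀) :
    (coordCurve V x₀ h (sectionCurve (F := F) (bumpSection (V := V) γ x₀ ψ v)) s).2 = ψ s • v := by
  rw [coordCurve_sectionCurve _ hx]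
  have key : ∀ r : ℝ, r = s → fiberCoord F E x₀ (basePath h γ s)
      (ψ r • constSection V E x₀ v (basePath h γ s)) = ψ s • v := by
    rintro _ rfl
    rw [map_smul, fiberCoord_constSection hx]
  exact key _ (congrArg Subtype.val (projIcc_of_mem h.le hs))

/-- When only the index `x₀` contributes, the glued lift is the horizontal lift of that chart, and
its vertical component there vanishes because the self-transition is constant. -/
theorem gluedComponent_eq_zero_of_single
    (hφ : φ.IsSubordinate (fun i => {s | basePath h γ s ∈ coordDomain V F E i}))
    (hφs : ∀ i ≠ x₀, φ i s = 0) : A.gluedComponent φ h η ξ x₀ s = 0 := by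
  rw [gluedComponent]
  refine (finsum_congr fun i => ?_).trans finsum_zero
  by_cases hi : φ i s = 0
  · rw [hi, zero_smul]
  · obtain rfl : i = x₀ := by
      by_contra hn
      exact hi (hφs i hn)
    have hm := mem_coordDomain_of_ne_zero hφ hi
    rw [coordCurve_fst hm, fderiv_fiberTrans_self hm]
    simp

omit [FiniteDimensional ℝ F] in
theorem derivWithin_coordCurve_snd (hξ : IsCkCurve V k h (sectionCurve ξ)) (hk : 1 ≤ k)
    (hs : s ∈ Icc t₀ t₁) (hx : basePath h γ s ∈ coordDomain V F E x₀) {f : ℝ → F} {f' : F}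
    (hf : HasDerivWithinAt f f' (Icc t₀ t₁) s)
    (e : ∀ᶠ r in 𝓝[Icc t₀ t₁] s, (coordCurve V x₀ h (sectionCurve (F := F) ξ) r).2 = f r) :
    (derivWithin (coordCurve V x₀ h (sectionCurve (F := F) ξ)) (Icc t₀ t₁) s).2 = f' := by
  have u := uniqueDiffWithinAt_Icc_of_mem h hs
  have d := ((hξ.contDiffWithinAt_coordCurve (x₀ := x₀) hs
    hx).differentiableWithinAt_of_one_le hk).hasDerivWithinAt
  rw [← d.prod_snd.derivWithin u]
  exact hf.derivWithin_eq_of_eventuallyEq u hs e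

theorem integrand_eq_zero
    (hφ : φ.IsSubordinate (fun i => {s | basePath h γ s ∈ coordDomain V F E i}))
    (hA : A.IsAlmostLie) (hL : ContMDiff (𝓘(ℝ, V).prod 𝓘(ℝ, F)) 𝓘(ℝ, ℝ) ∞ L)
    (hEL : A.IsELSolution L h γ) (hη : IsCkCurve V k h (sectionCurve η))
    (hξ : IsCkCurve V k h (sectionCurve ξ)) (hγ : IsCkCurve V k h γ) (hk : 1 ≤ k)
    (hξ₀ : ∀ t : Icc t₀ t₁, (t : ℝ) = t₀ ∨ (t : ℝ) = t₁ → ξ t = 0) (hs : s ∈ Icc t₀ t₁)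
    (hz : ∀ᶠ r in 𝓝[Icc t₀ t₁] s, ∀ hr : r ∈ Icc t₀ t₁, ξ ⟨r, hr⟩ = 0) :
    A.secondVariationIntegrand L h γ η (A.gluedLift φ η ξ) s = 0 := by
  have h₀ : basePath h γ s ∈ coordDomain V F E (basePath h γ s) := mem_coordDomain_self _
  have hzs := hz.self_of_nhdsWithin hs hs
  have e1 : (derivWithin (coordCurve V (basePath h γ s) h (sectionCurve (F := F) ξ))
      (Icc t₀ t₁) s).2 = 0 := by
    refine derivWithin_coordCurve_snd hξ hk hs h₀ (hasDerivWithinAt_const s _ (0 : F)) ?_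
    filter_upwards [hz, hγ.eventually_coordDomain hs h₀, self_mem_nhdsWithin] with r hr hr' hr''
      using coordCurve_sectionCurve_eq_zero hr' hr'' (hr hr'')
  have e2 : derivWithin (A.gluedComponent φ h η ξ (basePath h γ s)) (Icc t₀ t₁) s = 0 := by
    refine (hasDerivWithinAt_const s _ (0 : F)).derivWithin_eq_of_eventuallyEq
      (uniqueDiffWithinAt_Icc_of_mem h hs) hs ?_
    filter_upwards [hz, self_mem_nhdsWithin] with r hr hr''
      using gluedComponent_eq_zero hφ hr'' (hr hr'')
  rw [integrand_gluedLift hφ hA hL hEL hη hξ hγ hk hξ₀ hs h₀, e1, e2,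
    gluedComponent_eq_zero hφ hs hzs, coordCurve_sectionCurve_eq_zero h₀ hs hzs]
  simp

/-- For a test section `ψ v` in a single chart the glued lift has zero vertical component nearby, so
only the two terms of the weak Jacobi equation survive. -/
theorem integrand_bumpSection
    (hφ : φ.IsSubordinate (fun i => {s | basePath h γ s ∈ coordDomain V F E i}))
    (hA : A.IsAlmostLie) (hL : ContMDiff (𝓘(ℝ, V).prod 𝓘(ℝ, F)) 𝓘(ℝ, ℝ) ∞ L)
    (hEL : A.IsELSolution L h γ) (hη : IsCkCurve V k h (sectionCurve η))
    (hγ : IsCkCurve V k h γ) (hk : 1 ≤ k) {ψ : ℝ → ℝ} (hψ : ContDiff ℝ ∞ ψ) {v : F}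
    (hξ₀ : ∀ t : Icc t₀ t₁, (t : ℝ) = t₀ ∨ (t : ℝ) = t₁ → bumpSection (V := V) γ x₀ ψ v t = 0)
    (hs : s ∈ Icc t₀ t₁) (hx : basePath h γ s ∈ coordDomain V F E x₀)
    (hφs : ∀ᶠ r in 𝓝 s, ∀ i ≠ x₀, φ i r = 0) :
    A.secondVariationIntegrand L h γ η (A.gluedLift φ η (bumpSection (V := V) γ x₀ ψ v)) s =
      fderiv ℝ (momentum (coordLagrangian V L x₀)) (coordCurve V x₀ h γ s)
          (A.coordVariation x₀ h γ η s) v * deriv ψ s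
        + fderiv ℝ ((A.coord x₀).force (coordLagrangian V L x₀)) (coordCurve V x₀ h γ s)
          (A.coordVariation x₀ h γ η s) v * ψ s := by
  have hξ := isCkCurve_bumpSection (x₀ := x₀) hγ hψ v
  have e1 : (derivWithin (coordCurve V x₀ h (sectionCurve (F := F) (bumpSection (V := V) γ x₀ ψ v)))
      (Icc t₀ t₁) s).2 = deriv ψ s • v := by
    refine derivWithin_coordCurve_snd hξ hk hs hx
      (((contDiff_infty_iff_deriv.1 hψ).1 s).hasDerivAt.smul_const v).hasDerivWithinAt ?_
    filter_upwards [hγ.eventually_coordDomain hs hx, self_mem_nhdsWithin] with r hr hr'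
      using coordCurve_bumpSection hr' hr
  have e2 : derivWithin (A.gluedComponent φ h η (bumpSection (V := V) γ x₀ ψ v) x₀)
      (Icc t₀ t₁) s = 0 := by
    refine (hasDerivWithinAt_const s _ (0 : F)).derivWithin_eq_of_eventuallyEq
      (uniqueDiffWithinAt_Icc_of_mem h hs) hs ?_
    filter_upwards [mem_nhdsWithin_of_mem_nhds hφs] with r hr
      using gluedComponent_eq_zero_of_single hφ hr
  rw [integrand_gluedLift hφ hA hL hEL hη hξ hγ hk hξ₀ hs hx, e1, e2,
    gluedComponent_eq_zero_of_single hφ hφs.self_of_nhds, coordCurve_bumpSection hs hx]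
  simp only [map_smul, map_zero, add_zero, smul_eq_mul]
  ring

theorem exists_Icc_coordDomain (hγ : IsCkCurve V k h γ) (hs : s ∈ Icc t₀ t₁) :
    ∃ a b, a < b ∧ s ∈ Icc a b ∧ Icc a b ⊆ Icc t₀ t₁ ∧ Icc a b ∈ 𝓝[Icc t₀ t₁] s ∧
      ∀ r ∈ Icc a b, basePath h γ r ∈ coordDomain V F E (basePath h γ s) := by
  have hn : {r | basePath h γ r ∈ coordDomain V F E (basePath h γ s)} ∈ 𝓝 s :=
    (continuous_basePath hγ).continuousAt (coordDomain_mem_nhds (mem_coordDomain_self _))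
  obtain ⟨ε, hε, hb⟩ := Metric.nhds_basis_closedBall.mem_iff.1 hn
  rw [Real.closedBall_eq_Icc] at hb
  refine ⟨max t₀ (s - ε), min t₁ (s + ε), ?_, ?_, ?_, ?_, ?_⟩
  · exact max_lt (lt_min h (by linarith [hs.1])) (lt_min (by linarith [hs.2]) (by linarith))
  · exact ⟨max_le hs.1 (by linarith), le_min hs.2 (by linarith)⟩
  · exact Icc_subset_Icc (le_max_left _ _) (min_le_left _ _)
  · have e := Icc_inter_Icc (a₁ := t₀) (b₁ := t₁) (a₂ := s - ε) (b₂ := s + ε)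
    rw [← e]
    exact Filter.inter_mem self_mem_nhdsWithin (mem_nhdsWithin_of_mem_nhds
      (Icc_mem_nhds (by linarith) (by linarith)))
  · exact fun r hr => hb (Icc_subset_Icc (le_max_right _ _) (min_le_right _ _) hr)

open MeasureTheory in
-- Near each time the curve stays in one chart during some interval `[a, b]`. Sections `ψ v` with
-- `ψ` supported inside it turn the hypothesis into the weak form of `d/dt (Dp·δ_ηγ) = DR·δ_ηγ`, and
-- the lemma of du Bois-Reymond makes it strong.
theorem isJacobiField_of_integral_eq_zero (hA : A.IsAlmostLie)
    (hL : ContMDiff (𝓘(ℝ, V).prod 𝓘(ℝ, F)) 𝓘(ℝ, ℝ) ∞ L)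
    (hEL : A.IsELSolution L h γ) (hη : IsCkCurve V k h (sectionCurve η)) (hγ : IsCkCurve V k h γ)
    (hk : 1 ≤ k)
    (H : ∀ ξ : ∀ t, E (γ t).proj, IsCkCurve V k h (sectionCurve ξ) →
      (∀ t : Icc t₀ t₁, (t : ℝ) = t₀ ∨ (t : ℝ) = t₁ → ξ t = 0) →
      ∀ Δ, A.IsGeneratorLift k h γ η ξ Δ →
        ∫ t in t₀..t₁, A.secondVariationIntegrand L h γ η Δ t = 0) :
    A.IsJacobiField L h γ η := by
  rw [isJacobiField_iff hA hL hEL hη hγ hk]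
  intro t ht
  obtain ⟨a, b, hab, htab, hsub, hnhds, hdom⟩ := exists_Icc_coordDomain hγ ht
  set x₀ := basePath h γ t
  have cv : ∀ s ∈ Icc a b, ContinuousWithinAt (coordCurve V x₀ h γ) (Icc a b) s ∧
      ContinuousWithinAt (A.coordVariation x₀ h γ η) (Icc a b) s := fun s hs =>
    ⟨(hγ.contDiffWithinAt_coordCurve (hsub hs) (hdom s hs)).continuousWithinAt.mono hsub,
      (continuousWithinAt_coordVariation hη hγ hk (hsub hs) (hdom s hs)).mono hsub⟩
  refine HasDerivWithinAt.mono_of_mem_nhdsWithin (t := Icc a b) ?_ hnhds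
  refine hasDerivWithinAt_of_weak_deriv (w := fun s =>
    fderiv ℝ ((A.coord x₀).force (coordLagrangian V L x₀)) (coordCurve V x₀ h γ s)
      (A.coordVariation x₀ h γ η s)) hab ?_ ?_ ?_ htab
  · intro s hs
    exact ((contDiffAt_momentum (contDiffAt_coordLagrangian_coordCurve hL
      (hdom s hs))).fderiv_infty.continuousAt.comp_continuousWithinAt (cv s hs).1).clm_apply
      (cv s hs).2
  · intro s hs
    exact (((A.smoothAt_coordCurve (hdom s hs)).contDiffAt_force
      (contDiffAt_coordLagrangian_coordCurve hL
        (hdom s hs))).fderiv_infty.continuousAt.comp_continuousWithinAt (cv s hs).1).clm_apply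
      (cv s hs).2
  · intro v ψ hψ hψs
    have hz : ∀ r ∉ Ioo a b, ∀ᶠ q in 𝓝 r, ψ q = 0 := by
      intro r hr
      have : ∀ᶠ q in 𝓝 r, q ∉ tsupport ψ :=
        (isClosed_tsupport _).isOpen_compl.mem_nhds fun hm => hr (hψs hm)
      filter_upwards [this] with q hq using image_eq_zero_of_notMem_tsupport hq
    have hat : t₀ ≤ a ∧ b ≤ t₁ :=
      ⟨(hsub (left_mem_Icc.2 hab.le)).1, (hsub (right_mem_Icc.2 hab.le)).2⟩
    have hξ := isCkCurve_bumpSection (x₀ := x₀) hγ hψ v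
    have hξ₀ : ∀ r : Icc t₀ t₁, (r : ℝ) = t₀ ∨ (r : ℝ) = t₁ →
        bumpSection (V := V) γ x₀ ψ v r = 0 := by
      intro r hr
      have : (r : ℝ) ∉ Ioo a b := by
        rintro ⟨h1, h2⟩
        rcases hr with hr | hr <;> linarith
      rw [bumpSection, (hz r this).self_of_nhds, zero_smul]
    -- The partition reduces to the index `x₀` on `[a, b]`, which removes the vertical component
    -- from the integrand there.
    obtain ⟨φ, hφ, hφJ⟩ := exists_partition hγ x₀ isClosed_Icc hdom
    have h1 := H _ hξ hξ₀ _ (isGeneratorLift_gluedLift (A := A) hφ hη hξ hγ hξ₀)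
    -- Outside `(a, b)` the test section vanishes locally, hence so does the integrand, and the
    -- integral shrinks to `(a, b)`.
    rw [intervalIntegral.integral_of_le h.le, integral_Ioc_eq_integral_Ioo,
      setIntegral_eq_of_subset_of_forall_sdiff_eq_zero measurableSet_Ioo
        (Ioo_subset_Ioo hat.1 hat.2)] at h1
    · rw [← h1]
      refine setIntegral_congr_fun measurableSet_Ioo fun s hs => ?_
      have hs' := Ioo_subset_Icc_self hs
      refine (integrand_bumpSection hφ hA hL hEL hη hγ hk hψ hξ₀ (hsub hs') (hdom s hs') ?_).symm
      filter_upwards [Icc_mem_nhds hs.1 hs.2] with r hr using hφJ r hr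
    · intro s hs
      refine integrand_eq_zero hφ hA hL hEL hη hξ hγ hk hξ₀ (Ioo_subset_Icc_self hs.1) ?_
      filter_upwards [mem_nhdsWithin_of_mem_nhds (hz s hs.2)] with r hr hr'
      rw [bumpSection, hr, zero_smul]

theorem exists_isSubordinate (hγ : IsCkCurve V k h γ) :
    ∃ φ : SmoothPartitionOfUnity M 𝓘(ℝ, ℝ) ℝ univ,
      φ.IsSubordinate (fun i => {s | basePath h γ s ∈ coordDomain V F E i}) := by
  obtain ⟨φ, hφ, -⟩ := exists_partition hγ (basePath h γ t₀) isClosed_empty (by simp)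
  exact ⟨φ, hφ⟩

/-- Uniqueness uses only that an admissible lift exists: its integral fixes the value of the form.
-/
theorem existsUnique_isSecondVariation (hA : A.IsAlmostLie)
    (hL : ContMDiff (𝓘(ℝ, V).prod 𝓘(ℝ, F)) 𝓘(ℝ, ℝ) ∞ L)
    (hEL : A.IsELSolution L h γ) (hγ : IsCkCurve V k h γ) (hk : 1 ≤ k) :
    ∃! b : sectionsAlong V k h γ hγ →ₗ[ℝ] sectionsAlongZero V k h γ hγ →ₗ[ℝ] ℝ,
      A.IsSecondVariation L k h γ hγ b := by
  obtain ⟨φ, hφ⟩ := exists_isSubordinate (h := h) hγ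
  refine ⟨_, isSecondVariation_secondVariationForm hφ hA hL hEL hγ hk, fun b hb => ?_⟩
  ext η ξ
  obtain ⟨⟨Δ, hΔ⟩, H⟩ := hb η ξ
  rw [(H Δ hΔ).2, ((isSecondVariation_secondVariationForm hφ hA hL hEL hγ hk η ξ).2 Δ hΔ).2]

variable {hγ : IsCkCurve V k h γ}
  {b : sectionsAlong V k h γ hγ →ₗ[ℝ] sectionsAlongZero V k h γ hγ →ₗ[ℝ] ℝ}

theorem IsSecondVariation.isJacobiField_iff (hb : A.IsSecondVariation L k h γ hγ b)
    (hA : A.IsAlmostLie) (hL : ContMDiff (𝓘(ℝ, V).prod 𝓘(ℝ, F)) 𝓘(ℝ, ℝ) ∞ L)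
    (hEL : A.IsELSolution L h γ) (hk : 1 ≤ k) (η : sectionsAlong V k h γ hγ) :
    A.IsJacobiField L h γ η.1 ↔ ∀ ξ : sectionsAlongZero V k h γ hγ, b η ξ = 0 := by
  constructor
  · intro hJ ξ
    obtain ⟨⟨Δ, hΔ⟩, H⟩ := hb η ξ
    rw [(H Δ hΔ).2]
    exact hJ.integral_eq_zero hA hL hEL η.2 hγ hk hΔ (vanish_of_mem hγ ξ)
  · intro H
    refine isJacobiField_of_integral_eq_zero hA hL hEL η.2 hγ hk fun ξ hξ hξ₀ Δ hΔ => ?_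
    let ξ' : sectionsAlongZero V k h γ hγ := ⟨⟨ξ, hξ⟩, hξ₀ _ (.inl rfl), hξ₀ _ (.inr rfl)⟩
    rw [← ((hb η ξ').2 Δ hΔ).2, H ξ']

theorem IsSecondVariation.symm (hb : A.IsSecondVariation L k h γ hγ b) (hA : A.IsLie)
    (hL : ContMDiff (𝓘(ℝ, V).prod 𝓘(ℝ, F)) 𝓘(ℝ, ℝ) ∞ L)
    (hEL : A.IsELSolution L h γ) (hk : 1 ≤ k) (η ξ : sectionsAlongZero V k h γ hγ) :
    b η.1 ξ = b ξ.1 η := by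
  obtain ⟨⟨Δ, hΔ⟩, H⟩ := hb η.1 ξ
  obtain ⟨⟨Δ', hΔ'⟩, H'⟩ := hb ξ.1 η
  rw [(H Δ hΔ).2, (H' Δ' hΔ').2]
  exact hA.integral_symm hL hEL η.1.2 ξ.1.2 hγ hk hΔ hΔ' (vanish_of_mem hγ η)

theorem IsSecondVariation.ker_eq (hb : A.IsSecondVariation L k h γ hγ b) (hA : A.IsAlmostLie)
    (hL : ContMDiff (𝓘(ℝ, V).prod 𝓘(ℝ, F)) 𝓘(ℝ, ℝ) ∞ L)
    (hEL : A.IsELSolution L h γ) (hk : 1 ≤ k) :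
    (LinearMap.ker (b.domRestrict (sectionsAlongZero V k h γ hγ)) :
      Set (sectionsAlongZero V k h γ hγ)) = A.jacobiFieldsZero L k h γ hγ := by
  ext η
  rw [SetLike.mem_coe, LinearMap.mem_ker]
  refine Iff.trans ?_ (hb.isJacobiField_iff hA hL hEL hk η.1).symm
  exact LinearMap.ext_iff

end SkewAlgebroid

end Algebroid
end

theorem mainTheorem2
    {V : Type*} [NormedAddCommGroup V] [NormedSpace ℝ V] [FiniteDimensional ℝ V]
    {F : Type*} [NormedAddCommGroup F] [NormedSpace ℝ F] [FiniteDimensional ℝ F]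
    {M : Type*} [TopologicalSpace M] [ChartedSpace V M] [IsManifold 𝓘(ℝ, V) ∞ M]
    [T2Space M] [SecondCountableTopology M]
    {E : M → Type*} [∀ x, AddCommGroup (E x)] [∀ x, Module ℝ (E x)]
    [∀ x, TopologicalSpace (E x)] [TopologicalSpace (TotalSpace F E)]
    [FiberBundle F E] [VectorBundle ℝ F E] [ContMDiffVectorBundle ∞ F E 𝓘(ℝ, V)]
    (A : SkewAlgebroid V F E) (hA : A.IsAlmostLie)
    (L : TotalSpace F E → ℝ) (hL : ContMDiff (𝓘(ℝ, V).prod 𝓘(ℝ, F)) 𝓘(ℝ, ℝ) ∞ L)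
    {t₀ t₁ : ℝ} (h : t₀ < t₁) (k : ℕ∞) (hk : 1 ≤ k)
    (γ : Icc t₀ t₁ → TotalSpace F E) (hγ : IsCkCurve V k h γ)
    (hEL : A.IsELSolution L h γ) :
    (∃! b : sectionsAlong V k h γ hγ →ₗ[ℝ] sectionsAlongZero V k h γ hγ →ₗ[ℝ] ℝ,
      A.IsSecondVariation L k h γ hγ b) ∧
    ∀ b : sectionsAlong V k h γ hγ →ₗ[ℝ] sectionsAlongZero V k h γ hγ →ₗ[ℝ] ℝ,
      A.IsSecondVariation L k h γ hγ b →
      (∀ η : sectionsAlong V k h γ hγ,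
        A.IsJacobiField L h γ η.1 ↔ ∀ ξ : sectionsAlongZero V k h γ hγ, b η ξ = 0) ∧
      (A.IsLie →
        (∀ η ξ : sectionsAlongZero V k h γ hγ, b η.1 ξ = b ξ.1 η) ∧
        (LinearMap.ker (b.domRestrict (sectionsAlongZero V k h γ hγ)) :
            Set (sectionsAlongZero V k h γ hγ)) = A.jacobiFieldsZero L k h γ hγ ∧
        Module.rank ℝ (LinearMap.ker (b.domRestrict (sectionsAlongZero V k h γ hγ))) =
          A.conjugateMultiplicity L k h γ hγ ∧
        (A.AreConjugate L k h γ hγ ↔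
          LinearMap.ker (b.domRestrict (sectionsAlongZero V k h γ hγ)) ≠ ⊥)) := by
  refine ⟨SkewAlgebroid.existsUnique_isSecondVariation hA hL hEL hγ hk, fun b hb =>
    ⟨hb.isJacobiField_iff hA hL hEL hk, fun hLie => ?_⟩⟩
  have hker := hb.ker_eq hA hL hEL hk
  refine ⟨hb.symm hLie hL hEL hk, hker, ?_, ?_⟩
  -- The set of Jacobi fields vanishing at the ends is a kernel, hence a subspace equal to its own
  -- span.
  · rw [SkewAlgebroid.conjugateMultiplicity, ← hker, Submodule.span_eq]
  · rw [SkewAlgebroid.AreConjugate, ← hker, Submodule.ne_bot_iff]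
    rfl
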